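/- Let $q\in\mathbb C$ with $0<|q|<1$, fix a logarithm $\ell$ of $q$ and put $q^x=e^{x\ell}$. Let $N\in\mathbb Z$. *Fock space.* Let $\mathcal F$ be the fermionic Fock space of the modes $\psi_r,\psi^\dagger_r$ ($r\in\mathbb Z+\frac12$), $\{\psi_r,\psi^\dagger_s\}=\delta_{r+s,0}$, other anticommutators zero, with vacuum $|0\rangle$ annihilated by all $\psi_r,\psi_r^\dagger$ with $r>0$ (realized as the semi-infinite wedge space), and let $\hat{\mathcal F}$ be its completion (arbitrary formal combinations of the wedge basis). Put $$a_n=-\sum_r:\psi_r\psi^\dagger_{n-r}:,\qquad b_n=-\sum_r q^{n(r+\frac12)}:\psi^\dagger_r\psi_{-r}:+\frac1{1-q^{-n}}\quad(n\neq0),$$ $$\hat w=\sum_r r^2:\psi^\dagger_r\psi_{-r}:,\qquad L_0=\sum_{n>0}a_{-n}a_n .$$ For a Young diagram $\lambda$ with rows $\lambda_i$, columns $\lambda'_i$ and $d$ diagonal boxes, let $$|\lambda\rangle=\prod_{i=1}^{d}\left[(-1)^{-\lambda_i+i}\psi_{-\lambda'_i+i-\frac12}\psi^\dagger_{-\lambda_i+i-\frac12}\right]|0\rangle,$$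 and let $\langle\lambda|$ be its dual with respect to the bilinear form for which the wedge basis is orthonormal. *Vertex.* Let $\rho=(-\frac12,-\frac32,\dots)$, $\kappa_\lambda=\sum_i\lambda_i(\lambda_i-2i+1)$, $f_\lambda=(-1)^{|\lambda|}q^{\kappa_\lambda/2}$, $p_n(x)=\sum_i x_i^n$, let $s_{\lambda/\eta}$ be the skew Schur functions, and $$C_{\lambda\mu\nu}=q^{\frac{\kappa_\mu}2}s_{\nu'}(q^{-\rho})\sum_\eta s_{\lambda'/\eta}(q^{-\nu-\rho})\,s_{\mu/\eta}(q^{-\nu'-\rho}).$$ *Intertwiners.* Define $\tilde\Phi^*$, from the third Fock space to the completed tensor product of the first two, and $\tilde\Phi$, from the tensor product of the first two to the completed third, by $$\tilde\Phi^*=\sum_{\lambda,\mu,\nu}\left((-1)^Nq^{\frac12}\right)^{|\lambda|}f_\lambda^N\left(-q^{-\frac12}\right)^{|\mu|}f_\mu^{-1}\,q^{\frac12|\nu|}\,C_{\nu'\mu\lambda}\;|\lambda\rangle\otimes|\mu\rangle\otimes\langle\nu|,$$ $$\tilde\Phi=\sum_{\lambda,\mu,\nu}\left(-(-1)^Nq^{-\frac12}\right)^{|\lambda|}f_\lambda^{-N}\,q^{\frac12|\mu|}f_\mu\left(-q^{-\frac12}\right)^{|\nu|}C_{\nu\mu'\lambda'}\;\langle\lambda|\otimes\langle\mu|\otimes|\nu\rangle.$$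 *S-dual vacuum.* With $\mathcal N_\varnothing=\mathcal N'_\varnothing=\left[\prod_{i,j>0}(1-q^{i+j-1})^{-1}\right]^{1/2}$ (principal square root), put $$|0\rangle_{\mathcal S}=\mathcal N_\varnothing\exp\left[-\sum_{n>0}\frac{a_{-n}}n p_n(q^{-\rho-\frac12})\right]|0\rangle,\qquad {}_{\mathcal S}\langle0|=\mathcal N'_\varnothing\langle0|\exp\left[\sum_{n>0}\frac{a_n}n p_n(q^{-\rho+\frac12})\right].$$ **Theorem.** Writing $X^{(i)}$ for an operator $X$ acting on the $i$-th Fock space, and likewise for vectors, $$\tilde\Phi^*=\mathcal N_\varnothing^{-1}\;{}^3\langle0|\exp\left[\sum_{n>0}\frac1n\left(-(-1)^nb_n^{(1)}a_n^{(3)}+a_{-n}^{(2)}a_n^{(3)}+(-1)^nb_{-n}^{(1)}a_{-n}^{(2)}\right)\right]q^{\frac N2\hat w^{(1)}}q^{L_0^{(1)}}|0\rangle^1_{\mathcal S}|0\rangle^2,$$ $$\tilde\Phi=\mathcal N_\varnothing^{-1}\;{}^2\langle0|\;{}^1_{\mathcal S}\langle0|\,q^{-L_0^{(1)}}q^{-\frac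 N2\hat w^{(1)}}\exp\left[\sum_{n>0}\frac1n\left((-1)^nb_n^{(1)}a_n^{(2)}+a_n^{(2)}a_{-n}^{(3)}-(-1)^nb_{-n}^{(1)}a_{-n}^{(3)}\right)\right]|0\rangle^3 .$$ -/

import Mathlib

open scoped Nat

noncomputable section

namespace FreeFermion

/-! ### Powers of `q`

Throughout, `q = exp ℓ`, where `ℓ` is a chosen logarithm of `q`; the choice fixes every fractional
power of `q`. -/

/-- The power `q ^ x`, where `q = exp ℓ`. -/
def qPow (ℓ x : ℂ) : ℂ := Complex.exp (x * ℓ)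

/-! ### The fermionic Fock space -/

/-- A Maya diagram, that is, a set of occupied half-integers which differs in only finitely many
places from the set of all negative half-integers. The integer `k` stands for the half-integer
`k + 1/2`. -/
@[ext] structure Maya where
  occ : Set ℤ
  finite_diff : {k : ℤ | (0 ≤ k ∧ k ∈ occ) ∨ (k < 0 ∧ k ∉ occ)}.Finite

namespace Maya

/-- The vacuum: exactly the negative positions are occupied. -/
def vac : Maya where
  occ := {k | k < 0}
  finite_diff := by
    convert Set.finite_empty (α := ℤ)
    ext k
    simp only [Set.mem_ofPred_eq, Set.mem_empty_iff_false, iff_false]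
    omega

/-- Occupy the position `k`. -/
def insert (S : Maya) (k : ℤ) : Maya where
  occ := S.occ ∪ {k}
  finite_diff := by
    refine (S.finite_diff.union (Set.finite_singleton k)).subset ?_
    intro j hj
    simp only [Set.mem_ofPred_eq, Set.mem_union, Set.mem_singleton_iff] at hj ⊢
    tauto

/-- Vacate the position `k`. -/
def erase (S : Maya) (k : ℤ) : Maya where
  occ := S.occ \ {k}
  finite_diff := by
    refine (S.finite_diff.union (Set.finite_singleton k)).subset ?_
    intro j hj
    simp only [Set.mem_ofPred_eq, Set.mem_union, Set.mem_singleton_iff, Set.mem_sdiff] at hj ⊢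
    tauto

/-- The fermionic sign `(-1) ^ #{s ∈ S : s > k}`. -/
def sgn (S : Maya) (k : ℤ) : ℂ := (-1) ^ {s | s ∈ S.occ ∧ k < s}.ncard

end Maya

/-- Operators on the space of functions `X → ℂ`. For `X = Maya` the functions are the (formal,
possibly infinite) linear combinations of Maya diagrams, the function `w` being the vector whose
component along the diagram `S` is `w S`; thus `Maya → ℂ` is the completed Fock space and
`Maya →₀ ℂ` is the Fock space itself. For `X = Maya × Maya × Maya` they are the elements of the
completed threefold tensor product. Infinite sums of vectors are taken componentwise. -/
abbrev Op (X : Type) : Type := (X → ℂ) → (X → ℂ)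

open Classical in
/-- The vacuum vector `|0⟩`. -/
def vacuum : Maya → ℂ := fun S => if S = Maya.vac then 1 else 0

open Classical in
/-- The fermion mode `ψ_r`, `r = k + 1/2`: contraction with the half-integer `r` in the
semi-infinite wedge. -/
def psi (k : ℤ) : Op Maya := fun w S =>
  if k ∈ S.occ then 0 else S.sgn k * w (S.insert k)

open Classical in
/-- The fermion mode `ψ†_r`, `r = k + 1/2`: exterior multiplication by the half-integer
`-r = (-k - 1) + 1/2` in the semi-infinite wedge, so that `{ψ_r, ψ†_s} = δ_{r+s,0}`. -/
def psiDag (k : ℤ) : Op Maya := fun w S =>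
  if -k - 1 ∈ S.occ then S.sgn (-k - 1) * w (S.erase (-k - 1)) else 0

/-- The normally ordered product `:ψ_r ψ†_s:` with `r = j + 1/2`, `s = k + 1/2`; modes of positive
index annihilate the vacuum and stand on the right. -/
def nordPsiPsiDag (j k : ℤ) : Op Maya := fun w =>
  if 0 ≤ k then psi j (psiDag k w) else -(psiDag k (psi j w))

/-- The normally ordered product `:ψ†_r ψ_s:` with `r = j + 1/2`, `s = k + 1/2`. -/
def nordPsiDagPsi (j k : ℤ) : Op Maya := fun w =>
  if 0 ≤ k then psiDag j (psi k w) else -(psi k (psiDag j w))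

/-- The bosonic oscillator `a_n = - ∑_r :ψ_r ψ†_{n-r}:`. -/
def aMode (n : ℤ) : Op Maya := fun w S => -∑' k : ℤ, nordPsiPsiDag k (n - k - 1) w S

/-- The commuting oscillator
`b_n = - ∑_r q ^ (n (r + 1/2)) :ψ†_r ψ_{-r}: + 1 / (1 - q ^ (-n))`, `n ≠ 0`. -/
def bMode (ℓ : ℂ) (n : ℤ) : Op Maya := fun w S =>
  -(∑' k : ℤ, qPow ℓ ((n * (k + 1) : ℤ) : ℂ) * nordPsiDagPsi k (-k - 1) w S)
    + (1 / (1 - qPow ℓ (-n))) * w S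

/-- The operator `ŵ = ∑_r r² :ψ†_r ψ_{-r}:`. -/
def wHat : Op Maya := fun w S =>
  ∑' k : ℤ, ((k : ℂ) + 1 / 2) ^ 2 * nordPsiDagPsi k (-k - 1) w S

/-- The degree operator `L₀ = ∑_{n > 0} a_{-n} a_n`. -/
def L0 : Op Maya := fun w S => ∑' n : ℕ+, aMode (-(n : ℤ)) (aMode (n : ℤ) w) S

/-- The exponential `exp A = ∑_k A ^ k / k!` of an operator. -/
def opExp {X : Type} (A : Op X) : Op X := fun w x => ∑' k : ℕ, (k ! : ℂ)⁻¹ * (A^[k] w) x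

/-- The operator `q ^ (c A) = exp (c log q · A)`. -/
def qOp (ℓ c : ℂ) (A : Op Maya) : Op Maya := opExp (fun w => (c * ℓ) • A w)

/-- The pairing `⟨u| w⟩` for which the Maya diagrams are orthonormal. -/
def bra (u w : Maya → ℂ) : ℂ := ∑' S : Maya, u S * w S

/-! ### Young diagrams

The `i`-th row and column, `i = 1, 2, …`, of a diagram `lam` have lengths `lam.rowLen (i - 1)` and
`lam.colLen (i - 1)`. -/

/-- The number of diagonal boxes. -/
def diagLen (lam : YoungDiagram) : ℕ :=
  ((Finset.range lam.card).filter fun i => (i, i) ∈ lam).card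

/-- `κ_lam = ∑_i lam_i (lam_i - 2 i + 1)`, an even integer. -/
def kappa (lam : YoungDiagram) : ℤ :=
  ∑ i ∈ Finset.range (lam.colLen 0), (lam.rowLen i : ℤ) * (lam.rowLen i - 2 * (i + 1) + 1)

/-- The standard basis vector
`|lam⟩ = ∏_{i=1}^{diag} (-1) ^ (-lam_i + i) ψ_{-lam'_i+i-1/2} ψ†_{-lam_i+i-1/2} |0⟩`. -/
def ket (lam : YoungDiagram) : Maya → ℂ :=
  (List.range (diagLen lam)).foldr
    (fun i w => ((-1 : ℂ) ^ (-(lam.rowLen i : ℤ) + (i + 1))) •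
      psi (-(lam.colLen i : ℤ) + i) (psiDag (-(lam.rowLen i : ℤ) + i) w))
    vacuum

/-! ### Symmetric functions of a summable sequence of complex numbers -/

/-- The power sum `p_n(x)`. -/
def powerSum (n : ℕ) (x : ℕ → ℂ) : ℂ := ∑' i : ℕ, x i ^ n

/-- The complete homogeneous symmetric function `h_n(x)`: the sum of all monomials of degree `n`
if `n ≥ 0`, and zero if `n < 0`. -/
def hsym (x : ℕ → ℂ) : ℤ → ℂ
  | Int.ofNat n => ∑' s : Sym ℕ n, ((s : Multiset ℕ).map x).prod
  | Int.negSucc _ => 0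

/-- The skew Schur function `s_{lam/eta}(x) = det (h_{lam_i - eta_j - i + j}(x))`, the determinant
having at least as many rows as `lam` and `eta`. It vanishes unless `eta ⊆ lam`. -/
def skewSchur (lam eta : YoungDiagram) (x : ℕ → ℂ) : ℂ :=
  Matrix.det (Matrix.of fun i j : Fin (max (lam.colLen 0) (eta.colLen 0)) =>
    hsym x ((lam.rowLen i : ℤ) - eta.rowLen j - (i : ℕ) + (j : ℕ)))

/-- The sequence `q ^ (-lam - ρ + c)`, where `ρ = (-1/2, -3/2, …)`. -/
def spec (ℓ : ℂ) (lam : YoungDiagram) (c : ℂ) : ℕ → ℂ :=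
  fun i => qPow ℓ (-(lam.rowLen i : ℂ) + (i + 1 / 2) + c)

/-! ### The topological vertex and the intertwiners -/

/-- `q ^ (κ_lam / 2)`. -/
def qKappa (ℓ : ℂ) (lam : YoungDiagram) : ℂ := qPow ℓ ((kappa lam : ℂ) / 2)

/-- The topological vertex `C_{lam mu nu}`. -/
def vertexC (ℓ : ℂ) (lam mu nu : YoungDiagram) : ℂ :=
  qKappa ℓ mu * skewSchur nu.transpose ⊥ (spec ℓ ⊥ 0) *
    ∑' eta : YoungDiagram,
      skewSchur lam.transpose eta (spec ℓ nu 0) * skewSchur mu eta (spec ℓ nu.transpose 0)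

/-- The frame factor `f_lam = (-1) ^ |lam| q ^ (κ_lam / 2)`. -/
def frame (ℓ : ℂ) (lam : YoungDiagram) : ℂ := (-1) ^ lam.card * qKappa ℓ lam

/-- The coefficient of `|lam⟩ ⊗ |mu⟩ ⊗ ⟨nu|` in the intertwiner `Φ*`. -/
def phiStarCoeff (ℓ : ℂ) (N : ℤ) (lam mu nu : YoungDiagram) : ℂ :=
  ((-1) ^ N * qPow ℓ (1 / 2)) ^ lam.card * frame ℓ lam ^ N *
    ((-qPow ℓ (-1 / 2)) ^ mu.card * (frame ℓ mu)⁻¹) *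
    qPow ℓ (1 / 2) ^ nu.card * vertexC ℓ nu.transpose mu lam

/-- The coefficient of `⟨lam| ⊗ ⟨mu| ⊗ |nu⟩` in the intertwiner `Φ`. -/
def phiCoeff (ℓ : ℂ) (N : ℤ) (lam mu nu : YoungDiagram) : ℂ :=
  (-(-1) ^ N * qPow ℓ (-1 / 2)) ^ lam.card * frame ℓ lam ^ (-N) *
    (qPow ℓ (1 / 2) ^ mu.card * frame ℓ mu) *
    (-qPow ℓ (-1 / 2)) ^ nu.card * vertexC ℓ nu mu.transpose lam.transpose

/-- The intertwiner `Φ* = ∑ phiStarCoeff |lam⟩ ⊗ |mu⟩ ⊗ ⟨nu|`, from the third Fock space to the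
completed tensor product of the first two. -/
def PhiStar (ℓ : ℂ) (N : ℤ) (v : Maya →₀ ℂ) : Maya × Maya → ℂ := fun x =>
  ∑' t : YoungDiagram × YoungDiagram × YoungDiagram,
    phiStarCoeff ℓ N t.1 t.2.1 t.2.2 * (ket t.1 x.1 * ket t.2.1 x.2 * bra (ket t.2.2) v)

/-- The intertwiner `Φ = ∑ phiCoeff ⟨lam| ⊗ ⟨mu| ⊗ |nu⟩`, from the tensor product of the first two
Fock spaces to the completed third one. -/
def Phi (ℓ : ℂ) (N : ℤ) (v : Maya × Maya →₀ ℂ) : Maya → ℂ := fun R =>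
  ∑' t : YoungDiagram × YoungDiagram × YoungDiagram,
    phiCoeff ℓ N t.1 t.2.1 t.2.2 *
      (bra (ket t.1) (fun S => bra (ket t.2.1) (fun T => v (S, T))) * ket t.2.2 R)

/-! ### The S-dual basis -/

/-- `∏_{i,j > 0} (1 - q ^ (-lam_i - lam'_j + i + j - 1))⁻¹`. -/
def hookProd (ℓ : ℂ) (lam : YoungDiagram) : ℂ :=
  ∏' p : ℕ × ℕ,
    (1 - qPow ℓ (-(lam.rowLen p.1 : ℂ) - lam.colLen p.2 + (p.1 + 1) + (p.2 + 1) - 1))⁻¹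

/-- The normalizing constant `𝒩_lam` of the S-dual ket. -/
def normKet (ℓ : ℂ) (lam : YoungDiagram) : ℂ :=
  ((-1) ^ lam.card * qPow ℓ ((kappa lam : ℂ) / 2 - lam.card) * hookProd ℓ lam) ^ (1 / 2 : ℂ)

/-- The normalizing constant `𝒩'_lam` of the S-dual bra. -/
def normBra (ℓ : ℂ) (lam : YoungDiagram) : ℂ :=
  (-1) ^ lam.card *
    ((-1) ^ lam.card * qPow ℓ (-(kappa lam : ℂ) / 2 + lam.card) * hookProd ℓ lam) ^ (1 / 2 : ℂ)

/-- The S-dual ket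
`|lam⟩_S = 𝒩_lam exp (-∑_{n>0} (a_{-n} / n) p_n(q ^ (-lam' - ρ - 1/2))) |0⟩`. -/
def sKet (ℓ : ℂ) (lam : YoungDiagram) : Maya → ℂ :=
  normKet ℓ lam • opExp
    (fun w S => -∑' n : ℕ+, (1 / (n : ℂ)) *
      (powerSum n (spec ℓ lam.transpose (-1 / 2)) * aMode (-(n : ℤ)) w S)) vacuum

/-- The S-dual bra
`_S⟨lam| = 𝒩'_lam ⟨0| exp (∑_{n>0} (a_n / n) p_n(q ^ (-lam - ρ + 1/2)))`, applied to `w`. -/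
def sBra (ℓ : ℂ) (lam : YoungDiagram) (w : Maya → ℂ) : ℂ :=
  normBra ℓ lam * bra vacuum (opExp
    (fun w S => ∑' n : ℕ+, (1 / (n : ℂ)) *
      (powerSum n (spec ℓ lam (1 / 2)) * aMode (n : ℤ) w S)) w)

/-! ### Three Fock spaces -/

/-- The operator `A` acting on the first Fock space. -/
def on1 (A : Op Maya) : Op (Maya × Maya × Maya) := fun w x =>
  A (fun S => w (S, x.2.1, x.2.2)) x.1

/-- The operator `A` acting on the second Fock space. -/
def on2 (A : Op Maya) : Op (Maya × Maya × Maya) := fun w x =>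
  A (fun T => w (x.1, T, x.2.2)) x.2.1

/-- The operator `A` acting on the third Fock space. -/
def on3 (A : Op Maya) : Op (Maya × Maya × Maya) := fun w x =>
  A (fun R => w (x.1, x.2.1, R)) x.2.2

/-- The operator
`∑_{n>0} (1/n) (-(-1)^n b_n^(1) a_n^(3) + a_{-n}^(2) a_n^(3) + (-1)^n b_{-n}^(1) a_{-n}^(2))`. -/
def bilinStar (ℓ : ℂ) : Op (Maya × Maya × Maya) := fun w x =>
  ∑' n : ℕ+, (1 / (n : ℂ)) *
    (-(-1) ^ (n : ℕ) * on1 (bMode ℓ n) (on3 (aMode n) w) x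
      + on2 (aMode (-(n : ℤ))) (on3 (aMode n) w) x
      + (-1) ^ (n : ℕ) * on1 (bMode ℓ (-(n : ℤ))) (on2 (aMode (-(n : ℤ))) w) x)

/-- The operator
`∑_{n>0} (1/n) ((-1)^n b_n^(1) a_n^(2) + a_n^(2) a_{-n}^(3) - (-1)^n b_{-n}^(1) a_{-n}^(3))`. -/
def bilin (ℓ : ℂ) : Op (Maya × Maya × Maya) := fun w x =>
  ∑' n : ℕ+, (1 / (n : ℂ)) *
    ((-1) ^ (n : ℕ) * on1 (bMode ℓ n) (on2 (aMode n) w) x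
      + on2 (aMode n) (on3 (aMode (-(n : ℤ))) w) x
      - (-1) ^ (n : ℕ) * on1 (bMode ℓ (-(n : ℤ))) (on3 (aMode (-(n : ℤ))) w) x)

end FreeFermion

end

open FreeFermion

noncomputable section
namespace FreeFermion

/-! ### Inserting and erasing particles, with signs. -/

namespace Maya

/-! On the first Fock space b_n, ŵ and L₀ are all diagonal in the wedge basis. Freezing the first
component at a diagram λ therefore turns b_n and b_{-n} (n > 0) into the scalars -p_n(q^{-λ-ρ+1/2})
and p_n(q^{-λ'-ρ-1/2}) (`bEigen_pos`, `bEigen_neg`), while q^{±(N/2)ŵ} and q^{±L₀} become the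
framing factors in κ_λ and |λ|.

What remains is the exponential of Σ (α_n a_n + a_{-n} a_n / n + β_n a_{-n}) on two Fock spaces,
where a_{-n} acts on a factor that starts in the vacuum and a_n on a factor that ends in it. Between
these vacua the kernel exp Σ a_{-n} a_n / n copies a vector from one factor to the other, so the
result is exp(Σ β_n a_{-n}) exp(Σ α_n a_n) v (`exp_pairEnd_apply`, `opExp_pairOp`). The proof
compares two recursions in the degree. They agree because L₀ = Σ a_{-n} a_n is the degree operator
(`L0_apply`), which holds since the two-particle terms cancel in pairs.

The matrix elements of exp(Σ p_n(x) a_{-n} / n) in the wedge basis are the skew Schur functions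
s_{λ/η}(x). This is a Jacobi–Trudi formula (`IsSkewMatrix.eq_det`): commuting with the degree gives
a recursion for the exponential, and Newton's identities give the same recursion for the
determinants. Inserting the intermediate states η between the two exponentials yields the sum over η
in the vertex. The remaining factor, s_{λ'}(q^{-ρ}) or s_λ(q^{-ρ}), is the coefficient along λ of
the S-dual vacuum (`sKet_bot_mayaOf`, `sBra_bot`). A minus sign (-1)^{n-1} in the power sums
transposes diagrams (`oscMatrix_transpose`), which accounts for the transposes in the vertex.

All analysis reduces to finite sums: an oscillator involves finitely many moves at each component,
and for given data only diagrams with at most K boxes matter, where the operators are nilpotent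
matrices. Components of non-zero charge vanish on both sides. -/

theorem finite_gt (S : Maya) (k : ℤ) : {s | s ∈ S.occ ∧ k < s}.Finite := by
  refine (S.finite_diff.union (Set.finite_Icc k 0)).subset fun s hs => ?_
  simp only [Set.mem_ofPred_eq, Set.mem_union, Set.mem_Icc] at hs ⊢
  by_cases h : 0 ≤ s
  · exact Or.inl (Or.inl ⟨h, hs.1⟩)
  · right; omega

theorem finite_lt (S : Maya) (k : ℤ) : {s | s ∉ S.occ ∧ s < k}.Finite := by
  refine (S.finite_diff.union (Set.finite_Icc 0 k)).subset fun s hs => ?_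
  simp only [Set.mem_ofPred_eq, Set.mem_union, Set.mem_Icc] at hs ⊢
  by_cases h : s < 0
  · exact Or.inl (Or.inr ⟨h, hs.1⟩)
  · right; omega

@[simp] theorem mem_insert {S : Maya} {k j : ℤ} : j ∈ (S.insert k).occ ↔ j = k ∨ j ∈ S.occ := by
  simp [Maya.insert]

@[simp] theorem mem_erase {S : Maya} {k j : ℤ} : j ∈ (S.erase k).occ ↔ j ≠ k ∧ j ∈ S.occ := by
  simp [Maya.erase, and_comm]

@[simp] theorem mem_vac {j : ℤ} : j ∈ vac.occ ↔ j < 0 := Iff.rfl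

theorem sgn_insert {S : Maya} {j : ℤ} (hj : j ∉ S.occ) (k : ℤ) :
    (S.insert j).sgn k = (if k < j then -1 else 1) * S.sgn k := by
  unfold sgn
  split_ifs with h
  · have : {s | s ∈ (S.insert j).occ ∧ k < s} = Insert.insert j {s | s ∈ S.occ ∧ k < s} := by
      ext s
      simp only [mem_insert, Set.mem_ofPred_eq, Set.mem_insert_iff]
      constructor
      · tauto
      · rintro (rfl | hs) <;> tauto
    rw [this, Set.ncard_insert_of_notMem (fun hs => hj hs.1) (S.finite_gt k), pow_succ]
    ring
  · have : {s | s ∈ (S.insert j).occ ∧ k < s} = {s | s ∈ S.occ ∧ k < s} := by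
      ext s
      simp only [mem_insert, Set.mem_ofPred_eq]
      constructor
      · rintro ⟨rfl | hs, h'⟩ <;> tauto
      · tauto
    rw [this, one_mul]

theorem insert_erase {S : Maya} {j : ℤ} (hj : j ∈ S.occ) : (S.erase j).insert j = S := by
  ext s
  simp only [mem_insert, mem_erase]
  constructor
  · rintro (rfl | hs) <;> tauto
  · tauto

theorem erase_insert {S : Maya} {j : ℤ} (hj : j ∉ S.occ) : (S.insert j).erase j = S := by
  ext s
  simp only [mem_insert, mem_erase]
  constructor
  · tauto
  · intro hs
    exact ⟨fun h => hj (h ▸ hs), Or.inr hs⟩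

theorem insert_comm (S : Maya) (j k : ℤ) : (S.insert j).insert k = (S.insert k).insert j := by
  ext s; simp only [mem_insert]; tauto

theorem erase_comm (S : Maya) (j k : ℤ) : (S.erase j).erase k = (S.erase k).erase j := by
  ext s; simp only [mem_erase]; tauto

theorem insert_erase_comm (S : Maya) {j k : ℤ} (h : j ≠ k) :
    (S.insert j).erase k = (S.erase k).insert j := by
  ext s; simp only [mem_insert, mem_erase]
  constructor
  · tauto
  · rintro (rfl | hs) <;> tauto

theorem sgn_erase {S : Maya} {j : ℤ} (hj : j ∈ S.occ) (k : ℤ) :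
    (S.erase j).sgn k = (if k < j then -1 else 1) * S.sgn k := by
  have := sgn_insert (S := S.erase j) (j := j) (by simp) k
  rw [insert_erase hj] at this
  rw [this, ← mul_assoc]
  split_ifs <;> simp

theorem sgn_mul_self (S : Maya) (k : ℤ) : S.sgn k * S.sgn k = 1 := by
  unfold sgn
  rw [← mul_pow]; simp

end Maya

/-! ### Anticommutation relations, and oscillators as sums of particle moves. -/

open Classical in
/-- Exterior multiplication by the position `p`. -/
def wedge (p : ℤ) : Op Maya := fun w S =>
  if p ∈ S.occ then S.sgn p * w (S.erase p) else 0

theorem psiDag_eq_wedge (k : ℤ) : psiDag k = wedge (-k - 1) := rfl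

theorem psi_apply_of_mem {k : ℤ} {S : Maya} (h : k ∈ S.occ) (w : Maya → ℂ) : psi k w S = 0 := by
  simp [psi, h]

theorem psi_apply {k : ℤ} {S : Maya} (h : k ∉ S.occ) (w : Maya → ℂ) :
    psi k w S = S.sgn k * w (S.insert k) := by
  simp [psi, h]

theorem wedge_apply {k : ℤ} {S : Maya} (h : k ∈ S.occ) (w : Maya → ℂ) :
    wedge k w S = S.sgn k * w (S.erase k) := by
  simp [wedge, h]

theorem wedge_apply_of_notMem {k : ℤ} {S : Maya} (h : k ∉ S.occ) (w : Maya → ℂ) :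
    wedge k w S = 0 := by
  simp [wedge, h]

theorem psi_psi (j k : ℤ) (w : Maya → ℂ) : psi j (psi k w) = -psi k (psi j w) := by
  ext S
  rw [Pi.neg_apply]
  by_cases hj : j ∈ S.occ
  · rw [psi_apply_of_mem hj]
    by_cases hk : k ∈ S.occ
    · rw [psi_apply_of_mem hk]; simp
    · rw [psi_apply hk, psi_apply_of_mem (by simp [hj])]; simp
  by_cases hk : k ∈ S.occ
  · rw [psi_apply_of_mem hk, psi_apply hj, psi_apply_of_mem (by simp [hk])]; simp
  by_cases hjk : j = k
  · subst hjk
    rw [psi_apply hj, psi_apply_of_mem (by simp)]; simp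
  rw [psi_apply hj, psi_apply hk, psi_apply (by simp [hk, Ne.symm hjk]),
    psi_apply (by simp [hj, hjk]), Maya.sgn_insert hj, Maya.sgn_insert hk, S.insert_comm]
  rcases lt_or_gt_of_ne hjk with h | h
  · rw [if_neg h.not_gt, if_pos h]; ring
  · rw [if_neg h.not_gt, if_pos h]; ring

theorem wedge_wedge (j k : ℤ) (w : Maya → ℂ) : wedge j (wedge k w) = -wedge k (wedge j w) := by
  ext S
  rw [Pi.neg_apply]
  by_cases hj : j ∈ S.occ
  swap
  · rw [wedge_apply_of_notMem hj]
    by_cases hk : k ∈ S.occ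
    · rw [wedge_apply hk, wedge_apply_of_notMem (by simp [hj])]; simp
    · rw [wedge_apply_of_notMem hk]; simp
  by_cases hk : k ∈ S.occ
  swap
  · rw [wedge_apply_of_notMem hk, wedge_apply hj, wedge_apply_of_notMem (by simp [hk])]; simp
  by_cases hjk : j = k
  · subst hjk
    rw [wedge_apply hj, wedge_apply_of_notMem (by simp)]; simp
  rw [wedge_apply hj, wedge_apply hk, wedge_apply (by simp [hk, Ne.symm hjk]),
    wedge_apply (by simp [hj, hjk]), Maya.sgn_erase hj, Maya.sgn_erase hk, S.erase_comm]
  rcases lt_or_gt_of_ne hjk with h | h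
  · rw [if_neg h.not_gt, if_pos h]; ring
  · rw [if_neg h.not_gt, if_pos h]; ring

theorem psi_wedge {j k : ℤ} (hjk : j ≠ k) (w : Maya → ℂ) :
    psi j (wedge k w) = -wedge k (psi j w) := by
  ext S
  rw [Pi.neg_apply]
  by_cases hj : j ∈ S.occ
  · rw [psi_apply_of_mem hj]
    by_cases hk : k ∈ S.occ
    · rw [wedge_apply hk, psi_apply_of_mem (by simp [hj, hjk])]; simp
    · rw [wedge_apply_of_notMem hk]; simp
  by_cases hk : k ∈ S.occ
  swap
  · rw [wedge_apply_of_notMem hk, psi_apply hj, wedge_apply_of_notMem (by simp [hk, hjk.symm])]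
    simp
  rw [psi_apply hj, wedge_apply hk, wedge_apply (by simp [hk]),
    psi_apply (by simp [hj]), Maya.sgn_insert hj, Maya.sgn_erase hk, S.insert_erase_comm hjk]
  rcases lt_or_gt_of_ne hjk with h | h
  · rw [if_neg h.not_gt, if_pos h]; ring
  · rw [if_neg h.not_gt, if_pos h]; ring

theorem psi_wedge_self (k : ℤ) (w : Maya → ℂ) :
    psi k (wedge k w) = w - wedge k (psi k w) := by
  ext S
  rw [Pi.sub_apply]
  by_cases hk : k ∈ S.occ
  · rw [psi_apply_of_mem hk, wedge_apply hk, psi_apply (by simp), Maya.sgn_erase hk,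
      Maya.insert_erase hk, if_neg (lt_irrefl k), one_mul, ← mul_assoc, Maya.sgn_mul_self]
    ring
  · rw [psi_apply hk, wedge_apply (by simp), Maya.sgn_insert hk, Maya.erase_insert hk,
      wedge_apply_of_notMem hk, if_neg (lt_irrefl k), one_mul, ← mul_assoc, Maya.sgn_mul_self]
    ring

/-- For n ≠ 0 the positions k and k - n differ, so the two modes anticommute exactly and normal
ordering has no effect. -/
theorem nordPsiPsiDag_eq {n : ℤ} (hn : n ≠ 0) (k : ℤ) (w : Maya → ℂ) :
    nordPsiPsiDag k (n - k - 1) w = -wedge (k - n) (psi k w) := by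
  have h : -(n - k - 1) - 1 = k - n := by ring
  unfold nordPsiPsiDag
  rw [psiDag_eq_wedge, h]
  split_ifs
  · exact psi_wedge (by omega) w
  · rfl

theorem aMode_apply {n : ℤ} (hn : n ≠ 0) (w : Maya → ℂ) (S : Maya) :
    aMode n w S = ∑' k : ℤ, wedge (k - n) (psi k w) S := by
  unfold aMode
  rw [← tsum_neg]
  refine tsum_congr fun k => ?_
  rw [nordPsiPsiDag_eq hn, Pi.neg_apply, neg_neg]

/-- Far below there are no holes and far above no particles, so few particles can move by n. This is
what lets a_n act on the completed Fock space: at each component its series is a finite sum. -/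
theorem Maya.finite_moves (S : Maya) (n : ℤ) : {k : ℤ | k ∉ S.occ ∧ k - n ∈ S.occ}.Finite := by
  refine ((S.finite_lt (max 0 n)).union ((S.finite_gt (-1)).image (· + n))).subset fun k hk => ?_
  simp only [Set.mem_ofPred_eq, Set.mem_union, Set.mem_image] at hk ⊢
  by_cases h : k < max 0 n
  · exact Or.inl ⟨hk.1, h⟩
  · exact Or.inr ⟨k - n, ⟨hk.2, by omega⟩, by ring⟩

theorem wedge_psi_apply {n k : ℤ} {S : Maya} (h : k ∉ S.occ ∧ k - n ∈ S.occ)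
    (w : Maya → ℂ) :
    wedge (k - n) (psi k w) S =
      S.sgn (k - n) * ((S.erase (k - n)).sgn k * w ((S.erase (k - n)).insert k)) := by
  rw [wedge_apply h.2, psi_apply (by simp [h.1])]

theorem wedge_psi_eq_zero {n : ℤ} (hn : n ≠ 0) {k : ℤ} {S : Maya}
    (h : ¬(k ∉ S.occ ∧ k - n ∈ S.occ)) (w : Maya → ℂ) : wedge (k - n) (psi k w) S = 0 := by
  by_cases h2 : k - n ∈ S.occ
  · have hk : k ∈ S.occ := by tauto
    rw [wedge_apply h2, psi_apply_of_mem (Maya.mem_erase.2 ⟨by omega, hk⟩), mul_zero]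
  · exact wedge_apply_of_notMem h2 _

theorem aMode_support_finite {n : ℤ} (hn : n ≠ 0) (w : ℤ → Maya → ℂ) (S : Maya) :
    (Function.support fun k : ℤ => wedge (k - n) (psi k (w k)) S).Finite := by
  refine (S.finite_moves n).subset fun k hk => ?_
  by_contra h
  exact hk (wedge_psi_eq_zero hn h _)

theorem aMode_summable {n : ℤ} (hn : n ≠ 0) (w : ℤ → Maya → ℂ) (S : Maya) :
    Summable fun k : ℤ => wedge (k - n) (psi k (w k)) S :=
  summable_of_hasFiniteSupport (aMode_support_finite hn w S)

/-- The oscillator as a finite sum over the movable particles. -/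
theorem aMode_eq_sum {n : ℤ} (hn : n ≠ 0) (w : Maya → ℂ) (S : Maya) :
    aMode n w S = ∑ k ∈ (S.finite_moves n).toFinset, S.sgn (k - n) *
      ((S.erase (k - n)).sgn k * w ((S.erase (k - n)).insert k)) := by
  rw [aMode_apply hn, tsum_eq_sum (s := (S.finite_moves n).toFinset)]
  · refine Finset.sum_congr rfl fun k hk => wedge_psi_apply ?_ w
    simpa using hk
  · intro k hk
    exact wedge_psi_eq_zero hn (by simpa using hk) w

theorem psi_add (k : ℤ) (v w : Maya → ℂ) : psi k (v + w) = psi k v + psi k w := by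
  ext S; by_cases h : k ∈ S.occ <;> simp [psi, h, mul_add]

theorem psi_smul (k : ℤ) (c : ℂ) (w : Maya → ℂ) : psi k (c • w) = c • psi k w := by
  ext S; by_cases h : k ∈ S.occ <;> simp [psi, h]; ring

theorem wedge_neg (k : ℤ) (w : Maya → ℂ) : wedge k (-w) = -wedge k w := by
  ext S; by_cases h : k ∈ S.occ <;> simp [wedge, h]

/-- The commutator `[ψ_u, a_n] = ψ_{u+n}` of oscillators and contractions. -/
theorem psi_aMode {n : ℤ} (hn : n ≠ 0) (u : ℤ) (w : Maya → ℂ) :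
    psi u (aMode n w) = aMode n (psi u w) + psi (u + n) w := by
  -- `psi u` fails to anticommute with `wedge (k - n)` only for k = u + n, and that term leaves
  -- ψ_{u+n}.
  have key : ∀ k, psi u (wedge (k - n) (psi k w)) =
      wedge (k - n) (psi k (psi u w)) + if k = u + n then psi (u + n) w else 0 := by
    intro k
    split_ifs with h
    · subst h
      rw [add_sub_cancel_right, psi_wedge_self, psi_psi, wedge_neg]
      abel
    · rw [psi_wedge (by omega), psi_psi, wedge_neg, neg_neg, add_zero]
  ext S
  rw [Pi.add_apply, aMode_apply hn]
  have h1 : psi u (aMode n w) S = ∑' k, psi u (wedge (k - n) (psi k w)) S := by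
    by_cases h : u ∈ S.occ
    · simp [psi_apply_of_mem h]
    · simp only [psi_apply h, aMode_apply hn]
      rw [tsum_mul_left]
  rw [h1]
  simp only [key, Pi.add_apply]
  rw [Summable.tsum_add (aMode_summable hn (fun _ => psi u w) S)]
  · congr 1
    rw [tsum_eq_single (u + n)]
    · simp
    · intro k hk; simp [hk]
  · refine summable_of_hasFiniteSupport ((Set.finite_singleton (u + n)).subset fun k hk => ?_)
    by_contra h
    simp at h
    simp [h] at hk

end FreeFermion
end

noncomputable section
namespace FreeFermion

/-! ### Maya diagrams of charge zero -/

/-- The position of the `i`-th particle of a Young diagram. -/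
def particle (lam : YoungDiagram) (i : ℕ) : ℤ := (lam.rowLen i : ℤ) - i - 1

/-- The position of the `j`-th hole of a Young diagram. -/
def hole (lam : YoungDiagram) (j : ℕ) : ℤ := (j : ℤ) - lam.colLen j

theorem rowLen_eq_zero {lam : YoungDiagram} {i : ℕ} (h : lam.colLen 0 ≤ i) :
    lam.rowLen i = 0 := by
  by_contra h0
  have h1 : (i, 0) ∈ lam := YoungDiagram.mem_iff_lt_rowLen.2 (Nat.pos_of_ne_zero h0)
  have := YoungDiagram.mem_iff_lt_colLen.1 h1
  omega

theorem particle_eq {lam : YoungDiagram} {i : ℕ} (h : lam.colLen 0 ≤ i) :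
    particle lam i = -(i : ℤ) - 1 := by
  simp [particle, rowLen_eq_zero h]

theorem particle_strictAnti (lam : YoungDiagram) : StrictAnti (particle lam) := by
  intro i j hij
  have := lam.rowLen_anti i j hij.le
  unfold particle
  omega

/-- The difference of the two positions is the hook length of the box (i, j) when the box lies in
the diagram. Boxes thus become pairs of a particle and a lower hole, the form in which the degree is
counted. -/
theorem hole_lt_particle_iff {lam : YoungDiagram} {i j : ℕ} :
    hole lam j < particle lam i ↔ (i, j) ∈ lam := by
  unfold particle hole
  constructor
  · intro h
    by_contra hc
    have h1 := mt YoungDiagram.mem_iff_lt_rowLen.2 hc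
    have h2 := mt YoungDiagram.mem_iff_lt_colLen.2 hc
    omega
  · intro h
    have h1 := YoungDiagram.mem_iff_lt_rowLen.1 h
    have h2 := YoungDiagram.mem_iff_lt_colLen.1 h
    omega

theorem hole_ne_particle (lam : YoungDiagram) (i j : ℕ) : hole lam j ≠ particle lam i := by
  unfold particle hole
  by_cases h : (i, j) ∈ lam
  · have h1 := YoungDiagram.mem_iff_lt_rowLen.1 h
    have h2 := YoungDiagram.mem_iff_lt_colLen.1 h
    omega
  · have h1 := mt YoungDiagram.mem_iff_lt_rowLen.2 h
    have h2 := mt YoungDiagram.mem_iff_lt_colLen.2 h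
    omega

/-- Let i be the first index whose particle is at most k. If it is not equal to k, row i has length
at most k + i while every earlier row is longer, so column k + i has length i and its hole is k. -/
theorem exists_particle_or_hole (lam : YoungDiagram) (k : ℤ) :
    (∃ i, k = particle lam i) ∨ ∃ j, k = hole lam j := by
  have hex : ∃ i, particle lam i ≤ k := by
    refine ⟨max (lam.colLen 0) (-k).toNat, ?_⟩
    rw [particle_eq (le_max_left _ _)]
    have := le_max_right (lam.colLen 0) (-k).toNat
    omega
  classical
  set i := Nat.find hex with hi
  have h1 : particle lam i ≤ k := Nat.find_spec hex
  rcases h1.eq_or_lt with h | h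
  · exact Or.inl ⟨i, h.symm⟩
  refine Or.inr ⟨(k + i).toNat, ?_⟩
  unfold particle at h
  have hnot : (i, (k + i).toNat) ∉ lam := by
    rw [YoungDiagram.mem_iff_lt_rowLen]; omega
  have h2 := mt YoungDiagram.mem_iff_lt_colLen.2 hnot
  unfold hole
  rcases Nat.eq_zero_or_pos i with h0 | h0
  · rw [h0] at h2 h ⊢; omega
  · have h3 := Nat.find_min hex (m := i - 1) (by omega)
    unfold particle at h3
    have h4 : (i - 1, (k + i).toNat) ∈ lam := by
      rw [YoungDiagram.mem_iff_lt_rowLen]; omega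
    have h5 := YoungDiagram.mem_iff_lt_colLen.1 h4
    omega

/-- The Maya diagram of charge zero which belongs to a Young diagram. -/
def mayaOf (lam : YoungDiagram) : Maya where
  occ := Set.range (particle lam)
  finite_diff := by
    refine (Set.finite_Icc (-(lam.colLen 0 : ℤ)) (lam.rowLen 0)).subset fun k hk => ?_
    rcases hk with ⟨h0, i, rfl⟩ | ⟨h0, hk⟩
    · have := (particle_strictAnti lam).antitone (Nat.zero_le i)
      simp only [particle, Set.mem_Icc] at *
      omega
    · by_contra hc
      refine hk ⟨(-k - 1).toNat, ?_⟩
      simp only [Set.mem_Icc] at hc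
      rw [particle_eq (by omega)]
      omega

theorem mem_mayaOf {lam : YoungDiagram} {k : ℤ} :
    k ∈ (mayaOf lam).occ ↔ ∃ i, k = particle lam i := by
  simp only [mayaOf, Set.mem_range, eq_comm]

theorem notMem_mayaOf {lam : YoungDiagram} {k : ℤ} :
    k ∉ (mayaOf lam).occ ↔ ∃ j, k = hole lam j := by
  rw [mem_mayaOf]
  constructor
  · intro h
    exact (exists_particle_or_hole lam k).resolve_left h
  · rintro ⟨j, rfl⟩ ⟨i, h⟩
    exact hole_ne_particle lam i j h

theorem mem_mayaOf_transpose {lam : YoungDiagram} {k : ℤ} :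
    k ∈ (mayaOf lam.transpose).occ ↔ -k - 1 ∉ (mayaOf lam).occ := by
  rw [mem_mayaOf, notMem_mayaOf]
  simp only [particle, hole, YoungDiagram.rowLen_transpose]
  refine exists_congr fun i => ?_
  omega

theorem mayaOf_injective : Function.Injective mayaOf := by
  intro lam eta h
  have h1 : particle lam = particle eta := by
    have := StrictMono.range_inj (γ := ℤᵒᵈ) (f := particle lam) (g := particle eta)
      (particle_strictAnti lam).dual_right (particle_strictAnti eta).dual_right
    exact this.1 (congrArg Maya.occ h)
  have h2 : ∀ i, lam.rowLen i = eta.rowLen i := by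
    intro i
    have := congrFun h1 i
    unfold particle at this
    omega
  refine SetLike.ext fun c => ?_
  rw [show c = (c.1, c.2) from rfl, YoungDiagram.mem_iff_lt_rowLen,
    YoungDiagram.mem_iff_lt_rowLen, h2]

theorem rowLen_bot (i : ℕ) : (⊥ : YoungDiagram).rowLen i = 0 := by
  by_contra h
  exact YoungDiagram.notMem_bot (i, 0) (YoungDiagram.mem_iff_lt_rowLen.2 (Nat.pos_of_ne_zero h))

theorem colLen_bot (i : ℕ) : (⊥ : YoungDiagram).colLen i = 0 := by
  by_contra h
  exact YoungDiagram.notMem_bot (0, i) (YoungDiagram.mem_iff_lt_colLen.2 (Nat.pos_of_ne_zero h))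

theorem mayaOf_bot : mayaOf ⊥ = Maya.vac := by
  ext k
  rw [mem_mayaOf, Maya.mem_vac]
  simp only [particle, rowLen_bot]
  constructor
  · rintro ⟨i, rfl⟩; push_cast; omega
  · intro h; exact ⟨(-k - 1).toNat, by push_cast; omega⟩

/-! ### Additive functions of the occupied positions -/

namespace Maya

open Classical in
/-- The occupation number of a position, relative to the vacuum. -/
def net (S : Maya) (m : ℤ) : ℂ :=
  (if m ∈ S.occ then 1 else 0) - if m < 0 then 1 else 0

/-- The sum of `g` over the occupied positions, relative to the vacuum. -/
def excess (g : ℤ → ℂ) (S : Maya) : ℂ := ∑' m : ℤ, S.net m * g m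

theorem net_support_finite (S : Maya) : (Function.support S.net).Finite := by
  refine S.finite_diff.subset fun m hm => ?_
  simp only [Function.mem_support, net] at hm
  simp only [Set.mem_ofPred_eq]
  by_contra hc
  apply hm
  have hiff : m ∈ S.occ ↔ m < 0 := by
    constructor
    · intro h; by_contra h'; exact hc (Or.inl ⟨not_lt.1 h', h⟩)
    · intro h; by_contra h'; exact hc (Or.inr ⟨h, h'⟩)
  simp only [hiff, sub_self]

theorem excess_summable (g : ℤ → ℂ) (S : Maya) : Summable fun m => S.net m * g m := by
  refine summable_of_hasFiniteSupport (S.net_support_finite.subset fun m hm => ?_)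
  exact left_ne_zero_of_mul hm

theorem net_insert {S : Maya} {k : ℤ} (hk : k ∉ S.occ) (m : ℤ) :
    (S.insert k).net m = S.net m + if m = k then 1 else 0 := by
  unfold net
  by_cases h : m = k
  · subst h; simp [hk]; ring
  · have h1 : m ∈ (S.insert k).occ ↔ m ∈ S.occ := by simp [h]
    by_cases h2 : m ∈ S.occ
    · rw [if_pos (h1.2 h2), if_pos h2, if_neg h, add_zero]
    · rw [if_neg (mt h1.1 h2), if_neg h2, if_neg h, add_zero]

theorem excess_insert {S : Maya} {k : ℤ} (hk : k ∉ S.occ) (g : ℤ → ℂ) :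
    excess g (S.insert k) = excess g S + g k := by
  unfold excess
  simp only [net_insert hk, add_mul]
  rw [(S.excess_summable g).tsum_add]
  · congr 1
    rw [tsum_eq_single k]
    · simp
    · intro m hm; simp [hm]
  · refine summable_of_hasFiniteSupport ((Set.finite_singleton k).subset fun m hm => ?_)
    by_contra h
    simp at h
    simp [h] at hm

theorem excess_erase {S : Maya} {k : ℤ} (hk : k ∈ S.occ) (g : ℤ → ℂ) :
    excess g (S.erase k) = excess g S - g k := by
  have := excess_insert (S := S.erase k) (k := k) (by simp) g
  rw [insert_erase hk] at this
  rw [this]; ring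

theorem excess_move {S : Maya} {k l : ℤ} (hl : l ∈ S.occ) (hk : k ∉ S.occ) (g : ℤ → ℂ) :
    excess g ((S.erase l).insert k) = excess g S - g l + g k := by
  rw [excess_insert (by simp [hk]), excess_erase hl]

theorem excess_eq_of_window {S : Maya} {M : ℕ} {A : Finset ℤ}
    (hA : ∀ m, m ∈ A ↔ m ∈ S.occ ∧ -(M : ℤ) ≤ m) (hS : ∀ m, m < -(M : ℤ) → m ∈ S.occ)
    (g : ℤ → ℂ) :
    excess g S = ∑ m ∈ A, g m - ∑ i ∈ Finset.range M, g (-(i : ℤ) - 1) := by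
  classical
  have hB : ∑ i ∈ Finset.range M, g (-(i : ℤ) - 1) = ∑ m ∈ Finset.Ico (-(M : ℤ)) 0, g m := by
    refine Finset.sum_nbij (fun i : ℕ => -(i : ℤ) - 1) ?_ ?_ ?_ (fun _ _ => rfl)
    · intro i hi; simp at hi ⊢; omega
    · intro i _ j _ h; simp at h; omega
    · intro m hm
      simp at hm
      exact ⟨(-m - 1).toNat, by simp; omega, by simp; omega⟩
  rw [hB, excess, tsum_eq_sum (s := A ∪ Finset.Ico (-(M : ℤ)) 0)]
  · have h : ∀ m, m ∈ A ∪ Finset.Ico (-(M : ℤ)) 0 →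
        S.net m * g m = (if m ∈ A then g m else 0) -
          if m ∈ Finset.Ico (-(M : ℤ)) 0 then g m else 0 := by
      intro m hm
      have hge : -(M : ℤ) ≤ m := by
        rcases Finset.mem_union.1 hm with h | h
        · exact ((hA m).1 h).2
        · exact (Finset.mem_Ico.1 h).1
      simp only [net, hA, Finset.mem_Ico, hge, and_true, true_and, sub_mul, ite_mul, one_mul,
        zero_mul]
    rw [Finset.sum_congr rfl h, Finset.sum_sub_distrib]
    congr 1
    · rw [← Finset.sum_filter]
      exact Finset.sum_congr (by ext m; simp) fun _ _ => rfl
    · rw [← Finset.sum_filter]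
      exact Finset.sum_congr (by ext m; simp; tauto) fun _ _ => rfl
  · intro m hm
    simp only [Finset.mem_union, hA, Finset.mem_Ico, not_or, not_and] at hm
    have : S.net m = 0 := by
      unfold net
      by_cases h : m < -(M : ℤ)
      · simp [hS m h, show m < 0 by omega]
      · have h1 : m ∉ S.occ := fun h1 => hm.1 h1 (by omega)
        have h2 : ¬ m < 0 := hm.2 (by omega)
        simp [h1, h2]
    rw [this, zero_mul]

end Maya

open Maya

/-- Evaluates all quantum numbers at once: g = 1 gives the charge, g = m the size, g = (m + 1/2)²
the number κ, and g = q^{-nm} the power sum behind b_n. -/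
theorem excess_mayaOf {lam : YoungDiagram} {M : ℕ} (hM : lam.colLen 0 ≤ M) (g : ℤ → ℂ) :
    excess g (mayaOf lam) = ∑ i ∈ Finset.range M, (g (particle lam i) - g (-(i : ℤ) - 1)) := by
  classical
  rw [excess_eq_of_window (M := M) (A := (Finset.range M).image (particle lam)),
    Finset.sum_image, Finset.sum_sub_distrib]
  · exact fun i _ j _ h => (particle_strictAnti lam).injective h
  · intro m
    simp only [Finset.mem_image, Finset.mem_range, mem_mayaOf]
    constructor
    · rintro ⟨i, hi, rfl⟩
      refine ⟨⟨i, rfl⟩, ?_⟩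
      unfold particle; omega
    · rintro ⟨⟨i, rfl⟩, h⟩
      refine ⟨i, ?_, rfl⟩
      by_contra hc
      rw [particle_eq (by omega)] at h
      omega
  · intro m hm
    refine mem_mayaOf.2 ⟨(-m - 1).toNat, ?_⟩
    rw [particle_eq (by omega)]; omega

/-- Transposition reflects positions by m ↦ -m - 1 and exchanges particles with holes, which
reverses the net occupation. -/
theorem excess_mayaOf_transpose (lam : YoungDiagram) (g : ℤ → ℂ) :
    excess g (mayaOf lam.transpose) = -excess (fun m => g (-m - 1)) (mayaOf lam) := by
  unfold excess
  rw [← tsum_neg, ← (Equiv.subLeft (-1 : ℤ)).tsum_eq]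
  refine tsum_congr fun m => ?_
  have h : (mayaOf lam.transpose).net (-1 - m) = -(mayaOf lam).net m := by
    unfold net
    rw [mem_mayaOf_transpose, show -(-1 - m) - 1 = m by ring]
    by_cases h1 : m ∈ (mayaOf lam).occ <;> by_cases h2 : m < 0 <;>
      simp [h1, h2, show (-1 - m < 0) ↔ ¬ m < 0 by omega]
  rw [Equiv.subLeft_apply, h, show -1 - m = -m - 1 by ring, neg_mul]

theorem card_eq_sum_rowLen (lam : YoungDiagram) {M : ℕ} (hM : lam.colLen 0 ≤ M) :
    lam.card = ∑ i ∈ Finset.range M, lam.rowLen i := by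
  rw [YoungDiagram.card, Finset.card_eq_sum_card_fiberwise (f := Prod.fst) (t := Finset.range M)]
  · refine Finset.sum_congr rfl fun i _ => ?_
    rw [YoungDiagram.rowLen_eq_card]; rfl
  · rintro ⟨i, j⟩ hc
    have h1 : (i, j) ∈ lam := hc
    have h2 := YoungDiagram.mem_iff_lt_colLen.1 h1
    have := lam.colLen_anti 0 j (Nat.zero_le _)
    simp; omega

theorem excess_one_mayaOf (lam : YoungDiagram) : excess 1 (mayaOf lam) = 0 := by
  rw [excess_mayaOf le_rfl]; simp

theorem excess_id_mayaOf (lam : YoungDiagram) :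
    excess (fun m => (m : ℂ)) (mayaOf lam) = lam.card := by
  rw [excess_mayaOf le_rfl, card_eq_sum_rowLen lam le_rfl]
  push_cast
  refine Finset.sum_congr rfl fun i _ => ?_
  unfold particle; push_cast; ring

theorem card_transpose (lam : YoungDiagram) : lam.transpose.card = lam.card := by
  unfold YoungDiagram.card
  refine Finset.card_bij (fun c _ => c.swap) ?_ ?_ ?_
  · intro c hc
    exact YoungDiagram.mem_transpose.1 hc
  · intro a _ b _ h; exact Prod.swap_injective h
  · intro b hb
    refine ⟨b.swap, ?_, Prod.swap_swap b⟩
    rw [YoungDiagram.mem_cells, YoungDiagram.mem_transpose, Prod.swap_swap]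
    exact hb

theorem exists_rowLen_eq {r : ℕ → ℕ} {M : ℕ} (hr : Antitone r) (hM : ∀ i, M ≤ i → r i = 0) :
    ∃ lam : YoungDiagram, ∀ i, lam.rowLen i = r i := by
  classical
  let lam : YoungDiagram :=
    { cells := (Finset.range M ×ˢ Finset.range (r 0)).filter fun c => c.2 < r c.1
      isLowerSet := by
        rintro ⟨a, b⟩ ⟨c, d⟩ hle h
        have h1 : c ≤ a := hle.1
        have h2 : d ≤ b := hle.2
        have h3 := hr h1
        simp only [Finset.coe_filter, Finset.mem_product, Finset.mem_range, Set.mem_ofPred_eq] at h ⊢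
        omega }
  have hmem : ∀ i j, (i, j) ∈ lam ↔ j < r i := by
    intro i j
    rw [← YoungDiagram.mem_cells]
    simp only [lam, Finset.mem_filter, Finset.mem_product, Finset.mem_range]
    constructor
    · tauto
    · intro h
      refine ⟨⟨?_, h.trans_le (hr (Nat.zero_le i))⟩, h⟩
      by_contra hc
      rw [hM i (by omega)] at h
      omega
  refine ⟨lam, fun i => ?_⟩
  have h1 := hmem i (lam.rowLen i)
  have h2 := hmem i (r i)
  rw [YoungDiagram.mem_iff_lt_rowLen] at h1 h2
  omega

/-- Strict monotonicity and the lower bound force u j ≥ -M + j; the differences u j - (-M + j) are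
the rows, shortest first. `rev` appears because particles are listed downwards. -/
theorem exists_particle_eq {M : ℕ} {u : Fin M → ℤ} (hmono : StrictMono u)
    (hge : ∀ j, -(M : ℤ) ≤ u j) :
    ∃ lam : YoungDiagram, lam.colLen 0 ≤ M ∧ ∀ j : Fin M, particle lam j.rev = u j := by
  have hu : ∀ j : Fin M, -(M : ℤ) + j ≤ u j := by
    rintro ⟨j, hj⟩
    induction j with
    | zero => simpa using hge ⟨0, hj⟩
    | succ j ih =>
      have h1 := ih (by omega)
      have h2 : u ⟨j, by omega⟩ < u ⟨j + 1, hj⟩ := hmono (by simp [Fin.lt_def])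
      simp only at h1 ⊢
      push_cast
      omega
  let r : ℕ → ℕ := fun i => if h : i < M then (u (Fin.rev ⟨i, h⟩) + i + 1).toNat else 0
  have hr1 : ∀ i (h : i < M), (r i : ℤ) = u (Fin.rev ⟨i, h⟩) + i + 1 := by
    intro i h
    have := hu (Fin.rev ⟨i, h⟩)
    simp only [Fin.val_rev] at this
    simp only [r, dif_pos h]
    omega
  have hanti : Antitone r := by
    refine antitone_nat_of_succ_le fun i => ?_
    by_cases h : i + 1 < M
    · have h1 := hr1 i (by omega)
      have h2 := hr1 (i + 1) h
      have h3 : u (Fin.rev ⟨i + 1, h⟩) < u (Fin.rev ⟨i, by omega⟩) :=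
        hmono (by simp [Fin.lt_def]; omega)
      push_cast at h2
      omega
    · simp [r, h]
  have hr0 : ∀ i, M ≤ i → r i = 0 := fun i hi => by simp [r, not_lt.2 hi]
  obtain ⟨lam, hlam⟩ := exists_rowLen_eq hanti hr0
  refine ⟨lam, ?_, fun j => ?_⟩
  · by_contra hc
    have h1 := YoungDiagram.mem_iff_lt_rowLen.1 (YoungDiagram.mem_iff_lt_colLen.2 (not_le.1 hc))
    rw [hlam, hr0 M le_rfl] at h1
    omega
  · have h2 := hr1 j.rev j.rev.2
    simp only [Fin.eta, Fin.rev_rev] at h2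
    rw [particle, hlam, h2]
    ring

/-- Choose M with everything below -M occupied. Charge zero says that exactly M particles lie at or
above -M; sorted, they are the first M particles of a diagram. -/
theorem exists_mayaOf {S : Maya} (hS : excess 1 S = 0) : ∃ lam, S = mayaOf lam := by
  classical
  obtain ⟨M, hM⟩ : ∃ M : ℕ, ∀ m, m < -(M : ℤ) → m ∈ S.occ := by
    obtain ⟨b, hb⟩ := (S.finite_lt 0).bddBelow
    refine ⟨(-b).toNat, fun m hm => ?_⟩
    by_contra hc
    have := hb ⟨hc, by omega⟩
    omega
  have hfin := (S.finite_gt (-(M : ℤ) - 1))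
  set A := hfin.toFinset with hAdef
  have hA : ∀ m, m ∈ A ↔ m ∈ S.occ ∧ -(M : ℤ) ≤ m := by
    intro m
    rw [hAdef, Set.Finite.mem_toFinset]
    exact and_congr_right fun _ => by omega
  have hcard : A.card = M := by
    have := excess_eq_of_window hA hM 1
    rw [hS] at this
    simp at this
    exact_mod_cast (sub_eq_zero.1 this.symm)
  let u := A.orderEmbOfFin hcard
  obtain ⟨lam, hlen, hlam⟩ := exists_particle_eq u.strictMono
    fun j => ((hA _).1 (A.orderEmbOfFin_mem hcard j)).2
  refine ⟨lam, Maya.ext (Set.ext fun k => ?_)⟩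
  rw [mem_mayaOf]
  constructor
  · intro hk
    by_cases h : -(M : ℤ) ≤ k
    · have h1 : k ∈ Set.range u := by
        rw [Finset.range_orderEmbOfFin]
        exact (hA k).2 ⟨hk, h⟩
      obtain ⟨j, rfl⟩ := h1
      exact ⟨Fin.rev j, (hlam j).symm⟩
    · refine ⟨(-k - 1).toNat, ?_⟩
      rw [particle_eq (by omega)]
      omega
  · rintro ⟨i, rfl⟩
    by_cases h : i < M
    · have h3 := ((hA _).1 (A.orderEmbOfFin_mem hcard (Fin.rev ⟨i, h⟩))).1
      have h4 := hlam (Fin.rev ⟨i, h⟩)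
      rw [Fin.rev_rev] at h4
      rwa [h4]
    · apply hM
      rw [particle_eq (by omega)]
      omega

/-- Moving a particle of a diagram by `n` gives a diagram of size changed by `n`. -/
theorem exists_mayaOf_move {lam : YoungDiagram} {k n : ℤ} (hk : k ∉ (mayaOf lam).occ)
    (hl : k - n ∈ (mayaOf lam).occ) :
    ∃ eta, ((mayaOf lam).erase (k - n)).insert k = mayaOf eta ∧
      (eta.card : ℤ) = lam.card + n := by
  obtain ⟨eta, h⟩ := exists_mayaOf (S := ((mayaOf lam).erase (k - n)).insert k) (by
    rw [excess_move hl hk, excess_one_mayaOf]; simp)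
  refine ⟨eta, h, ?_⟩
  have h1 := excess_id_mayaOf eta
  rw [← h, excess_move hl hk, excess_id_mayaOf] at h1
  push_cast at h1
  have h2 : ((eta.card : ℤ) : ℂ) = ((lam.card + n : ℤ) : ℂ) := by
    push_cast; rw [← h1]; ring
  exact_mod_cast h2

end FreeFermion
end

noncomputable section
namespace FreeFermion
open Maya

/-! ### Diagonal operators -/

/-- This is the number operator of the position m. For m < 0 normal ordering reverses the factors
and gives the occupation minus one; subtracting the sea in this way makes the sums over positions
finite. -/
theorem nordPsiDagPsi_apply (m : ℤ) (w : Maya → ℂ) (S : Maya) :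
    nordPsiDagPsi (-m - 1) m w S = S.net m * w S := by
  unfold nordPsiDagPsi
  rw [psiDag_eq_wedge, show -(-m - 1) - 1 = m by ring]
  unfold net
  split_ifs with h0 h1 h2 h2 h1 h2 h2
  · omega
  · rw [wedge_apply h1, psi_apply (by simp), sgn_erase h1, if_neg (lt_irrefl m), Maya.insert_erase h1,
      one_mul, ← mul_assoc, sgn_mul_self]; ring
  · omega
  · rw [wedge_apply_of_notMem h1]; ring
  · rw [Pi.neg_apply, psi_apply_of_mem h1]; ring
  · omega
  · rw [Pi.neg_apply, psi_apply h1, wedge_apply (by simp), sgn_insert h1, if_neg (lt_irrefl m),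
      Maya.erase_insert h1, one_mul, ← mul_assoc, sgn_mul_self]; ring
  · omega

/-- Diagonalizes every series Σ g(r) :ψ†_r ψ_{-r}: at one stroke, in particular b_n and ŵ. The mode
r counts the position -r, whence the reflected argument of g. -/
theorem tsum_nordPsiDagPsi (g : ℤ → ℂ) (w : Maya → ℂ) (S : Maya) :
    ∑' k : ℤ, g k * nordPsiDagPsi k (-k - 1) w S = excess (fun m => g (-m - 1)) S * w S := by
  unfold excess
  rw [← tsum_mul_right, ← (Equiv.subLeft (-1 : ℤ)).tsum_eq]
  refine tsum_congr fun m => ?_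
  rw [Equiv.subLeft_apply, show -1 - m = -m - 1 by ring, show -(-m - 1) - 1 = m by ring,
    nordPsiDagPsi_apply]
  ring

theorem kappa_eq (lam : YoungDiagram) :
    (kappa lam : ℂ) = excess (fun m => ((m : ℂ) + 1 / 2) ^ 2) (mayaOf lam) := by
  rw [excess_mayaOf le_rfl, kappa]
  push_cast
  refine Finset.sum_congr rfl fun i _ => ?_
  unfold particle; push_cast; ring

/-- The weight (m + 1/2)² is invariant under the reflection m ↦ -m - 1. -/
theorem kappa_transpose (lam : YoungDiagram) : kappa lam.transpose = -kappa lam := by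
  have h : (kappa lam.transpose : ℂ) = ((-kappa lam : ℤ) : ℂ) := by
    rw [kappa_eq, excess_mayaOf_transpose, Int.cast_neg, kappa_eq]
    congr 2
    ext m; push_cast; ring
  exact_mod_cast h

theorem wHat_apply (w : Maya → ℂ) (S : Maya) :
    wHat w S = excess (fun m => ((m : ℂ) + 1 / 2) ^ 2) S * w S := by
  unfold wHat
  rw [tsum_nordPsiDagPsi (fun k => ((k : ℂ) + 1 / 2) ^ 2)]
  congr 2
  ext m; push_cast; ring

theorem qPow_add (ℓ x y : ℂ) : qPow ℓ (x + y) = qPow ℓ x * qPow ℓ y := by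
  rw [qPow, add_mul, Complex.exp_add]; rfl

theorem qPow_ne_zero (ℓ x : ℂ) : qPow ℓ x ≠ 0 := Complex.exp_ne_zero _

theorem qPow_neg (ℓ x : ℂ) : qPow ℓ (-x) = (qPow ℓ x)⁻¹ := by
  rw [qPow, neg_mul, Complex.exp_neg]; rfl

theorem qPow_pow (ℓ x : ℂ) (n : ℕ) : qPow ℓ x ^ n = qPow ℓ (n * x) := by
  rw [qPow, ← Complex.exp_nat_mul, qPow, mul_assoc]

theorem qPow_zpow (ℓ x : ℂ) (n : ℤ) : qPow ℓ x ^ n = qPow ℓ (n * x) := by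
  rw [qPow, ← Complex.exp_int_mul, qPow, mul_assoc]

/-- The eigenvalue of `b_n`. -/
def bEigen (ℓ : ℂ) (n : ℤ) (S : Maya) : ℂ :=
  -excess (fun m => qPow ℓ (-(n * m))) S + 1 / (1 - qPow ℓ (-n))

theorem bMode_apply (ℓ : ℂ) (n : ℤ) (w : Maya → ℂ) (S : Maya) :
    bMode ℓ n w S = bEigen ℓ n S * w S := by
  unfold bMode bEigen
  rw [tsum_nordPsiDagPsi (fun k => qPow ℓ ((n * (k + 1) : ℤ) : ℂ)), add_mul, neg_mul]
  congr 4
  ext m; congr 1; push_cast; ring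

/-! ### The eigenvalues of b_n as convergent power sums. -/

section Convergent

variable {ℓ : ℂ}

theorem norm_qPow_nat_lt_one (hℓ : ‖Complex.exp ℓ‖ < 1) {n : ℕ} (hn : 0 < n) :
    ‖qPow ℓ n‖ < 1 := by
  have : qPow ℓ n = Complex.exp ℓ ^ n := by rw [qPow, ← Complex.exp_nat_mul]
  rw [this, norm_pow]
  exact pow_lt_one₀ (norm_nonneg _) hℓ hn.ne'

theorem one_sub_qPow_ne_zero (hℓ : ‖Complex.exp ℓ‖ < 1) {n : ℕ} (hn : 0 < n) :
    1 - qPow ℓ n ≠ 0 := by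
  intro h
  have := norm_qPow_nat_lt_one hℓ hn
  rw [← sub_eq_zero.1 h, norm_one] at this
  exact lt_irrefl _ this

theorem hasSum_qPow (hℓ : ‖Complex.exp ℓ‖ < 1) {n : ℕ} (hn : 0 < n) (c : ℂ) :
    HasSum (fun i : ℕ => qPow ℓ (n * (i + c))) (qPow ℓ (n * c) / (1 - qPow ℓ n)) := by
  have h := (hasSum_geometric_of_norm_lt_one (norm_qPow_nat_lt_one hℓ hn)).mul_left (qPow ℓ (n * c))
  rw [← div_eq_mul_inv] at h
  refine h.congr_fun fun i => ?_
  rw [qPow_pow, ← qPow_add]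
  congr 1; ring

theorem spec_pow (lam : YoungDiagram) (n i : ℕ) :
    spec ℓ lam (1 / 2) i ^ n = qPow ℓ (-(n * particle lam i)) := by
  rw [spec, qPow_pow]
  congr 1
  unfold particle; push_cast; ring

/-- The power sums of `q ^ (-lam - ρ + 1/2)`. -/
theorem hasSum_spec_half (hℓ : ‖Complex.exp ℓ‖ < 1) (lam : YoungDiagram) {n : ℕ} (hn : 0 < n) :
    HasSum (fun i => spec ℓ lam (1 / 2) i ^ n)
      (excess (fun m => qPow ℓ (-(n * m))) (mayaOf lam) + qPow ℓ n / (1 - qPow ℓ n)) := by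
  have h1 := hasSum_qPow hℓ hn 1
  rw [mul_one] at h1
  have h2 : HasSum (fun i : ℕ => qPow ℓ (-(n * particle lam i)) - qPow ℓ (n * (i + 1)))
      (excess (fun m => qPow ℓ (-(n * m))) (mayaOf lam)) := by
    rw [excess_mayaOf le_rfl]
    convert hasSum_sum_of_ne_finset_zero (s := Finset.range (lam.colLen 0)) ?_ using 1
    · refine Finset.sum_congr rfl fun i _ => ?_
      congr 2; push_cast; ring
    · intro i hi
      rw [particle_eq (by simpa using hi), sub_eq_zero]
      congr 1; push_cast; ring
    · infer_instance
  refine (h2.add h1).congr_fun fun i => ?_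
  rw [spec_pow]; ring

/-- The constant 1/(1 - q^{-n}) equals -q^n/(1 - q^n), minus the power sum of the sea. It completes
the sum relative to the vacuum to the full power sum. -/
theorem bEigen_pos (hℓ : ‖Complex.exp ℓ‖ < 1) (lam : YoungDiagram) {n : ℕ} (hn : 0 < n) :
    bEigen ℓ n (mayaOf lam) = -powerSum n (spec ℓ lam (1 / 2)) := by
  rw [powerSum, (hasSum_spec_half hℓ lam hn).tsum_eq, bEigen]
  have h1 := one_sub_qPow_ne_zero hℓ hn
  have h2 := qPow_ne_zero ℓ n
  push_cast
  rw [qPow_neg]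
  have h3 : 1 - (qPow ℓ n)⁻¹ ≠ 0 := by
    intro h; apply h1; field_simp at h; linear_combination -h
  have h4 : 1 / (1 - (qPow ℓ n)⁻¹) = -(qPow ℓ n / (1 - qPow ℓ n)) := by
    rw [← neg_div, div_eq_div_iff h3 h1]; field_simp; ring
  rw [h4]; ring

theorem spec_add (lam : YoungDiagram) (c d : ℂ) (i : ℕ) :
    spec ℓ lam (c + d) i = qPow ℓ c * spec ℓ lam d i := by
  rw [spec, spec, ← qPow_add]; congr 1; ring

theorem powerSum_smul (n : ℕ) (c : ℂ) (x : ℕ → ℂ) :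
    powerSum n (fun i => c * x i) = c ^ n * powerSum n x := by
  unfold powerSum
  rw [← tsum_mul_left]
  exact tsum_congr fun i => mul_pow _ _ _

theorem powerSum_spec_add (lam : YoungDiagram) (n : ℕ) (c d : ℂ) :
    powerSum n (spec ℓ lam (c + d)) = qPow ℓ c ^ n * powerSum n (spec ℓ lam d) := by
  rw [← powerSum_smul]; congr 1; ext i; exact spec_add _ _ _ _

/-- For negative index the sum over the sea would diverge. Passing to holes by transposition
restores convergence, and the reflection contributes the factor q^{-n} that changes the shift 1/2
into -1/2. -/
theorem bEigen_neg (hℓ : ‖Complex.exp ℓ‖ < 1) (lam : YoungDiagram) {n : ℕ} (hn : 0 < n) :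
    bEigen ℓ (-n) (mayaOf lam) = powerSum n (spec ℓ lam.transpose (-1 / 2)) := by
  have h := powerSum_spec_add (ℓ := ℓ) lam.transpose n (-1) (1 / 2)
  rw [show (-1 : ℂ) + 1 / 2 = -1 / 2 by ring] at h
  rw [h, powerSum, (hasSum_spec_half hℓ lam.transpose hn).tsum_eq, bEigen]
  have h1 : excess (fun m => qPow ℓ (-(((-n : ℤ) : ℂ) * m))) (mayaOf lam) =
      -(qPow ℓ (-1) ^ n * excess (fun m => qPow ℓ (-(n * m))) (mayaOf lam.transpose)) := by
    conv_lhs => rw [← lam.transpose_transpose]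
    rw [excess_mayaOf_transpose, excess, excess, ← tsum_mul_left]
    congr 1
    refine tsum_congr fun m => ?_
    rw [mul_left_comm, qPow_pow, ← qPow_add]
    congr 2; push_cast; ring
  have h2 := one_sub_qPow_ne_zero hℓ hn
  have h3 := qPow_ne_zero ℓ n
  rw [h1, qPow_pow, show (n : ℂ) * -1 = -n by ring, qPow_neg]
  push_cast
  rw [neg_neg]
  field_simp

end Convergent

theorem opExp_diagonal {X : Type} {A : Op X} {c : X → ℂ} (hA : ∀ w x, A w x = c x * w x)
    (w : X → ℂ) (x : X) : opExp A w x = Complex.exp (c x) * w x := by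
  have h : ∀ k, (A^[k] w) x = c x ^ k * w x := by
    intro k
    induction k with
    | zero => simp
    | succ k ih => rw [Function.iterate_succ_apply', hA, ih, pow_succ]; ring
  unfold opExp
  simp only [h, ← mul_assoc]
  rw [tsum_mul_right, Complex.exp_eq_exp_ℂ, NormedSpace.exp_eq_tsum ℂ]
  simp only [smul_eq_mul]

theorem qOp_wHat (ℓ c : ℂ) (w : Maya → ℂ) (lam : YoungDiagram) :
    qOp ℓ c wHat w (mayaOf lam) = qPow ℓ (c * kappa lam) * w (mayaOf lam) := by
  unfold qOp
  rw [opExp_diagonal (c := fun S => c * ℓ * excess (fun m => ((m : ℂ) + 1 / 2) ^ 2) S), ← kappa_eq,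
    qPow]
  · congr 2; ring
  · intro w S
    rw [Pi.smul_apply, wHat_apply, smul_eq_mul]; ring

end FreeFermion
end

noncomputable section
namespace FreeFermion
open Maya

/-! ### The standard basis -/

open Classical in
/-- The basis vector of a Maya diagram. -/
def basisVec (S : Maya) : Maya → ℂ := fun X => if X = S then 1 else 0

theorem vacuum_eq : vacuum = basisVec vac := rfl

theorem basisVec_self (S : Maya) : basisVec S S = 1 := if_pos rfl

theorem basisVec_of_ne {S X : Maya} (h : X ≠ S) : basisVec S X = 0 := if_neg h

theorem psi_wedge_basisVec {S : Maya} {a b : ℤ} (hb : b ∈ S.occ) (ha : a ∉ S.occ) (hba : b < a) :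
    psi b (wedge a (basisVec S)) =
      (-(S.sgn b * S.sgn a)) • basisVec ((S.insert a).erase b) := by
  ext X
  rw [Pi.smul_apply, smul_eq_mul]
  by_cases hX : X = (S.insert a).erase b
  · subst hX
    have h1 : b ∈ (S.insert a).occ := by simp [hb]
    rw [basisVec_self, psi_apply (by simp), Maya.insert_erase h1, wedge_apply (by simp),
      Maya.erase_insert ha, basisVec_self, sgn_erase h1, sgn_insert ha, sgn_insert ha,
      if_neg (lt_irrefl b), if_pos hba, if_neg (lt_irrefl a)]
    ring
  · rw [basisVec_of_ne hX, mul_zero]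
    by_cases h1 : b ∈ X.occ
    · exact psi_apply_of_mem h1 _
    rw [psi_apply h1]
    by_cases h2 : a ∈ (X.insert b).occ
    · rw [wedge_apply h2, basisVec_of_ne, mul_zero, mul_zero]
      intro h
      apply hX
      rw [← h, Maya.insert_erase h2, Maya.erase_insert h1]
    · rw [wedge_apply_of_notMem h2, mul_zero]

/-- The search range `range lam.card` in `diagLen` loses nothing, since a box (i, i) brings i + 1
diagonal boxes with it, and the diagonal boxes form an initial segment. -/
theorem mem_of_lt_diagLen {lam : YoungDiagram} {i : ℕ} : i < diagLen lam ↔ (i, i) ∈ lam := by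
  have hdown : ∀ {i j}, i ≤ j → (j, j) ∈ lam → (i, i) ∈ lam :=
    fun h hj => lam.up_left_mem h h hj
  have hcard : ∀ {i}, (i, i) ∈ lam → i < lam.card := by
    intro i hi
    have hsub : (Finset.range (i + 1)).image (fun k => (k, k)) ⊆ lam.cells := by
      intro c hc
      simp only [Finset.mem_image, Finset.mem_range] at hc
      obtain ⟨k, hk, rfl⟩ := hc
      exact hdown (by omega) hi
    have := Finset.card_le_card hsub
    rw [Finset.card_image_of_injective _ (fun a b h => (Prod.ext_iff.1 h).1),
      Finset.card_range] at this
    exact this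
  unfold diagLen
  set F := (Finset.range lam.card).filter fun i => (i, i) ∈ lam
  have hF : ∀ i, i ∈ F ↔ (i, i) ∈ lam := by
    intro i
    simp only [F, Finset.mem_filter, Finset.mem_range]
    exact ⟨And.right, fun h => ⟨hcard h, h⟩⟩
  rw [← hF]
  constructor
  · intro hi
    by_contra hc
    have hsub : F ⊆ Finset.range i := by
      intro k hk
      rw [Finset.mem_range]
      by_contra hki
      exact hc ((hF i).2 (hdown (not_lt.1 hki) ((hF k).1 hk)))
    have := Finset.card_le_card hsub
    rw [Finset.card_range] at this
    omega
  · intro hi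
    have hsub : Finset.range (i + 1) ⊆ F := by
      intro k hk
      rw [Finset.mem_range] at hk
      exact (hF k).2 (hdown (by omega) ((hF i).1 hi))
    have := Finset.card_le_card hsub
    rw [Finset.card_range] at this
    omega

theorem particle_nonneg_iff {lam : YoungDiagram} {i : ℕ} : 0 ≤ particle lam i ↔ (i, i) ∈ lam := by
  rw [YoungDiagram.mem_iff_lt_rowLen, particle]; omega

theorem hole_neg_iff {lam : YoungDiagram} {i : ℕ} : hole lam i < 0 ↔ (i, i) ∈ lam := by
  rw [YoungDiagram.mem_iff_lt_colLen, hole]; omega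

theorem hole_strictMono (lam : YoungDiagram) : StrictMono (hole lam) := by
  intro i j hij
  have := lam.colLen_anti i j hij.le
  unfold hole
  omega

/-- The Maya diagram obtained from the vacuum by the particle-hole moves of the diagonal boxes
`i, …, i + n - 1`. -/
def hookState (lam : YoungDiagram) (i n : ℕ) : Maya :=
  (List.range' i n).foldr (fun k S => (S.insert (particle lam k)).erase (hole lam k)) vac

theorem hookState_succ (lam : YoungDiagram) (i n : ℕ) :
    hookState lam i (n + 1) =
      ((hookState lam (i + 1) n).insert (particle lam i)).erase (hole lam i) := by
  simp [hookState, List.range'_succ]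

theorem mem_hookState {lam : YoungDiagram} {n : ℕ} : ∀ {i : ℕ}, i + n ≤ diagLen lam → ∀ m,
    m ∈ (hookState lam i n).occ ↔ (m < 0 ∧ ∀ k, i ≤ k → k < i + n → m ≠ hole lam k) ∨
      ∃ k, i ≤ k ∧ k < i + n ∧ m = particle lam k := by
  induction n with
  | zero =>
    intro i _ m
    simp only [hookState, List.range'_zero, List.foldr_nil, mem_vac]
    constructor
    · intro h; exact Or.inl ⟨h, fun k _ _ => by omega⟩
    · rintro (h | ⟨k, _, _, _⟩)
      · exact h.1
      · omega
  | succ n ih =>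
    intro i hi m
    rw [hookState_succ, mem_erase, mem_insert, ih (by omega)]
    constructor
    · rintro ⟨h1, rfl | ⟨h2, h3⟩ | ⟨k, h2, h3, h4⟩⟩
      · exact Or.inr ⟨i, le_rfl, by omega, rfl⟩
      · refine Or.inl ⟨h2, fun k hk hk' => ?_⟩
        rcases hk.eq_or_lt with rfl | h
        · exact h1
        · exact h3 k (by omega) (by omega)
      · exact Or.inr ⟨k, by omega, by omega, h4⟩
    · rintro (⟨h1, h2⟩ | ⟨k, h2, h3, rfl⟩)
      · exact ⟨h2 i le_rfl (by omega), Or.inr (Or.inl ⟨h1, fun k hk hk' =>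
          h2 k (by omega) (by omega)⟩)⟩
      · refine ⟨(hole_ne_particle lam k i).symm, ?_⟩
        rcases h2.eq_or_lt with rfl | h
        · exact Or.inl rfl
        · exact Or.inr (Or.inr ⟨k, by omega, by omega, rfl⟩)

theorem hookState_eq_mayaOf (lam : YoungDiagram) :
    hookState lam 0 (diagLen lam) = mayaOf lam := by
  ext m
  rw [mem_hookState (by omega)]
  constructor
  · rintro (⟨h1, h2⟩ | ⟨k, -, -, rfl⟩)
    · by_contra hc
      obtain ⟨j, rfl⟩ := notMem_mayaOf.1 hc
      have := mem_of_lt_diagLen.2 (hole_neg_iff.1 h1)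
      exact h2 j (Nat.zero_le _) (by omega) rfl
    · exact mem_mayaOf.2 ⟨k, rfl⟩
  · intro h
    obtain ⟨i, rfl⟩ := mem_mayaOf.1 h
    by_cases hi : i < diagLen lam
    · exact Or.inr ⟨i, Nat.zero_le _, by omega, rfl⟩
    · refine Or.inl ⟨?_, fun k _ _ => (hole_ne_particle lam i k).symm⟩
      have := mt particle_nonneg_iff.1 (mt mem_of_lt_diagLen.2 hi)
      omega

theorem hole_mem_hookState {lam : YoungDiagram} {i n : ℕ} (h : i + (n + 1) ≤ diagLen lam) :
    hole lam i ∈ (hookState lam (i + 1) n).occ := by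
  rw [mem_hookState (by omega)]
  refine Or.inl ⟨hole_neg_iff.2 (mem_of_lt_diagLen.1 (by omega)), fun k hk _ he => ?_⟩
  have := (hole_strictMono lam).injective he
  omega

theorem particle_notMem_hookState {lam : YoungDiagram} {i n : ℕ}
    (h : i + (n + 1) ≤ diagLen lam) : particle lam i ∉ (hookState lam (i + 1) n).occ := by
  rw [mem_hookState (by omega)]
  have h0 := particle_nonneg_iff.2 (mem_of_lt_diagLen.1 (show i < diagLen lam by omega))
  rintro (h1 | ⟨k, hk, _, he⟩)
  · omega
  · have := (particle_strictAnti lam).injective he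
    omega

theorem sgn_vac (b : ℤ) : vac.sgn b = (-1) ^ (-b - 1).toNat := by
  unfold sgn
  congr 1
  have : {s | s ∈ vac.occ ∧ b < s} = ↑(Finset.Ioo b 0) := by
    ext s; simp [and_comm]
  rw [this, Set.ncard_coe_finset, Int.card_Ioo]
  congr 1; ring

/-- Every hook move goes from one position above b to another, so the number of particles above b
stays that of the vacuum. -/
theorem sgn_hookState_hole {lam : YoungDiagram} {n : ℕ} : ∀ {i : ℕ} {b : ℤ},
    i + n ≤ diagLen lam → (∀ k, i ≤ k → b < hole lam k) →
    (hookState lam i n).sgn b = vac.sgn b := by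
  induction n with
  | zero => intro i b _ _; rfl
  | succ n ih =>
    intro i b h hb
    have h1 := hole_mem_hookState h
    have h2 := particle_notMem_hookState h
    have h3 := hb i le_rfl
    have h4 := hole_lt_particle_iff.2 (mem_of_lt_diagLen.1 (show i < diagLen lam by omega))
    rw [hookState_succ, sgn_erase (by simp [h1]), sgn_insert h2,
      ih (by omega) (fun k hk => hb k (by omega)), if_pos h3, if_pos (h3.trans h4)]
    ring

/-- The inner hooks are applied first and their particles lie lower, so nothing lies above the
position being filled. -/
theorem sgn_hookState_particle {lam : YoungDiagram} {i n : ℕ}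
    (h : i + (n + 1) ≤ diagLen lam) : (hookState lam (i + 1) n).sgn (particle lam i) = 1 := by
  have : {s | s ∈ (hookState lam (i + 1) n).occ ∧ particle lam i < s} = ∅ := by
    rw [Set.eq_empty_iff_forall_notMem]
    rintro s ⟨hs, hlt⟩
    rw [mem_hookState (by omega)] at hs
    have h0 := particle_nonneg_iff.2 (mem_of_lt_diagLen.1 (show i < diagLen lam by omega))
    rcases hs with hs | ⟨k, hk, _, rfl⟩
    · omega
    · have := particle_strictAnti lam (show i < k by omega)
      omega
  rw [sgn, this, Set.ncard_empty, pow_zero]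

/-- The length of the hook of the `i`-th diagonal box. -/
def diagHook (lam : YoungDiagram) (i : ℕ) : ℕ := lam.rowLen i + lam.colLen i - 2 * i - 1

/-- The diagram is the disjoint union of its diagonal hooks; the i-th consists of the boxes whose
smaller coordinate is i. -/
theorem sum_diagHook (lam : YoungDiagram) :
    ∑ i ∈ Finset.range (diagLen lam), diagHook lam i = lam.card := by
  rw [YoungDiagram.card, Finset.card_eq_sum_card_fiberwise (f := fun c => min c.1 c.2)
    (t := Finset.range (diagLen lam))]
  · refine Finset.sum_congr rfl fun i hi => ?_
    have hd := mem_of_lt_diagLen.1 (Finset.mem_range.1 hi)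
    have hr := YoungDiagram.mem_iff_lt_rowLen.1 hd
    have hc := YoungDiagram.mem_iff_lt_colLen.1 hd
    have : lam.cells.filter (fun c => min c.1 c.2 = i) =
        (Finset.Ico i (lam.rowLen i)).image (fun j => (i, j)) ∪
        (Finset.Ico (i + 1) (lam.colLen i)).image fun j => (j, i) := by
      ext ⟨a, b⟩
      simp only [Finset.mem_filter, YoungDiagram.mem_cells, Finset.mem_union, Finset.mem_image,
        Finset.mem_Ico, Prod.mk.injEq]
      constructor
      · rintro ⟨hm, hmin⟩
        by_cases hab : a ≤ b
        · obtain rfl : a = i := by omega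
          exact Or.inl ⟨b, ⟨hab, YoungDiagram.mem_iff_lt_rowLen.1 hm⟩, rfl, rfl⟩
        · obtain rfl : b = i := by omega
          exact Or.inr ⟨a, ⟨by omega, YoungDiagram.mem_iff_lt_colLen.1 hm⟩, rfl, rfl⟩
      · rintro (⟨j, ⟨h1, h2⟩, rfl, rfl⟩ | ⟨j, ⟨h1, h2⟩, rfl, rfl⟩)
        · exact ⟨YoungDiagram.mem_iff_lt_rowLen.2 h2, by omega⟩
        · exact ⟨YoungDiagram.mem_iff_lt_colLen.2 h2, by omega⟩
    rw [this, Finset.card_union_of_disjoint,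
      Finset.card_image_of_injective _ (fun a b h => (Prod.ext_iff.1 h).2),
      Finset.card_image_of_injective _ (fun a b h => (Prod.ext_iff.1 h).1), Nat.card_Ico,
      Nat.card_Ico, diagHook]
    · omega
    · rw [Finset.disjoint_left]
      rintro ⟨a, b⟩ h1 h2
      simp only [Finset.mem_image, Finset.mem_Ico, Prod.mk.injEq] at h1 h2
      obtain ⟨j, h1, rfl, rfl⟩ := h1
      obtain ⟨j', h2, h3, h4⟩ := h2
      omega
  · rintro ⟨a, b⟩ hc
    have h1 : (a, b) ∈ lam := hc
    simp only [Finset.coe_range, Set.mem_Iio]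
    exact mem_of_lt_diagLen.2 (lam.up_left_mem (min_le_left _ _) (min_le_right _ _) h1)

/-- Each diagonal hook contributes the sign in the definition, the sign of the sea above its hole,
and one further reversal because the new particle lies above the hole: together -1 to the hook
length. The hooks exhaust the diagram, so the kets are the wedge basis up to (-1)^{|λ|}. -/
theorem ket_eq (lam : YoungDiagram) : ket lam = (-1 : ℂ) ^ lam.card • basisVec (mayaOf lam) := by
  have key : ∀ n i, i + n ≤ diagLen lam → (List.range' i n).foldr
      (fun i w => ((-1 : ℂ) ^ (-(lam.rowLen i : ℤ) + (i + 1))) •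
        psi (-(lam.colLen i : ℤ) + i) (psiDag (-(lam.rowLen i : ℤ) + i) w)) vacuum =
      (-1 : ℂ) ^ (∑ k ∈ Finset.range n, diagHook lam (i + k)) • basisVec (hookState lam i n) := by
    intro n
    induction n with
    | zero => intro i _; simp [hookState, vacuum_eq]
    | succ n ih =>
      intro i h
      have hd := mem_of_lt_diagLen.1 (show i < diagLen lam by omega)
      have hr := YoungDiagram.mem_iff_lt_rowLen.1 hd
      have hc := YoungDiagram.mem_iff_lt_colLen.1 hd
      rw [List.range'_succ, List.foldr_cons, ih (i + 1) (by omega), psiDag_eq_wedge,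
        show -(-(lam.rowLen i : ℤ) + i) - 1 = particle lam i by unfold particle; ring,
        show -(lam.colLen i : ℤ) + i = hole lam i by unfold hole; ring]
      have hlin : ∀ (c : ℂ) (w : Maya → ℂ) (a b : ℤ),
          psi b (wedge a (c • w)) = c • psi b (wedge a w) := by
        intro c w a b
        rw [← psi_smul]
        congr 1
        ext S; by_cases hS : a ∈ S.occ <;> simp [wedge, hS]; ring
      rw [hlin, psi_wedge_basisVec (hole_mem_hookState h) (particle_notMem_hookState h)
        (hole_lt_particle_iff.2 hd), sgn_hookState_particle h,
        sgn_hookState_hole (by omega) (fun k hk => hole_strictMono lam (by omega)),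
        sgn_vac, ← hookState_succ, smul_smul, smul_smul,
        Finset.sum_range_succ']
      congr 1
      have h1 : ((-1 : ℂ) ^ (-(lam.rowLen i : ℤ) + (i + 1))) =
          (-1) ^ (lam.rowLen i - i - 1) := by
        rw [show -(lam.rowLen i : ℤ) + (i + 1) = -((lam.rowLen i - i - 1 : ℕ) : ℤ) by omega,
          zpow_neg, zpow_natCast, ← inv_pow, inv_neg_one]
      rw [h1, pow_add]
      have h2 : diagHook lam (i + 0) =
          (lam.rowLen i - i - 1) + (-hole lam i - 1).toNat + 1 := by
        unfold diagHook hole; simp; omega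
      rw [h2, pow_add, pow_add]
      have h3 : ∀ k, i + 1 + k = i + (k + 1) := by intro k; ring
      simp only [h3]
      ring
  have := key (diagLen lam) 0 (by omega)
  rw [hookState_eq_mayaOf] at this
  simp only [zero_add] at this
  rw [sum_diagHook, ← List.range_eq_range'] at this
  exact this

end FreeFermion
end

noncomputable section
namespace FreeFermion
open Maya

/-! ### The degree operator -/

theorem Maya.finite_inversions (S : Maya) :
    {c : ℤ × ℤ | c.1 ∈ S.occ ∧ c.2 ∉ S.occ ∧ c.2 < c.1}.Finite := by
  obtain ⟨B, hB⟩ := (S.finite_gt 0).bddAbove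
  obtain ⟨A, hA⟩ := (S.finite_lt 0).bddBelow
  refine ((Set.finite_Icc (min A 0) (max B 0)).prod (Set.finite_Icc (min A 0) (max B 0))).subset ?_
  rintro ⟨p, k⟩ ⟨hp, hk, hlt⟩
  have h1 : p ≤ max B 0 := by
    by_cases h : 0 < p
    · exact (hB ⟨hp, h⟩).trans (le_max_left _ _)
    · exact (not_lt.1 h).trans (le_max_right _ _)
  have h2 : min A 0 ≤ k := by
    by_cases h : k < 0
    · exact (min_le_left _ _).trans (hA ⟨hk, h⟩)
    · exact (min_le_right _ _).trans (not_lt.1 h)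
  simp only at hlt
  exact ⟨⟨h2.trans hlt.le, h1⟩, ⟨h2, hlt.le.trans h1⟩⟩

/-- The pairs of a particle and a hole below it. -/
def Maya.inversions (S : Maya) : Finset (ℤ × ℤ) := S.finite_inversions.toFinset

theorem Maya.mem_inversions {S : Maya} {c : ℤ × ℤ} :
    c ∈ S.inversions ↔ c.1 ∈ S.occ ∧ c.2 ∉ S.occ ∧ c.2 < c.1 := by
  simp [Maya.inversions]

theorem card_inversions_mayaOf (lam : YoungDiagram) :
    (mayaOf lam).inversions.card = lam.card := by
  symm
  unfold YoungDiagram.card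
  refine Finset.card_bij (fun c _ => (particle lam c.1, hole lam c.2)) ?_ ?_ ?_
  · rintro ⟨i, j⟩ hc
    exact mem_inversions.2 ⟨mem_mayaOf.2 ⟨i, rfl⟩, notMem_mayaOf.2 ⟨j, rfl⟩,
      hole_lt_particle_iff.2 hc⟩
  · rintro ⟨i, j⟩ _ ⟨i', j'⟩ _ h
    obtain ⟨h1, h2⟩ := Prod.ext_iff.1 h
    exact Prod.ext ((particle_strictAnti lam).injective h1) ((hole_strictMono lam).injective h2)
  · rintro ⟨p, k⟩ hc
    obtain ⟨h1, h2, h3⟩ := mem_inversions.1 hc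
    obtain ⟨i, rfl⟩ := mem_mayaOf.1 h1
    obtain ⟨j, rfl⟩ := notMem_mayaOf.1 h2
    exact ⟨(i, j), hole_lt_particle_iff.1 h3, rfl⟩

theorem wedge_psi_tsum {ι : Type} (p k : ℤ) (g : ι → Maya → ℂ) (S : Maya) :
    wedge p (psi k fun X => ∑' i, g i X) S = ∑' i, wedge p (psi k (g i)) S := by
  by_cases hp : p ∈ S.occ
  · by_cases hk : k ∈ (S.erase p).occ
    · simp only [wedge_apply hp, psi_apply_of_mem hk, mul_zero, tsum_zero]
    · simp only [wedge_apply hp, psi_apply hk, tsum_mul_left]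
  · simp only [wedge_apply_of_notMem hp, tsum_zero]

/-- When two particles are moved, exchanging their sources (here) or their targets (next lemma)
changes the sign. This feeds the cancellation in `sum_wedge_psi_wedge_psi`. -/
theorem wedge_psi_wedge_psi_swap_left {p k x y : ℤ} (hkp : k ≠ p) (hkx : k ≠ x) (w : Maya → ℂ) :
    wedge p (psi k (wedge x (psi y w))) = -wedge x (psi k (wedge p (psi y w))) := by
  rw [psi_wedge hkx, psi_wedge hkp, wedge_neg, wedge_neg, wedge_wedge]

theorem wedge_psi_wedge_psi_swap_right {p k x y : ℤ} (hkx : k ≠ x) (hyx : y ≠ x) (w : Maya → ℂ) :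
    wedge p (psi k (wedge x (psi y w))) = -wedge p (psi y (wedge x (psi k w))) := by
  rw [psi_wedge hkx, psi_wedge hyx, psi_psi, wedge_neg, wedge_neg, wedge_neg]

/-- The term y = p undoes the outer move and returns w S; what is left are the two-particle terms.
-/
theorem tsum_wedge_psi_wedge_psi {S : Maya} {p k : ℤ} (h : (p, k) ∈ S.inversions)
    (w : Maya → ℂ) :
    ∑' y : ℤ, wedge p (psi k (wedge (y - (p - k)) (psi y w))) S =
      w S + ∑ y ∈ (S.finite_moves (p - k)).toFinset.erase k,
        wedge p (psi k (wedge (y - (p - k)) (psi y w))) S := by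
  obtain ⟨hp, hk, hlt⟩ := mem_inversions.1 h
  simp only at hp hk hlt
  have hself : wedge p (psi k (wedge k (psi p w))) S = w S := by
    have h1 : k ∉ (S.erase p).occ := by simp [hk]
    rw [wedge_apply hp, psi_apply h1, wedge_apply (by simp), Maya.erase_insert h1,
      psi_apply (by simp), Maya.insert_erase hp, sgn_insert h1, sgn_erase hp, sgn_erase hp]
    rw [if_neg (lt_irrefl k), if_neg (lt_irrefl p), if_pos hlt]
    linear_combination (S.sgn k * S.sgn k * w S) * S.sgn_mul_self p + w S * S.sgn_mul_self k
  have hpm : p ∉ (S.finite_moves (p - k)).toFinset.erase k := by simp [hp]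
  rw [tsum_eq_sum (s := Insert.insert p ((S.finite_moves (p - k)).toFinset.erase k)),
    Finset.sum_insert hpm, sub_sub_cancel, hself]
  intro y hy
  simp only [Finset.mem_insert, Finset.mem_erase, Set.Finite.mem_toFinset, Set.mem_ofPred_eq,
    not_or, not_and] at hy
  rw [wedge_apply hp, psi_apply (by simp [hk]), wedge_psi_eq_zero (by omega), mul_zero, mul_zero]
  simp only [mem_insert, mem_erase, not_or, not_and]
  rintro ⟨h1, h2⟩
  exact ⟨by omega, fun _ => hy.2 h1 (h2 hy.1)⟩

/-- A sign-reversing involution: the same two particles reach the same two holes along exchanged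
routes. Hence a_{-n} a_n summed over n > 0 is a one-body quantity. -/
theorem sum_wedge_psi_wedge_psi (S : Maya) (w : Maya → ℂ) :
    ∑ c ∈ S.inversions, ∑ y ∈ (S.finite_moves (c.1 - c.2)).toFinset.erase c.2,
      wedge c.1 (psi c.2 (wedge (y - (c.1 - c.2)) (psi y w))) S = 0 := by
  rw [Finset.sum_sigma']
  -- If y < p the targets k and y are exchanged, otherwise the sources p and y - (p - k). Either
  -- choice keeps the outer move directed downwards.
  refine Finset.sum_involution (fun a _ =>
    if a.2 < a.1.1 then ⟨(a.1.1, a.2), a.1.2⟩ else ⟨(a.2 - (a.1.1 - a.1.2), a.1.2), a.2⟩)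
    ?_ ?_ ?_ ?_
  · rintro ⟨⟨p, k⟩, y⟩ ha
    simp only [Finset.mem_sigma, mem_inversions, Finset.mem_erase, Set.Finite.mem_toFinset,
      Set.mem_ofPred_eq] at ha ⊢
    obtain ⟨⟨hp, hk, hlt⟩, hyk, hy, hx⟩ := ha
    have hkx : k ≠ y - (p - k) := fun h => hk (h ▸ hx)
    split_ifs with h
    · simp only
      rw [show k - (p - y) = y - (p - k) by ring, wedge_psi_wedge_psi_swap_right hkx (by omega)]
      simp
    · simp only
      rw [show y - (y - (p - k) - k) = p by ring, wedge_psi_wedge_psi_swap_left hlt.ne hkx]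
      simp
  · rintro ⟨⟨p, k⟩, y⟩ ha hne hfix
    simp only [Finset.mem_sigma, mem_inversions, Finset.mem_erase, Set.Finite.mem_toFinset,
      Set.mem_ofPred_eq] at ha hne hfix
    obtain ⟨⟨hp, hk, hlt⟩, hyk, hy, hx⟩ := ha
    split_ifs at hfix with h
    · simp only [Sigma.mk.injEq, Prod.mk.injEq, true_and] at hfix
      exact hyk hfix.1
    · simp only [Sigma.mk.injEq, Prod.mk.injEq, and_true] at hfix
      -- A fixed point would use the particle p twice; its term equals its own negative.
      have hfix' : y - (p - k) = p := by tauto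
      apply hne
      rw [hfix']
      have := congrFun (wedge_psi_wedge_psi_swap_left (y := y) hlt.ne hlt.ne w) S
      rw [Pi.neg_apply] at this
      exact self_eq_neg.1 this
  · rintro ⟨⟨p, k⟩, y⟩ ha
    simp only [Finset.mem_sigma, mem_inversions, Finset.mem_erase, Set.Finite.mem_toFinset,
      Set.mem_ofPred_eq] at ha ⊢
    obtain ⟨⟨hp, hk, hlt⟩, hyk, hy, hx⟩ := ha
    split_ifs with h
    · simp only
      refine ⟨⟨hp, hy, h⟩, Ne.symm hyk, hk, ?_⟩
      rwa [show k - (p - y) = y - (p - k) by ring]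
    · have hyp : y ≠ p := fun h => hy (h ▸ hp)
      simp only
      refine ⟨⟨hx, hk, by omega⟩, hyk, hy, ?_⟩
      rwa [show y - (y - (p - k) - k) = p by ring]
  · rintro ⟨⟨p, k⟩, y⟩ ha
    simp only [Finset.mem_sigma, mem_inversions, Finset.mem_erase, Set.Finite.mem_toFinset,
      Set.mem_ofPred_eq] at ha
    obtain ⟨⟨hp, hk, hlt⟩, hyk, hy, hx⟩ := ha
    by_cases h : y < p
    · simp only [h, hlt, if_true]
    · have h2 : ¬ y < y - (p - k) := by omega
      simp only [h, h2, if_false]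
      rw [show y - (y - (p - k) - k) = p by ring]

/-- The degree operator is diagonal. -/
theorem L0_apply (w : Maya → ℂ) (S : Maya) : L0 w S = S.inversions.card * w S := by
  have hn : ∀ n : ℕ+, ((n : ℕ) : ℤ) ≠ 0 := fun n => by exact_mod_cast n.ne_zero
  let F : ℤ × ℤ → ℂ := fun c => ∑' y : ℤ,
    wedge c.1 (psi c.2 (wedge (y - (c.1 - c.2)) (psi y w))) S
  have h1 : ∀ n : ℕ+, aMode (-(n : ℤ)) (aMode (n : ℤ) w) S = ∑' k : ℤ, F (k + n, k) := by
    intro n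
    rw [aMode_apply (neg_ne_zero.2 (hn n))]
    refine tsum_congr fun k => ?_
    have : aMode (n : ℤ) w = fun X => ∑' y, wedge (y - n) (psi y w) X :=
      funext fun X => aMode_apply (hn n) w X
    rw [this, wedge_psi_tsum, sub_neg_eq_add]
    simp only [F, add_sub_cancel_left]
  have hF : ∀ c : ℤ × ℤ, c.2 < c.1 → c ∉ S.inversions → F c = 0 := by
    rintro ⟨p, k⟩ hlt hc
    have : ∀ v, wedge p (psi k v) S = 0 := by
      intro v
      have := wedge_psi_eq_zero (n := k - p) (k := k) (S := S) (by simp at hlt; omega) (by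
        rw [sub_sub_cancel]
        intro h
        exact hc (mem_inversions.2 ⟨h.2, h.1, hlt⟩)) v
      rwa [sub_sub_cancel] at this
    simp only [F, this, tsum_zero]
  let toPair : ℕ+ × ℤ → ℤ × ℤ := fun c => (c.2 + c.1, c.2)
  have hpair : Function.Injective toPair := by
    rintro ⟨n, k⟩ ⟨n', k'⟩ h
    obtain ⟨h1, h2⟩ := Prod.ext_iff.1 h
    simp only [toPair] at h1 h2
    subst h2
    refine Prod.ext (PNat.eq ?_) rfl
    simp only
    omega
  have hpairlt : ∀ c, (toPair c).2 < (toPair c).1 := by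
    rintro ⟨n, k⟩
    have := n.pos
    simp only [toPair]; omega
  have hfin : (Function.support (F ∘ toPair)).Finite := by
    refine (S.inversions.finite_toSet.preimage hpair.injOn).subset fun c hc => ?_
    by_contra h
    exact hc (hF _ (hpairlt c) h)
  have h2 : L0 w S = ∑ c ∈ S.inversions, F c := by
    unfold L0
    simp only [h1]
    refine (Summable.tsum_prod (f := F ∘ toPair) (summable_of_hasFiniteSupport hfin)).symm.trans ?_
    rw [tsum_eq_sum (s := S.inversions.preimage toPair hpair.injOn)]
    · exact Finset.sum_preimage toPair S.inversions hpair.injOn F (by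
        rintro ⟨p, k⟩ hc hr
        obtain ⟨_, _, h⟩ := mem_inversions.1 hc
        simp only at h
        exact absurd ⟨(⟨(p - k).toNat, by omega⟩, k), by simp [toPair]; omega⟩ hr)
    · intro c hc
      exact hF _ (hpairlt c) (by simpa using hc)
  rw [h2, Finset.sum_congr rfl fun c hc => tsum_wedge_psi_wedge_psi (p := c.1) (k := c.2) hc w,
    Finset.sum_add_distrib, sum_wedge_psi_wedge_psi, Finset.sum_const, nsmul_eq_mul, add_zero]

theorem qOp_L0 (ℓ c : ℂ) (w : Maya → ℂ) (lam : YoungDiagram) :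
    qOp ℓ c L0 w (mayaOf lam) = qPow ℓ (c * lam.card) * w (mayaOf lam) := by
  unfold qOp
  rw [opExp_diagonal (c := fun S => c * ℓ * S.inversions.card), card_inversions_mayaOf, qPow]
  · congr 2; ring
  · intro w S
    rw [Pi.smul_apply, L0_apply, smul_eq_mul]; ring

end FreeFermion
end

noncomputable section
namespace FreeFermion
open Maya

/-! ### Window coefficients -/

/-- The Maya diagram whose occupied positions are those below `-M`. -/
def sea (M : ℕ) : Maya where
  occ := {k | k < -(M : ℤ)}
  finite_diff := by
    refine (Set.finite_Ico (-(M : ℤ)) 0).subset fun k hk => ?_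
    simp only [Set.mem_ofPred_eq, Set.mem_Ico] at hk ⊢
    omega

@[simp] theorem mem_sea {M : ℕ} {k : ℤ} : k ∈ (sea M).occ ↔ k < -(M : ℤ) := Iff.rfl

/-- The contraction with a position as a linear map. -/
def psiLin (k : ℤ) : Module.End ℂ (Maya → ℂ) where
  toFun := psi k
  map_add' := psi_add k
  map_smul' := psi_smul k

/-- The product `ψ_{u_0} ψ_{u_1} ⋯`. -/
def psiProd {M : ℕ} (u : Fin M → ℤ) (w : Maya → ℂ) : Maya → ℂ := (List.ofFn u).foldr psi w

/-- The coefficient of `w` at the (unsorted) sequence of positions `u` above the sea. -/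
def windowCoeff {M : ℕ} (w : Maya → ℂ) (u : Fin M → ℤ) : ℂ := psiProd u w (sea M)

theorem psiProd_succ {M : ℕ} (u : Fin (M + 1) → ℤ) (w : Maya → ℂ) :
    psiProd u w = psi (u 0) (psiProd (fun i => u i.succ) w) := by
  simp [psiProd, List.ofFn_succ]

/-- Carrying a_n through the product with [ψ_u, a_n] = ψ_{u+n} shifts one index at a time. -/
theorem psiProd_aMode {n : ℤ} (hn : n ≠ 0) {M : ℕ} (u : Fin M → ℤ) (w : Maya → ℂ) :
    psiProd u (aMode n w) =
      aMode n (psiProd u w) + ∑ i, psiProd (u + Pi.single i n) w := by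
  induction M with
  | zero => simp [psiProd]
  | succ M ih =>
    rw [psiProd_succ, ih, psi_add, psi_aMode hn, ← psiProd_succ, Fin.sum_univ_succ, add_assoc]
    congr 2
    · rw [psiProd_succ]
      congr 1
      · simp
    · have h : psi (u 0) (∑ i, psiProd ((fun i => u i.succ) + Pi.single i n) w) =
          ∑ i, psi (u 0) (psiProd ((fun i => u i.succ) + Pi.single i n) w) :=
        map_sum (psiLin (u 0)) _ _
      rw [h]
      refine Finset.sum_congr rfl fun i _ => ?_
      rw [psiProd_succ]
      congr 1
      · simp
      · congr 1; ext j; simp [Pi.single_apply]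

/-- At a component S the operator a_{-n} needs a particle n places above a hole, and the sea has
none. -/
theorem aMode_neg_sea {n : ℕ} (hn : 0 < n) (M : ℕ) (w : Maya → ℂ) :
    aMode (-(n : ℤ)) w (sea M) = 0 := by
  rw [aMode_eq_sum (by omega)]
  refine Finset.sum_eq_zero fun k hk => ?_
  simp only [Set.Finite.mem_toFinset, Set.mem_ofPred_eq, mem_sea] at hk
  omega

/-- The purpose of window coefficients: an oscillator lowers one entry by n, with no sign, at the
price of admitting unsorted sequences. -/
theorem windowCoeff_aMode {n : ℕ} (hn : 0 < n) {M : ℕ} (w : Maya → ℂ) (u : Fin M → ℤ) :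
    windowCoeff (aMode (-(n : ℤ)) w) u =
      ∑ i, windowCoeff w (u + Pi.single i (-(n : ℤ))) := by
  unfold windowCoeff
  rw [psiProd_aMode (by omega), Pi.add_apply, aMode_neg_sea hn, zero_add, Finset.sum_apply]

theorem foldr_psi_apply_of_mem {l : List ℤ} {k : ℤ} (hk : k ∈ l) : ∀ {S : Maya}, k ∈ S.occ →
    ∀ w : Maya → ℂ, l.foldr psi w S = 0 := by
  induction l with
  | nil => simp at hk
  | cons a l ih =>
    intro S hS w
    rw [List.foldr_cons]
    by_cases ha : a ∈ S.occ
    · exact psi_apply_of_mem ha _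
    · have hka : k ∈ l := by
        rcases List.mem_cons.1 hk with rfl | h
        · exact absurd hS ha
        · exact h
      rw [psi_apply ha, ih hka (by simp [hS]), mul_zero]

theorem windowCoeff_eq_zero_of_lt {M : ℕ} {u : Fin M → ℤ} {i : Fin M} (hi : u i < -(M : ℤ))
    (w : Maya → ℂ) : windowCoeff w u = 0 :=
  foldr_psi_apply_of_mem (List.mem_ofFn.2 ⟨i, rfl⟩) (mem_sea.2 hi) w

/-- Positions are filled in increasing order, each above every particle already present, so all
signs are +1. -/
theorem foldr_psi_apply_of_sorted {l : List ℤ} (hl : l.Pairwise (· < ·)) : ∀ {S : Maya},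
    (∀ s ∈ S.occ, ∀ k ∈ l, s < k) → ∀ w : Maya → ℂ,
    ∃ S' : Maya, (∀ m, m ∈ S'.occ ↔ m ∈ S.occ ∨ m ∈ l) ∧ l.foldr psi w S = w S' := by
  induction l with
  | nil => intro S _ w; exact ⟨S, by simp, rfl⟩
  | cons a l ih =>
    intro S hS w
    rw [List.pairwise_cons] at hl
    have ha : a ∉ S.occ := fun h => lt_irrefl a (hS a h a (by simp))
    obtain ⟨S', h1, h2⟩ := ih hl.2 (S := S.insert a) (by
      intro s hs k hk
      rcases mem_insert.1 hs with rfl | hs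
      · exact hl.1 k hk
      · exact hS s hs k (by simp [hk])) w
    refine ⟨S', fun m => ?_, ?_⟩
    · rw [h1, mem_insert, List.mem_cons]; tauto
    · have hsgn : S.sgn a = 1 := by
        have : {s | s ∈ S.occ ∧ a < s} = ∅ := by
          rw [Set.eq_empty_iff_forall_notMem]
          rintro s ⟨hs, h⟩
          exact lt_asymm h (hS s hs a (by simp))
        rw [sgn, this, Set.ncard_empty, pow_zero]
      rw [List.foldr_cons, psi_apply ha, hsgn, h2, one_mul]

theorem particle_rev_strictMono (lam : YoungDiagram) (M : ℕ) :
    StrictMono fun i : Fin M => particle lam i.rev := by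
  intro i j h
  refine particle_strictAnti lam ?_
  have : (i : ℕ) < j := h
  have := j.2
  simp only [Fin.val_rev]
  omega

theorem windowCoeff_particle {lam : YoungDiagram} {M : ℕ} (hM : lam.colLen 0 ≤ M)
    (w : Maya → ℂ) :
    windowCoeff w (fun i : Fin M => particle lam i.rev) = w (mayaOf lam) := by
  have hge : ∀ i : Fin M, -(M : ℤ) ≤ particle lam i := by
    intro i; have := i.2; unfold particle; omega
  obtain ⟨S', h1, h2⟩ := foldr_psi_apply_of_sorted
    (l := List.ofFn fun i : Fin M => particle lam i.rev)
    (by rw [List.pairwise_ofFn]; exact fun i j h => particle_rev_strictMono lam M h)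
    (S := sea M) (by
      intro s hs k hk
      obtain ⟨i, rfl⟩ := List.mem_ofFn.1 hk
      exact lt_of_lt_of_le (mem_sea.1 hs) (hge _)) w
  refine h2.trans (congrArg w (Maya.ext (Set.ext fun m => ?_)))
  rw [h1, mem_sea, List.mem_ofFn, mem_mayaOf]
  constructor
  · rintro (h | ⟨i, rfl⟩)
    · refine ⟨(-m - 1).toNat, ?_⟩
      rw [particle_eq (by omega)]; omega
    · exact ⟨_, rfl⟩
  · rintro ⟨i, rfl⟩
    by_cases h : i < M
    · exact Or.inr ⟨Fin.rev ⟨i, h⟩, by rw [Fin.rev_rev]⟩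
    · left
      rw [particle_eq (by omega)]; omega

/-- On window coefficients both oscillators are sums of shifts of single entries, and shifts
commute. -/
theorem aMode_neg_comm {n m : ℕ} (hn : 0 < n) (hm : 0 < m) (w : Maya → ℂ)
    (lam : YoungDiagram) :
    aMode (-(n : ℤ)) (aMode (-(m : ℤ)) w) (mayaOf lam) =
      aMode (-(m : ℤ)) (aMode (-(n : ℤ)) w) (mayaOf lam) := by
  simp only [← windowCoeff_particle (le_refl (lam.colLen 0)), windowCoeff_aMode hn,
    windowCoeff_aMode hm]
  rw [Finset.sum_comm]
  simp only [add_right_comm]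

/-- The contraction with a linear combination of positions. -/
def psiSpan : (ℤ →₀ ℂ) →ₗ[ℂ] Module.End ℂ (Maya → ℂ) := Finsupp.linearCombination ℂ psiLin

theorem psiSpan_anticomm (f g : ℤ →₀ ℂ) : psiSpan f * psiSpan g + psiSpan g * psiSpan f = 0 := by
  induction f using Finsupp.induction_linear with
  | zero => simp
  | add f₁ f₂ h₁ h₂ =>
    rw [map_add, add_mul, mul_add, add_add_add_comm, h₁, h₂, add_zero]
  | single j a =>
    induction g using Finsupp.induction_linear with
    | zero => simp
    | add f₁ f₂ h₁ h₂ =>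
      rw [map_add, add_mul, mul_add, add_add_add_comm, h₁, h₂, add_zero]
    | single k b =>
      have h : psiLin j * psiLin k = -(psiLin k * psiLin j) :=
        LinearMap.ext fun w => psi_psi j k w
      simp only [psiSpan, Finsupp.linearCombination_single, smul_mul_smul_comm]
      rw [h, mul_comm b a, smul_neg, neg_add_cancel]

theorem psiSpan_mul_self (f : ℤ →₀ ℂ) : psiSpan f * psiSpan f = 0 := by
  have h := psiSpan_anticomm f f
  rw [← two_smul ℂ] at h
  exact (smul_eq_zero.1 h).resolve_left two_ne_zero

/-- The products of contractions as an alternating map. -/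
def psiAlt (M : ℕ) : (ℤ →₀ ℂ) [⋀^Fin M]→ₗ[ℂ] Module.End ℂ (Maya → ℂ) :=
  (ExteriorAlgebra.lift ℂ ⟨psiSpan, psiSpan_mul_self⟩).toLinearMap.compAlternatingMap
    (ExteriorAlgebra.ιMulti ℂ M)

/-- As the value of an alternating map obtained from the exterior algebra, the product inherits the
permutation sign and the vanishing on repeated positions. -/
theorem psiProd_eq_psiAlt {M : ℕ} (u : Fin M → ℤ) (w : Maya → ℂ) :
    psiProd u w = psiAlt M (fun i => Finsupp.single (u i) 1) w := by
  have h : psiAlt M (fun i => Finsupp.single (u i) 1) =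
      (List.ofFn fun i => psiLin (u i)).prod := by
    simp only [psiAlt, LinearMap.compAlternatingMap_apply, ExteriorAlgebra.ιMulti_apply,
      AlgHom.toLinearMap_apply, map_list_prod, List.map_ofFn]
    congr 2
    ext i : 1
    simp [psiSpan]
  rw [h]
  clear h
  induction M with
  | zero => simp [psiProd]
  | succ M ih => rw [psiProd_succ, ih, List.ofFn_succ, List.prod_cons]; rfl

theorem windowCoeff_perm {M : ℕ} (w : Maya → ℂ) (u : Fin M → ℤ) (σ : Equiv.Perm (Fin M)) :
    windowCoeff w (u ∘ σ) = ((Equiv.Perm.sign σ : ℤ) : ℂ) * windowCoeff w u := by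
  unfold windowCoeff
  rw [psiProd_eq_psiAlt, psiProd_eq_psiAlt]
  have := (psiAlt M).map_perm (fun i => Finsupp.single (u i) 1) σ
  have h2 : (fun i => Finsupp.single ((u ∘ σ) i) (1 : ℂ)) =
      (fun i => Finsupp.single (u i) 1) ∘ σ := rfl
  rw [h2, this]
  rcases Int.units_eq_one_or (Equiv.Perm.sign σ) with h | h <;> simp [h]

theorem windowCoeff_of_not_injective {M : ℕ} (w : Maya → ℂ) {u : Fin M → ℤ}
    (hu : ¬Function.Injective u) : windowCoeff w u = 0 := by
  unfold windowCoeff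
  rw [psiProd_eq_psiAlt, (psiAlt M).map_eq_zero_of_not_injective]
  · rfl
  · intro h
    refine hu fun i j hij => h ?_
    simp only [hij]

end FreeFermion
end

noncomputable section
namespace FreeFermion
open Maya

/-! ### The oscillators as finite matrices -/

/-- The Young diagrams with at most `K` boxes. -/
abbrev BoundedDiagram (K : ℕ) : Type := {lam : YoungDiagram // lam.card ≤ K}

theorem YoungDiagram.finite_card_le (K : ℕ) : {lam : YoungDiagram | lam.card ≤ K}.Finite := by
  refine Set.Finite.of_finite_image (f := YoungDiagram.cells)
    (((Finset.range K ×ˢ Finset.range K).powerset.finite_toSet).subset ?_) ?_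
  · rintro _ ⟨lam, hlam, rfl⟩
    simp only [Finset.coe_powerset, Set.mem_preimage, Set.mem_powerset_iff, Finset.coe_subset]
    rintro ⟨i, j⟩ hc
    have h1 : (i, j) ∈ lam := hc
    have h2 : (Finset.range (i + 1)).image (fun a => (a, j)) ⊆ lam.cells := by
      intro c hc
      simp only [Finset.mem_image, Finset.mem_range] at hc
      obtain ⟨a, ha, rfl⟩ := hc
      exact lam.up_left_mem (by omega) le_rfl h1
    have h3 : (Finset.range (j + 1)).image (fun b => (i, b)) ⊆ lam.cells := by
      intro c hc
      simp only [Finset.mem_image, Finset.mem_range] at hc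
      obtain ⟨b, hb, rfl⟩ := hc
      exact lam.up_left_mem le_rfl (by omega) h1
    have h4 := Finset.card_le_card h2
    have h5 := Finset.card_le_card h3
    rw [Finset.card_image_of_injective _ (fun a b h => (Prod.ext_iff.1 h).1),
      Finset.card_range] at h4
    rw [Finset.card_image_of_injective _ (fun a b h => (Prod.ext_iff.1 h).2),
      Finset.card_range] at h5
    have h6 : lam.cells.card ≤ K := hlam
    simp only [Finset.mem_product, Finset.mem_range]
    omega
  · intro a _ b _ h
    exact YoungDiagram.ext h

instance (K : ℕ) : Fintype (BoundedDiagram K) := (YoungDiagram.finite_card_le K).fintype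

instance (K : ℕ) : DecidableEq (BoundedDiagram K) := Classical.decEq _

theorem aMode_basisVec_support {n : ℤ} (hn : n ≠ 0) {lam eta : YoungDiagram}
    (h : aMode n (basisVec (mayaOf eta)) (mayaOf lam) ≠ 0) :
    (eta.card : ℤ) = lam.card + n := by
  rw [aMode_eq_sum hn] at h
  obtain ⟨k, hk, hne⟩ := Finset.exists_ne_zero_of_sum_ne_zero h
  simp only [Set.Finite.mem_toFinset, Set.mem_ofPred_eq] at hk
  obtain ⟨κ, hκ, hcard⟩ := exists_mayaOf_move hk.1 hk.2
  have h1 := right_ne_zero_of_mul (right_ne_zero_of_mul hne)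
  have h2 : mayaOf κ = mayaOf eta := by
    by_contra hc
    rw [hκ] at h1
    exact h1 (basisVec_of_ne hc)
  rw [← mayaOf_injective h2, hcard]

/-- A move and its reversal cross the same particles and carry the same sign, so a_{-n} is the
transpose of a_n. -/
theorem aMode_basisVec_comm {n : ℤ} (hn : n ≠ 0) (S T : Maya) :
    aMode n (basisVec T) S = aMode (-n) (basisVec S) T := by
  have key : ∀ {n : ℤ} {S T : Maya} {k : ℤ}, k ∉ S.occ → k - n ∈ S.occ → n ≠ 0 →
      (S.erase (k - n)).insert k = T →
      (k - n ∉ T.occ ∧ k - n - -n ∈ T.occ) ∧ (T.erase (k - n - -n)).insert (k - n) = S ∧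
        T.sgn (k - n - -n) * (T.erase (k - n - -n)).sgn (k - n) =
          S.sgn (k - n) * (S.erase (k - n)).sgn k := by
    rintro n S T k hk hl hn rfl
    have h1 : k - n - -n = k := by ring
    have hk' : k ∉ (S.erase (k - n)).occ := by simp [hk]
    rw [h1, Maya.erase_insert hk', Maya.insert_erase hl, sgn_insert hk', sgn_erase hl (k - n),
      if_neg (lt_irrefl _), if_neg (lt_irrefl _)]
    refine ⟨⟨?_, by simp⟩, rfl, by ring⟩
    rw [mem_insert, mem_erase]
    rintro (h | h)
    · omega
    · exact h.1 rfl
  rw [aMode_eq_sum hn, aMode_eq_sum (neg_ne_zero.2 hn)]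
  classical
  have hconv : ∀ {n : ℤ} (S T : Maya), ∑ k ∈ (S.finite_moves n).toFinset,
      S.sgn (k - n) * ((S.erase (k - n)).sgn k * basisVec T ((S.erase (k - n)).insert k)) =
      ∑ k ∈ (S.finite_moves n).toFinset with (S.erase (k - n)).insert k = T,
        S.sgn (k - n) * (S.erase (k - n)).sgn k := by
    intro n S T
    rw [Finset.sum_filter]
    refine Finset.sum_congr rfl fun k _ => ?_
    split_ifs with h
    · rw [h, basisVec_self]; ring
    · rw [basisVec_of_ne h]; ring
  rw [hconv, hconv]
  refine Finset.sum_nbij' (fun k => k - n) (fun k => k - -n) ?_ ?_ ?_ ?_ ?_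
  · intro k hk
    simp only [Finset.mem_filter, Set.Finite.mem_toFinset, Set.mem_ofPred_eq] at hk ⊢
    obtain ⟨h1, h2, -⟩ := key hk.1.1 hk.1.2 hn hk.2
    exact ⟨h1, h2⟩
  · intro k hk
    simp only [Finset.mem_filter, Set.Finite.mem_toFinset, Set.mem_ofPred_eq] at hk ⊢
    obtain ⟨h1, h2, -⟩ := key hk.1.1 hk.1.2 (neg_ne_zero.2 hn) hk.2
    rw [neg_neg] at h1 h2
    exact ⟨h1, h2⟩
  · intro k _; ring
  · intro k _; ring
  · intro k hk
    simp only [Finset.mem_filter, Set.Finite.mem_toFinset, Set.mem_ofPred_eq] at hk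
    exact (key hk.1.1 hk.1.2 hn hk.2).2.2.symm

/-- An oscillator of non-zero index acts within charge zero through its matrix elements. -/
theorem aMode_apply_eq_sum {n : ℤ} (hn : n ≠ 0) {K : ℕ} (w : Maya → ℂ) (lam : YoungDiagram)
    (hw : ∀ eta : YoungDiagram, (eta.card : ℤ) = lam.card + n → K < eta.card →
      w (mayaOf eta) = 0) :
    aMode n w (mayaOf lam) = ∑ eta : BoundedDiagram K,
      aMode n (basisVec (mayaOf eta.1)) (mayaOf lam) * w (mayaOf eta.1) := by
  simp only [aMode_eq_sum hn, Finset.sum_mul]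
  rw [Finset.sum_comm]
  refine Finset.sum_congr rfl fun k hk => ?_
  simp only [Set.Finite.mem_toFinset, Set.mem_ofPred_eq] at hk
  obtain ⟨κ, hκ, hcard⟩ := exists_mayaOf_move hk.1 hk.2
  rw [hκ]
  have hne : ∀ eta : BoundedDiagram K, eta.1 ≠ κ → basisVec (mayaOf eta.1) (mayaOf κ) = 0 :=
    fun eta h => basisVec_of_ne fun h' => h (mayaOf_injective h').symm
  by_cases hK : κ.card ≤ K
  · rw [Finset.sum_eq_single (⟨κ, hK⟩ : BoundedDiagram K)]
    · rw [basisVec_self]; ring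
    · intro eta _ h
      rw [hne eta fun h' => h (Subtype.ext h')]; ring
    · intro h; exact absurd (Finset.mem_univ _) h
  · rw [hw κ hcard (not_le.1 hK), Finset.sum_eq_zero]
    · ring
    · intro eta _
      rw [hne eta fun h => hK (h ▸ eta.2)]; ring

theorem tsum_pnat_eq_sum {K : ℕ} (g : ℕ → ℂ) (hg : ∀ n, K < n → g n = 0) :
    ∑' n : ℕ+, g n = ∑ n ∈ Finset.Icc 1 K, g n := by
  rw [tsum_eq_sum (s := (Finset.Icc 1 K).preimage ((↑) : ℕ+ → ℕ) PNat.coe_injective.injOn)]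
  · refine Finset.sum_preimage _ _ PNat.coe_injective.injOn g fun n hn hr => ?_
    exact absurd ⟨⟨n, (Finset.mem_Icc.1 hn).1⟩, rfl⟩ hr
  · intro n hn
    refine hg _ ?_
    by_contra h
    exact hn (Finset.mem_preimage.2 (Finset.mem_Icc.2 ⟨n.pos, not_lt.1 h⟩))

/-- The matrix of `a_{-n}`. -/
def oscMatrix (K n : ℕ) : Matrix (BoundedDiagram K) (BoundedDiagram K) ℂ :=
  Matrix.of fun lam eta => aMode (-(n : ℤ)) (basisVec (mayaOf eta.1)) (mayaOf lam.1)

/-- The degree matrix. -/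
def degMatrix (K : ℕ) : Matrix (BoundedDiagram K) (BoundedDiagram K) ℂ :=
  Matrix.diagonal fun lam => (lam.1.card : ℂ)

section

variable {K n m : ℕ}

theorem oscMatrix_support (hn : 0 < n) {lam eta : BoundedDiagram K}
    (h : oscMatrix K n lam eta ≠ 0) : eta.1.card + n = lam.1.card := by
  have := aMode_basisVec_support (by omega) h
  omega

/-- The components of a_{-n} w involve only components of w along smaller diagrams, so truncation is
exact for every w. The operator a_n refers to larger diagrams, which is why `aMode_pos_apply` asks w
to vanish beyond K. -/
theorem aMode_neg_apply (hn : 0 < n) (w : Maya → ℂ) (lam : BoundedDiagram K) :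
    aMode (-(n : ℤ)) w (mayaOf lam.1) =
      ∑ eta : BoundedDiagram K, oscMatrix K n lam eta * w (mayaOf eta.1) := by
  refine aMode_apply_eq_sum (by omega) w lam.1 fun eta h1 h2 => ?_
  have := lam.2
  omega

theorem aMode_pos_apply (hn : 0 < n) {w : Maya → ℂ}
    (hw : ∀ eta : YoungDiagram, K < eta.card → w (mayaOf eta) = 0) (lam : BoundedDiagram K) :
    aMode n w (mayaOf lam.1) =
      ∑ eta : BoundedDiagram K, oscMatrix K n eta lam * w (mayaOf eta.1) := by
  rw [aMode_apply_eq_sum (K := K) (by omega) w lam.1 fun eta _ => hw eta]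
  refine Finset.sum_congr rfl fun eta _ => ?_
  rw [aMode_basisVec_comm (by omega)]
  rfl

theorem oscMatrix_commute (hn : 0 < n) (hm : 0 < m) :
    Commute (oscMatrix K n) (oscMatrix K m) := by
  ext lam eta
  have h := aMode_neg_comm hn hm (basisVec (mayaOf eta.1)) lam.1
  rw [aMode_neg_apply hn, aMode_neg_apply hm] at h
  exact h

theorem degMatrix_mul_oscMatrix (hn : 0 < n) :
    degMatrix K * oscMatrix K n = oscMatrix K n * degMatrix K + (n : ℂ) • oscMatrix K n := by
  ext lam eta
  rw [degMatrix, Matrix.diagonal_mul, Matrix.add_apply, Matrix.mul_diagonal, Matrix.smul_apply,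
    smul_eq_mul]
  by_cases h : oscMatrix K n lam eta = 0
  · rw [h]; ring
  · rw [← oscMatrix_support hn h]; push_cast; ring

/-- The diagonal form of L₀ as a matrix identity; the terms with n > K vanish on diagrams with at
most K boxes. -/
theorem sum_oscMatrix_mul_transpose :
    ∑ n ∈ Finset.Icc 1 K, oscMatrix K n * (oscMatrix K n).transpose = degMatrix K := by
  ext lam eta
  have h1 : ∀ n : ℕ, 0 < n → (oscMatrix K n * (oscMatrix K n).transpose) lam eta =
      aMode (-(n : ℤ)) (aMode n (basisVec (mayaOf eta.1))) (mayaOf lam.1) := by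
    intro n hn
    rw [aMode_neg_apply hn, Matrix.mul_apply]
    refine Finset.sum_congr rfl fun κ _ => ?_
    rw [aMode_basisVec_comm (by omega)]
    rfl
  have h2 := L0_apply (basisVec (mayaOf eta.1)) (mayaOf lam.1)
  rw [L0, card_inversions_mayaOf] at h2
  rw [Matrix.sum_apply, degMatrix, Matrix.diagonal_apply]
  have h3 : (if lam = eta then (lam.1.card : ℂ) else 0) =
      lam.1.card * basisVec (mayaOf eta.1) (mayaOf lam.1) := by
    split_ifs with h
    · rw [h, basisVec_self, mul_one]
    · rw [basisVec_of_ne fun h' => h (Subtype.ext (mayaOf_injective h')), mul_zero]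
  rw [h3, ← h2]
  symm
  have h4 : ∀ n : ℕ, K < n → (oscMatrix K n * (oscMatrix K n).transpose) lam eta = 0 := by
    intro n hn
    rw [Matrix.mul_apply]
    refine Finset.sum_eq_zero fun κ _ => ?_
    by_contra h
    have h4 := oscMatrix_support (by omega) (left_ne_zero_of_mul h)
    have h5 := lam.2
    omega
  rw [← tsum_pnat_eq_sum (fun n : ℕ => (oscMatrix K n * (oscMatrix K n).transpose) lam eta) h4]
  exact tsum_congr fun n => (h1 n n.pos).symm

end

/-! ### Transposition -/

-- Only the particles jumped over contribute; those above both ends are counted twice.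
open Classical in
theorem Maya.sgn_move (S : Maya) {k : ℤ} {n : ℕ} (hn : 0 < n) :
    S.sgn (k + n) * (S.erase (k + n)).sgn k =
      (-1) ^ ((Finset.Ioo k (k + n)).filter (· ∈ S.occ)).card := by
  have h1 : {s | s ∈ (S.erase (k + n)).occ ∧ k < s} =
      {s | s ∈ S.occ ∧ k + n < s} ∪ ↑((Finset.Ioo k (k + n)).filter (· ∈ S.occ)) := by
    ext s
    simp only [mem_erase, Set.mem_ofPred_eq, Set.mem_union, Finset.coe_filter, Finset.mem_Ioo]
    constructor
    · rintro ⟨⟨h1, h2⟩, h3⟩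
      rcases lt_or_gt_of_ne h1 with h4 | h4
      · exact Or.inr ⟨⟨h3, h4⟩, h2⟩
      · exact Or.inl ⟨h2, h4⟩
    · rintro (⟨h1, h2⟩ | ⟨⟨h1, h2⟩, h3⟩)
      · exact ⟨⟨by omega, h1⟩, by omega⟩
      · exact ⟨⟨by omega, h3⟩, h1⟩
  rw [sgn, sgn, h1, Set.ncard_union_eq _ (S.finite_gt _) (Finset.finite_toSet _),
    Set.ncard_coe_finset, pow_add, ← mul_assoc, ← mul_pow]
  · simp
  · rw [Set.disjoint_left]
    rintro s ⟨_, h2⟩ h3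
    simp only [Finset.coe_filter, Finset.mem_Ioo, Set.mem_ofPred_eq] at h3
    omega

theorem oscMatrix_apply {K n : ℕ} (hn : 0 < n) (lam eta : BoundedDiagram K) :
    oscMatrix K n lam eta = ∑' k : ℤ, wedge (k + n) (psi k (basisVec (mayaOf eta.1)))
      (mayaOf lam.1) := by
  rw [oscMatrix, Matrix.of_apply, aMode_apply (by omega)]
  simp only [sub_neg_eq_add]

/-- Transposition turns the holes jumped over into particles jumped over. The two numbers add up to
the n - 1 interior positions, which gives the relative sign. -/
theorem wedge_psi_basisVec_transpose {n : ℕ} (hn : 0 < n) (lam eta : YoungDiagram) (k : ℤ) :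
    wedge (-k - 1) (psi (-k - n - 1) (basisVec (mayaOf eta.transpose))) (mayaOf lam.transpose) =
      (-1) ^ (n - 1) * wedge (k + n) (psi k (basisVec (mayaOf eta))) (mayaOf lam) := by
  classical
  have hn0 : (-(n : ℤ)) ≠ 0 := by omega
  have e1 : k + n = k - -(n : ℤ) := by ring
  have e2 : -k - 1 = (-k - n - 1) - -(n : ℤ) := by ring
  by_cases h : k ∉ (mayaOf lam).occ ∧ k + n ∈ (mayaOf lam).occ
  swap
  · rw [e1] at h ⊢
    rw [wedge_psi_eq_zero hn0 h, mul_zero, e2, wedge_psi_eq_zero hn0]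
    rw [← e2, mem_mayaOf_transpose, mem_mayaOf_transpose, show -(-k - 1) - 1 = k by ring,
      show -(-k - n - 1) - 1 = k - -(n : ℤ) by ring]
    tauto
  obtain ⟨hk, hl⟩ := h
  have ht : -k - n - 1 ∉ (mayaOf lam.transpose).occ ∧ -k - 1 ∈ (mayaOf lam.transpose).occ := by
    rw [mem_mayaOf_transpose, mem_mayaOf_transpose, show -(-k - 1) - 1 = k by ring,
      show -(-k - n - 1) - 1 = k + n by ring]
    tauto
  have e3 : -k - 1 = -k - n - 1 + n := by ring
  obtain ⟨κ, hκ, -⟩ := exists_mayaOf_move (n := -n) hk (by rwa [← e1])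
  have hκt : ((mayaOf lam.transpose).erase (-k - 1)).insert (-k - n - 1) =
      mayaOf κ.transpose := by
    ext m
    rw [mem_mayaOf_transpose, ← hκ]
    simp only [mem_insert, mem_erase, mem_mayaOf_transpose]
    rw [← e1, not_or, not_and]
    constructor
    · rintro (h | ⟨h1, h2⟩)
      · exact ⟨by omega, fun h' => by omega⟩
      · exact ⟨by omega, fun _ => h2⟩
    · rintro ⟨h1, h2⟩
      by_cases h : m = -k - n - 1
      · exact Or.inl h
      · exact Or.inr ⟨by omega, h2 (by omega)⟩
  rw [← e1] at hκ
  rw [wedge_apply hl, wedge_apply ht.2, psi_apply fun h => hk (mem_erase.1 h).2,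
    psi_apply fun h => ht.1 (mem_erase.1 h).2, hκ, hκt]
  have s1 := Maya.sgn_move (mayaOf lam) (k := k) hn
  have s2 := Maya.sgn_move (mayaOf lam.transpose) (k := -k - n - 1) hn
  rw [← e3] at s2
  have hb : basisVec (mayaOf eta.transpose) (mayaOf κ.transpose) =
      basisVec (mayaOf eta) (mayaOf κ) := by
    by_cases h : κ = eta
    · rw [h, basisVec_self, basisVec_self]
    · rw [basisVec_of_ne fun h' => h (mayaOf_injective h'), basisVec_of_ne fun h' =>
        h (YoungDiagram.transpose_eq_iff.1 (mayaOf_injective h'))]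
  rw [hb]
  have hcount : ((Finset.Ioo (-k - n - 1) (-k - 1)).filter
      (· ∈ (mayaOf lam.transpose).occ)).card =
      ((Finset.Ioo k (k + n)).filter (· ∉ (mayaOf lam).occ)).card := by
    refine Finset.card_nbij' (fun m => -m - 1) (fun m => -m - 1) ?_ ?_ ?_ ?_
    · intro m hm
      simp only [Finset.coe_filter, Finset.mem_Ioo, mem_mayaOf_transpose, Set.mem_ofPred_eq] at hm ⊢
      exact ⟨⟨by omega, by omega⟩, hm.2⟩
    · intro m hm
      simp only [Finset.coe_filter, Finset.mem_Ioo, mem_mayaOf_transpose, Set.mem_ofPred_eq] at hm ⊢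
      refine ⟨⟨by omega, by omega⟩, ?_⟩
      rw [show -(-m - 1) - 1 = m by ring]
      exact hm.2
    · intro m _; simp
    · intro m _; simp
  have htot := Finset.card_filter_add_card_filter_not (s := Finset.Ioo k (k + n))
    (fun m => m ∈ (mayaOf lam).occ)
  rw [Int.card_Ioo] at htot
  have hexp : n - 1 = ((Finset.Ioo k (k + n)).filter (· ∈ (mayaOf lam).occ)).card +
      ((Finset.Ioo k (k + n)).filter (· ∉ (mayaOf lam).occ)).card := by omega
  have hsign : (-1 : ℂ) ^ ((Finset.Ioo k (k + n)).filter (· ∈ (mayaOf lam).occ)).card *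
      (-1) ^ ((Finset.Ioo k (k + n)).filter (· ∈ (mayaOf lam).occ)).card = 1 := by
    rw [← mul_pow]; simp
  rw [hcount] at s2
  rw [hexp, pow_add]
  generalize (-1 : ℂ) ^ ((Finset.Ioo k (k + n)).filter (· ∈ (mayaOf lam).occ)).card = x at *
  generalize (-1 : ℂ) ^ ((Finset.Ioo k (k + n)).filter (· ∉ (mayaOf lam).occ)).card = y at *
  generalize basisVec (mayaOf eta) (mayaOf κ) = z at *
  linear_combination z * s2 - x * y * z * s1 - y * z * hsign

/-- The transposition of bounded diagrams. -/
def transposeEquiv (K : ℕ) : BoundedDiagram K ≃ BoundedDiagram K where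
  toFun lam := ⟨lam.1.transpose, (card_transpose lam.1).trans_le lam.2⟩
  invFun lam := ⟨lam.1.transpose, (card_transpose lam.1).trans_le lam.2⟩
  left_inv lam := Subtype.ext lam.1.transpose_transpose
  right_inv lam := Subtype.ext lam.1.transpose_transpose

/-- The matrix form of the involution ω p_n = (-1)^{n-1} p_n of symmetric functions. -/
theorem oscMatrix_transpose {K n : ℕ} (hn : 0 < n) :
    (oscMatrix K n).submatrix (transposeEquiv K) (transposeEquiv K) =
      (-1 : ℂ) ^ (n - 1) • oscMatrix K n := by
  ext lam eta
  rw [Matrix.submatrix_apply, Matrix.smul_apply, oscMatrix_apply hn, oscMatrix_apply hn,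
    smul_eq_mul, ← tsum_mul_left, ← (Equiv.subLeft (-(n : ℤ) - 1)).tsum_eq]
  refine tsum_congr fun k => ?_
  rw [← wedge_psi_basisVec_transpose hn, Equiv.subLeft_apply,
    show -(n : ℤ) - 1 - k + n = -k - 1 by ring, show -(n : ℤ) - 1 - k = -k - n - 1 by ring]
  rfl

end FreeFermion
end

noncomputable section
namespace FreeFermion
open Maya

/-! ### Exponentials of nilpotent elements -/

/-- Commutation with D is a derivation, so [D, exp a] = a' exp a when a' = [D, a] commutes with a.
Every degree recursion below is an instance. -/
theorem mul_nilpotent_exp {A : Type*} [Ring A] [Algebra ℚ A] {D a a' : A} (ha : IsNilpotent a)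
    (h : D * a = a * D + a') (hc : Commute a a') :
    D * IsNilpotent.exp a = IsNilpotent.exp a * D + a' * IsNilpotent.exp a := by
  have hpow : ∀ k : ℕ, D * a ^ (k + 1) = a ^ (k + 1) * D + ((k : ℚ) + 1) • (a' * a ^ k) := by
    intro k
    induction k with
    | zero => simp [h]
    | succ k ih =>
      rw [pow_succ a (k + 1), ← mul_assoc, ih, add_mul, mul_assoc, h, mul_add, smul_mul_assoc,
        mul_assoc a', ← pow_succ, (hc.pow_left (k + 1)).eq, mul_assoc, add_assoc]
      congr 1
      push_cast
      module
  obtain ⟨n, hn⟩ := ha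
  -- The exponential is written with n + 1 terms once and with n terms once, because the derivation
  -- lowers the exponent by one.
  have hn' : a ^ (n + 1) = 0 := by rw [pow_succ, hn, zero_mul]
  have e0 := IsNilpotent.exp_eq_sum hn
  have e1 := IsNilpotent.exp_eq_sum hn'
  rw [Finset.sum_range_succ'] at e1
  simp only [pow_zero, Nat.factorial_zero, Nat.cast_one, inv_one, one_smul] at e1
  have hterm : ∀ k : ℕ, D * (((k + 1).factorial : ℚ)⁻¹ • a ^ (k + 1)) =
      (((k + 1).factorial : ℚ)⁻¹ • a ^ (k + 1)) * D + a' * ((k.factorial : ℚ)⁻¹ • a ^ k) := by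
    intro k
    rw [mul_smul_comm, hpow, smul_add, smul_mul_assoc, smul_smul, mul_smul_comm]
    congr 2
    rw [Nat.factorial_succ]
    push_cast
    have h1 : (k.factorial : ℚ) ≠ 0 := by exact_mod_cast k.factorial_ne_zero
    have h2 : (k : ℚ) + 1 ≠ 0 := by positivity
    field_simp
  calc D * IsNilpotent.exp a
      = ∑ k ∈ Finset.range n, D * (((k + 1).factorial : ℚ)⁻¹ • a ^ (k + 1)) + D := by
        rw [e1, mul_add, Finset.mul_sum, mul_one]
    _ = (∑ k ∈ Finset.range n, ((k + 1).factorial : ℚ)⁻¹ • a ^ (k + 1) + 1) * D +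
          a' * ∑ k ∈ Finset.range n, (k.factorial : ℚ)⁻¹ • a ^ k := by
        rw [Finset.sum_congr rfl fun k _ => hterm k, Finset.sum_add_distrib, add_mul,
          Finset.sum_mul, Finset.mul_sum, one_mul, add_right_comm]
    _ = IsNilpotent.exp a * D + a' * IsNilpotent.exp a := by rw [← e1, ← e0]

section Triangular

variable {ι : Type*} [Fintype ι] [DecidableEq ι] {deg : ι → ℕ} {B : Matrix ι ι ℂ}

theorem triangular_pow (hB : ∀ i j, B i j ≠ 0 → deg j < deg i) (k : ℕ) :
    ∀ i j, (B ^ k) i j ≠ 0 → deg j + k ≤ deg i := by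
  induction k with
  | zero =>
    intro i j h
    rw [pow_zero, Matrix.one_apply] at h
    have : i = j := by by_contra hc; exact h (if_neg hc)
    rw [this]; rfl
  | succ k ih =>
    intro i j h
    rw [pow_succ, Matrix.mul_apply] at h
    obtain ⟨l, -, hl⟩ := Finset.exists_ne_zero_of_sum_ne_zero h
    have h1 := ih i l (left_ne_zero_of_mul hl)
    have h2 := hB l j (right_ne_zero_of_mul hl)
    omega

theorem triangular_pow_eq_zero {K : ℕ} (hB : ∀ i j, B i j ≠ 0 → deg j < deg i)
    (hK : ∀ i, deg i ≤ K) : B ^ (K + 1) = 0 := by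
  ext i j
  by_contra h
  have h1 := triangular_pow hB _ i j h
  have h2 := hK i
  omega

theorem triangular_exp_apply {K : ℕ} (hB : ∀ i j, B i j ≠ 0 → deg j < deg i)
    (hK : ∀ i, deg i ≤ K) {i j : ι} (hij : deg i ≤ deg j) :
    IsNilpotent.exp B i j = if i = j then 1 else 0 := by
  rw [IsNilpotent.exp_eq_sum (triangular_pow_eq_zero hB hK), Matrix.sum_apply,
    Finset.sum_eq_single 0]
  · simp [Matrix.one_apply]
  · intro k _ hk
    have : (B ^ k) i j = 0 := by
      by_contra h
      have := triangular_pow hB _ i j h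
      omega
    rw [Matrix.smul_apply, this, smul_zero]
  · intro h; simp at h

end Triangular

/-! ### Skew Schur matrices -/

/-- The matrix of `∑_{n>0} c_n a_{-n}`. -/
def creationMatrix (K : ℕ) (c : ℕ → ℂ) : Matrix (BoundedDiagram K) (BoundedDiagram K) ℂ :=
  ∑ n ∈ Finset.Icc 1 K, c n • oscMatrix K n

/-- The matrices which satisfy the recursion of the skew Schur functions with power sums `p`. -/
structure IsSkewMatrix (K : ℕ) (p : ℕ → ℂ)
    (F : Matrix (BoundedDiagram K) (BoundedDiagram K) ℂ) : Prop where
  recursion : degMatrix K * F = F * degMatrix K + creationMatrix K p * F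
  unitriangular : ∀ lam eta : BoundedDiagram K, lam.1.card ≤ eta.1.card →
    F lam eta = if lam = eta then 1 else 0

section

variable {K : ℕ} {p c : ℕ → ℂ} {F G : Matrix (BoundedDiagram K) (BoundedDiagram K) ℂ}

theorem creationMatrix_support {lam eta : BoundedDiagram K}
    (h : creationMatrix K c lam eta ≠ 0) : eta.1.card < lam.1.card := by
  rw [creationMatrix, Matrix.sum_apply] at h
  obtain ⟨n, hn, hne⟩ := Finset.exists_ne_zero_of_sum_ne_zero h
  rw [Finset.mem_Icc] at hn
  have := oscMatrix_support (by omega) (right_ne_zero_of_mul hne)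
  omega

theorem creationMatrix_nilpotent : IsNilpotent (creationMatrix K c) :=
  ⟨K + 1, triangular_pow_eq_zero (deg := fun lam => lam.1.card)
    (fun _ _ => creationMatrix_support) fun lam => lam.2⟩

theorem commute_oscMatrix_creationMatrix {n : ℕ} (hn : 0 < n) :
    Commute (oscMatrix K n) (creationMatrix K c) := by
  refine Commute.sum_right _ _ _ fun m hm => Commute.smul_right (oscMatrix_commute hn ?_) _
  rw [Finset.mem_Icc] at hm; omega

theorem commute_creationMatrix : Commute (creationMatrix K p) (creationMatrix K c) := by
  refine Commute.sum_left _ _ _ fun m hm =>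
    Commute.smul_left (commute_oscMatrix_creationMatrix ?_) _
  rw [Finset.mem_Icc] at hm; omega

theorem degMatrix_mul_creationMatrix :
    degMatrix K * creationMatrix K c =
      creationMatrix K c * degMatrix K + creationMatrix K fun n => n * c n := by
  simp only [creationMatrix, Finset.mul_sum, Finset.sum_mul]
  rw [← Finset.sum_add_distrib]
  refine Finset.sum_congr rfl fun n hn => ?_
  rw [Finset.mem_Icc] at hn
  rw [Matrix.mul_smul, degMatrix_mul_oscMatrix (by omega), smul_add, Matrix.smul_mul, smul_smul,
    mul_comm (n : ℂ)]

theorem isSkewMatrix_exp (p : ℕ → ℂ) :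
    IsSkewMatrix K p (IsNilpotent.exp (creationMatrix K fun n => p n / n)) where
  recursion := by
    rw [mul_nilpotent_exp creationMatrix_nilpotent degMatrix_mul_creationMatrix
      commute_creationMatrix]
    congr 2
    refine Finset.sum_congr rfl fun n hn => ?_
    rw [Finset.mem_Icc] at hn
    have : (n : ℂ) ≠ 0 := by exact_mod_cast (by omega : n ≠ 0)
    simp only [mul_div_cancel₀ _ this]
  unitriangular lam eta h := triangular_exp_apply (deg := fun lam : BoundedDiagram K => lam.1.card)
    (fun _ _ => creationMatrix_support) (fun lam => lam.2) h

theorem IsSkewMatrix.apply (hF : IsSkewMatrix K p F) (lam eta : BoundedDiagram K) :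
    ((lam.1.card : ℂ) - eta.1.card) * F lam eta =
      ∑ n ∈ Finset.Icc 1 K, p n * ∑ κ, oscMatrix K n lam κ * F κ eta := by
  have h := congrFun (congrFun hF.recursion lam) eta
  rw [Matrix.add_apply, degMatrix, Matrix.diagonal_mul, Matrix.mul_diagonal, creationMatrix,
    Finset.sum_mul, Matrix.sum_apply] at h
  rw [sub_mul, h, mul_comm (F lam eta), add_sub_cancel_left]
  refine Finset.sum_congr rfl fun n _ => ?_
  rw [Matrix.smul_mul, Matrix.smul_apply, Matrix.mul_apply, smul_eq_mul]

/-- For |λ| > |η| the recursion divides by |λ| - |η| ≠ 0 and refers to smaller κ only; the other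
entries are prescribed. -/
theorem IsSkewMatrix.unique (hF : IsSkewMatrix K p F) (hG : IsSkewMatrix K p G) : F = G := by
  have key : ∀ d, ∀ lam eta : BoundedDiagram K, lam.1.card = d → F lam eta = G lam eta := by
    intro d
    induction d using Nat.strong_induction_on with
    | _ d ih =>
      intro lam eta hd
      by_cases h : lam.1.card ≤ eta.1.card
      · rw [hF.unitriangular _ _ h, hG.unitriangular _ _ h]
      · have hne : (lam.1.card : ℂ) - eta.1.card ≠ 0 := by
          rw [sub_ne_zero]; exact_mod_cast (by omega : lam.1.card ≠ eta.1.card)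
        refine mul_left_cancel₀ hne ?_
        rw [hF.apply, hG.apply]
        refine Finset.sum_congr rfl fun n hn => ?_
        rw [Finset.mem_Icc] at hn
        congr 1
        refine Finset.sum_congr rfl fun κ _ => ?_
        by_cases h0 : oscMatrix K n lam κ = 0
        · rw [h0, zero_mul, zero_mul]
        · have := oscMatrix_support (by omega) h0
          rw [ih κ.1.card (by omega) κ eta rfl]
  ext lam eta
  exact key _ lam eta rfl

theorem degMatrix_transpose_submatrix :
    (degMatrix K).submatrix (transposeEquiv K) (transposeEquiv K) = degMatrix K := by
  rw [degMatrix, Matrix.submatrix_diagonal_equiv]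
  congr 1
  ext lam
  simp [transposeEquiv, card_transpose]

theorem IsSkewMatrix.transpose (hF : IsSkewMatrix K p F) :
    IsSkewMatrix K (fun n => (-1) ^ (n - 1) * p n)
      (F.submatrix (transposeEquiv K) (transposeEquiv K)) where
  recursion := by
    have h := congrArg (fun X => X.submatrix (transposeEquiv K) (transposeEquiv K)) hF.recursion
    simp only [Matrix.submatrix_add, Pi.add_apply] at h
    rw [← Matrix.submatrix_mul_equiv _ _ _ (transposeEquiv K),
      ← Matrix.submatrix_mul_equiv _ _ _ (transposeEquiv K),
      ← Matrix.submatrix_mul_equiv _ _ _ (transposeEquiv K), degMatrix_transpose_submatrix] at h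
    rw [h]
    congr 2
    ext lam eta
    simp only [creationMatrix, Matrix.submatrix_apply, Matrix.sum_apply, Matrix.smul_apply]
    refine Finset.sum_congr rfl fun n hn => ?_
    rw [Finset.mem_Icc] at hn
    have := congrFun (congrFun (oscMatrix_transpose (K := K) (n := n) (by omega)) lam) eta
    rw [Matrix.submatrix_apply, Matrix.smul_apply] at this
    rw [this]
    simp only [smul_eq_mul]; ring
  unitriangular lam eta h := by
    rw [Matrix.submatrix_apply, hF.unitriangular _ _ (by
      simpa [transposeEquiv, card_transpose] using h)]
    simp only [EmbeddingLike.apply_eq_iff_eq]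

/-- Conjugation by c^degree multiplies a_{-n} by c^n. With uniqueness, this shows what the
exponential becomes when the variables are rescaled. -/
theorem IsSkewMatrix.scale (hF : IsSkewMatrix K p F) {c : ℂ} (hc : c ≠ 0) :
    IsSkewMatrix K (fun n => c ^ n * p n)
      (Matrix.of fun lam eta => c ^ lam.1.card * F lam eta * (c ^ eta.1.card)⁻¹) where
  recursion := by
    ext lam eta
    have h := hF.apply lam eta
    rw [Matrix.add_apply, degMatrix, Matrix.diagonal_mul, Matrix.mul_diagonal, creationMatrix,
      Finset.sum_mul, Matrix.sum_apply]
    have h2 : ∑ n ∈ Finset.Icc 1 K, (((c ^ n * p n) • oscMatrix K n) * Matrix.of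
        fun lam eta : BoundedDiagram K => c ^ lam.1.card * F lam eta * (c ^ eta.1.card)⁻¹) lam eta =
        c ^ lam.1.card * (c ^ eta.1.card)⁻¹ *
          ∑ n ∈ Finset.Icc 1 K, p n * ∑ κ, oscMatrix K n lam κ * F κ eta := by
      rw [Finset.mul_sum]
      refine Finset.sum_congr rfl fun n hn => ?_
      rw [Finset.mem_Icc] at hn
      rw [Matrix.smul_mul, Matrix.smul_apply, Matrix.mul_apply, smul_eq_mul, Finset.mul_sum,
        Finset.mul_sum, Finset.mul_sum]
      refine Finset.sum_congr rfl fun κ _ => ?_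
      by_cases h0 : oscMatrix K n lam κ = 0
      · rw [h0]; ring
      · rw [← oscMatrix_support (by omega) h0, Matrix.of_apply, pow_add]; ring
    rw [h2, ← h, Matrix.of_apply]
    ring
  unitriangular lam eta h := by
    rw [Matrix.of_apply, hF.unitriangular _ _ h]
    split_ifs with h0
    · rw [h0]
      have : c ^ eta.1.card ≠ 0 := pow_ne_zero _ hc
      field_simp
    · ring

end

end FreeFermion
end

noncomputable section
namespace FreeFermion
open Maya

/-! ### Jacobi–Trudi determinants -/

/-- The sequences `h` which are related to the power sums `p` by Newton's identities. -/
structure IsComplete (p : ℕ → ℂ) (h : ℤ → ℂ) : Prop where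
  neg : ∀ m, m < 0 → h m = 0
  zero : h 0 = 1
  newton : ∀ m : ℕ, (m : ℂ) * h m = ∑ n ∈ Finset.Icc 1 m, p n * h (m - n)

theorem IsComplete.newton_of_le {p : ℕ → ℂ} {h : ℤ → ℂ} (hh : IsComplete p h) {m : ℤ} {L : ℕ}
    (hm : m ≤ L) : (m : ℂ) * h m = ∑ n ∈ Finset.Icc 1 L, p n * h (m - n) := by
  rcases lt_or_ge m 0 with h0 | h0
  · rw [hh.neg m h0, mul_zero, Finset.sum_eq_zero]
    intro n _
    rw [hh.neg _ (by omega), mul_zero]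
  · lift m to ℕ using h0
    rw [Int.cast_natCast, hh.newton]
    refine Finset.sum_subset (Finset.Icc_subset_Icc_right (by exact_mod_cast hm)) ?_
    intro n hn hn'
    simp only [Finset.mem_Icc] at hn hn'
    rw [hh.neg _ (by omega), mul_zero]

/-- The determinant `det (h (u_i - v_j))`. -/
def detWindow {M : ℕ} (h : ℤ → ℂ) (v u : Fin M → ℤ) : ℂ :=
  Matrix.det (Matrix.of fun i j => h (u i - v j))

section

variable {M : ℕ} {h : ℤ → ℂ} {v u : Fin M → ℤ} {p : ℕ → ℂ}

/-- In the Leibniz expansion the term of σ acquires the factor Σ_i (a_i - b_{σ⁻¹ i}), which is the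
same for every σ. -/
theorem sum_det_updateRow_weight (A : Matrix (Fin M) (Fin M) ℂ) (a b : Fin M → ℂ) :
    ∑ i, (A.updateRow i fun j => (a i - b j) * A i j).det = (∑ i, a i - ∑ j, b j) * A.det := by
  simp only [Matrix.det_apply]
  rw [Finset.sum_comm, Finset.mul_sum]
  refine Finset.sum_congr rfl fun σ _ => ?_
  rw [← Finset.smul_sum, mul_smul_comm]
  congr 1
  have hterm : ∀ i, ∏ k, (A.updateRow i fun j => (a i - b j) * A i j) (σ k) k =
      (a i - b (σ.symm i)) * ∏ k, A (σ k) k := by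
    intro i
    rw [← Finset.mul_prod_erase _ _ (Finset.mem_univ (σ.symm i)),
      ← Finset.mul_prod_erase (Finset.univ) (fun k => A (σ k) k) (Finset.mem_univ (σ.symm i)),
      Equiv.apply_symm_apply, Matrix.updateRow_self, mul_assoc]
    congr 2
    refine Finset.prod_congr rfl fun k hk => ?_
    rw [Matrix.updateRow_ne]
    intro hc
    exact (Finset.mem_erase.1 hk).1 (by rw [← hc, Equiv.symm_apply_apply])
  rw [Finset.sum_congr rfl fun i _ => hterm i, ← Finset.sum_mul, Finset.sum_sub_distrib,
    Equiv.sum_comp σ.symm b]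

/-- Newton's identity expands (u_i - v_j) h(u_i - v_j) into p_n h(u_i - n - v_j), so weighting a row
amounts to lowering u_i by n. This is the shift rule of `windowCoeff_aMode`. -/
theorem detWindow_recursion (hh : IsComplete p h) {L : ℕ} (hL : ∀ i j, u i - v j ≤ L) :
    ((∑ i, u i - ∑ j, v j : ℤ) : ℂ) * detWindow h v u =
      ∑ n ∈ Finset.Icc 1 L, p n * ∑ i, detWindow h v (u + Pi.single i (-(n : ℤ))) := by
  have h1 := sum_det_updateRow_weight (Matrix.of fun i j => h (u i - v j))
    (fun i => (u i : ℂ)) (fun j => (v j : ℂ))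
  push_cast
  rw [detWindow, ← h1]
  simp only [Finset.mul_sum]
  rw [Finset.sum_comm]
  refine Finset.sum_congr rfl fun i _ => ?_
  have h2 : (fun j => ((u i : ℂ) - v j) * (Matrix.of fun i j => h (u i - v j)) i j) =
      ∑ n ∈ Finset.Icc 1 L, p n • fun j => h (u i - v j - n) := by
    ext j
    have := hh.newton_of_le (hL i j)
    push_cast at this
    rw [Matrix.of_apply, this, Finset.sum_apply]
    rfl
  have h3 : ∀ (s : Finset ℕ) (f : ℕ → Fin M → ℂ),
      (Matrix.updateRow (Matrix.of fun i j => h (u i - v j)) i (∑ n ∈ s, f n)).det =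
        ∑ n ∈ s, (Matrix.updateRow (Matrix.of fun i j => h (u i - v j)) i (f n)).det := by
    intro s f
    classical
    induction s using Finset.induction_on with
    | empty =>
      rw [Finset.sum_empty, Finset.sum_empty]
      exact Matrix.det_eq_zero_of_row_eq_zero i (by simp)
    | insert n s hn ih => rw [Finset.sum_insert hn, Finset.sum_insert hn, Matrix.det_updateRow_add, ih]
  rw [h2, h3]
  refine Finset.sum_congr rfl fun n _ => ?_
  rw [Matrix.det_updateRow_smul, detWindow]
  congr 2
  ext k j
  by_cases hk : k = i
  · subst hk
    rw [Matrix.updateRow_self, Matrix.of_apply, Pi.add_apply, Pi.single_eq_same]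
    congr 1; ring
  · rw [Matrix.updateRow_ne hk, Matrix.of_apply, Matrix.of_apply, Pi.add_apply,
      Pi.single_eq_of_ne hk, add_zero]

theorem detWindow_perm (σ : Equiv.Perm (Fin M)) :
    detWindow h v (u ∘ σ) = ((Equiv.Perm.sign σ : ℤ) : ℂ) * detWindow h v u :=
  Matrix.det_permute σ (Matrix.of fun i j => h (u i - v j))

theorem detWindow_of_not_injective (hu : ¬Function.Injective u) : detWindow h v u = 0 := by
  simp only [Function.Injective, not_forall] at hu
  obtain ⟨i, j, hij, hne⟩ := hu
  exact Matrix.det_zero_of_row_eq hne (by ext k; simp [hij])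

theorem detWindow_of_lt (hh : IsComplete p h) {i : Fin M} (hi : ∀ j, u i < v j) :
    detWindow h v u = 0 :=
  Matrix.det_eq_zero_of_row_eq_zero i fun j => hh.neg _ (by have := hi j; omega)

theorem detWindow_self (hh : IsComplete p h) (hu : StrictMono u) : detWindow h u u = 1 := by
  rw [detWindow, Matrix.det_of_isLowerTriangular]
  · simp [hh.zero]
  · intro i j hij
    have h1 : i < j := hij
    exact hh.neg _ (by have := hu h1; omega)

/-- A non-zero Leibniz term needs v_i ≤ u_{σ i} for every i; the inequality of the sums then forces
equality, and sortedness gives u = v. -/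
theorem detWindow_of_ne (hh : IsComplete p h) (hu : StrictMono u) (hv : StrictMono v)
    (hsum : ∑ i, u i ≤ ∑ i, v i) (hne : u ≠ v) : detWindow h v u = 0 := by
  rw [detWindow, Matrix.det_apply]
  refine Finset.sum_eq_zero fun σ _ => ?_
  suffices hz : ∏ i, (Matrix.of fun i j => h (u i - v j)) (σ i) i = 0 by rw [hz, smul_zero]
  by_contra hprod
  rw [← ne_eq, Finset.prod_ne_zero_iff] at hprod
  have hle : ∀ i, v i ≤ u (σ i) := by
    intro i
    by_contra hc
    exact hprod i (Finset.mem_univ i) (hh.neg _ (by omega))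
  have hs : ∑ i, u (σ i) = ∑ i, u i := Equiv.sum_comp σ u
  have heq : ∀ i, v i = u (σ i) := by
    have h1 : ∑ i, v i = ∑ i, u (σ i) :=
      le_antisymm (Finset.sum_le_sum fun i _ => hle i) (by rw [hs]; exact hsum)
    intro i
    exact (Finset.sum_eq_sum_iff_of_le fun i _ => hle i).1 h1 i (Finset.mem_univ i)
  apply hne
  refine (StrictMono.range_inj hu hv).1 ?_
  rw [show v = u ∘ σ from funext heq, Set.range_comp, σ.surjective.range_eq, Set.image_univ]

end

/-- Shifts leave the sorted sequences, so the recursion is run on all sequences; an alternating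
function is determined by the sorted ones. -/
theorem eq_of_eq_on_strictMono {M : ℕ} {f g : (Fin M → ℤ) → ℂ}
    (hf : ∀ u (σ : Equiv.Perm (Fin M)), f (u ∘ σ) = ((Equiv.Perm.sign σ : ℤ) : ℂ) * f u)
    (hg : ∀ u (σ : Equiv.Perm (Fin M)), g (u ∘ σ) = ((Equiv.Perm.sign σ : ℤ) : ℂ) * g u)
    (hf0 : ∀ u, ¬Function.Injective u → f u = 0) (hg0 : ∀ u, ¬Function.Injective u → g u = 0)
    (u : Fin M → ℤ) (h : ∀ σ : Equiv.Perm (Fin M), StrictMono (u ∘ σ) → f (u ∘ σ) = g (u ∘ σ)) :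
    f u = g u := by
  by_cases hu : Function.Injective u
  · have h1 := h (Tuple.sort u)
      ((Tuple.monotone_sort u).strictMono_of_injective (hu.comp (Tuple.sort u).injective))
    rw [hf, hg] at h1
    refine mul_left_cancel₀ ?_ h1
    rcases Int.units_eq_one_or (Equiv.Perm.sign (Tuple.sort u)) with h | h <;> simp [h]
  · rw [hf0 u hu, hg0 u hu]

theorem sum_particle_rev {lam : YoungDiagram} {M : ℕ} (hM : lam.colLen 0 ≤ M) :
    ∑ i : Fin M, particle lam i.rev = lam.card + ∑ i ∈ Finset.range M, (-(i : ℤ) - 1) := by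
  refine (Equiv.sum_comp Fin.revPerm (fun i : Fin M => particle lam i)).trans ?_
  rw [Fin.sum_univ_eq_sum_range (particle lam), card_eq_sum_rowLen lam hM]
  push_cast
  rw [← Finset.sum_add_distrib]
  refine Finset.sum_congr rfl fun i _ => ?_
  unfold particle; ring

/-- The Jacobi–Trudi formula. -/
theorem IsSkewMatrix.eq_det {K : ℕ} {p : ℕ → ℂ} {h : ℤ → ℂ}
    {F : Matrix (BoundedDiagram K) (BoundedDiagram K) ℂ} (hF : IsSkewMatrix K p F)
    (hh : IsComplete p h) (lam eta : BoundedDiagram K) {M : ℕ} (hlam : lam.1.colLen 0 ≤ M)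
    (heta : eta.1.colLen 0 ≤ M) :
    F lam eta = Matrix.det (Matrix.of fun i j : Fin M =>
      h (particle lam.1 i - particle eta.1 j)) := by
  let v : Fin M → ℤ := fun j => particle eta.1 j.rev
  have hv : StrictMono v := particle_rev_strictMono eta.1 M
  have hvge : ∀ j, -(M : ℤ) ≤ v j := by
    intro j; have := j.rev.2; simp only [v]; unfold particle; omega
  -- The column eta of F as a vector, so that window coefficients extend its entries to arbitrary
  -- sequences.
  let w : Maya → ℂ := fun S => ∑ κ : BoundedDiagram K, F κ eta * basisVec (mayaOf κ.1) S
  have hw : ∀ κ : BoundedDiagram K, w (mayaOf κ.1) = F κ eta := by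
    intro κ
    simp only [w]
    rw [Finset.sum_eq_single κ]
    · rw [basisVec_self, mul_one]
    · intro κ' _ hne
      rw [basisVec_of_ne fun h' => hne (Subtype.ext (mayaOf_injective h')).symm, mul_zero]
    · intro h'; exact absurd (Finset.mem_univ _) h'
  -- The quantity bounded by d is the size of the diagram with positions u, if there is one; the
  -- recursion lowers it by n. The bound K + 1 keeps these diagrams inside the truncation.
  have key : ∀ d : ℕ, ∀ u : Fin M → ℤ,
      ∑ i, u i - ∑ j, v j + eta.1.card < d → d ≤ K + 1 → windowCoeff w u = detWindow h v u := by
    intro d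
    induction d with
    | zero =>
      intro u hu _
      refine eq_of_eq_on_strictMono (windowCoeff_perm w) (fun u => detWindow_perm)
        (fun u => windowCoeff_of_not_injective w) (fun u => detWindow_of_not_injective) u
        fun σ hσ => ?_
      by_cases hge : ∀ i, -(M : ℤ) ≤ (u ∘ σ) i
      · obtain ⟨mu, hmu, he⟩ := exists_particle_eq hσ hge
        have h1 := sum_particle_rev hmu
        have h2 := sum_particle_rev heta
        rw [Finset.sum_congr rfl fun i _ => he i,
          show Finset.univ.sum (u ∘ σ) = ∑ i, u i from Equiv.sum_comp σ u] at h1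
        simp only [v] at hu
        omega
      · simp only [not_forall, not_le] at hge
        obtain ⟨i, hi⟩ := hge
        rw [windowCoeff_eq_zero_of_lt hi, detWindow_of_lt hh fun j => hi.trans_le (hvge j)]
    | succ d ih =>
      intro u hu hd
      refine eq_of_eq_on_strictMono (windowCoeff_perm w) (fun u => detWindow_perm)
        (fun u => windowCoeff_of_not_injective w) (fun u => detWindow_of_not_injective) u
        fun σ hσ => ?_
      by_cases hge : ∀ i, -(M : ℤ) ≤ (u ∘ σ) i
      swap
      · simp only [not_forall, not_le] at hge
        obtain ⟨i, hi⟩ := hge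
        rw [windowCoeff_eq_zero_of_lt hi, detWindow_of_lt hh fun j => hi.trans_le (hvge j)]
      obtain ⟨mu, hmu, he⟩ := exists_particle_eq hσ hge
      have hu' : u ∘ σ = fun i : Fin M => particle mu i.rev := (funext he).symm
      have h1 := sum_particle_rev hmu
      have h2 := sum_particle_rev heta
      have h3 : ∑ i, u i = ∑ i : Fin M, particle mu i.rev := by
        rw [← Equiv.sum_comp σ u]; exact Finset.sum_congr rfl fun i _ => (he i).symm
      have hcard : mu.card ≤ d := by
        have : (mu.card : ℤ) < (d + 1 : ℕ) := by
          refine lt_of_eq_of_lt ?_ hu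
          rw [h3, h1]; simp only [v]; rw [h2]; ring
        omega
      have hdiff : (∑ i, (u ∘ σ) i - ∑ j, v j : ℤ) = mu.card - eta.1.card := by
        rw [hu', h1]; simp only [v]; rw [h2]; ring
      let mu' : BoundedDiagram K := ⟨mu, by omega⟩
      have hW : windowCoeff w (u ∘ σ) = F mu' eta := by
        rw [hu', windowCoeff_particle hmu]; exact hw mu'
      by_cases hle : mu.card ≤ eta.1.card
      · rw [hW, hF.unitriangular _ _ hle]
        split_ifs with heq
        · have : u ∘ σ = v := by
            rw [hu']; simp only [v]; rw [← heq]
          rw [this, detWindow_self hh hv]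
        · rw [detWindow_of_ne hh hσ hv (by omega)]
          intro hc
          apply heq
          refine Subtype.ext (mayaOf_injective ?_)
          have h4 : ∀ S : Maya → ℂ, S (mayaOf mu) = S (mayaOf eta.1) := by
            intro S
            rw [← windowCoeff_particle hmu S, ← hu', hc]
            exact windowCoeff_particle heta S
          have h5 := h4 (basisVec (mayaOf eta.1))
          rw [basisVec_self] at h5
          by_contra hc'
          rw [basisVec_of_ne hc'] at h5
          exact zero_ne_one h5
      · have hne : (mu.card : ℂ) - eta.1.card ≠ 0 := by
          rw [sub_ne_zero]; exact_mod_cast (by omega : mu.card ≠ eta.1.card)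
        refine mul_left_cancel₀ hne ?_
        -- The determinant recursion runs up to a bound for all u_i - v_j, the matrix recursion only
        -- up to K; the surplus terms vanish by degree.
        obtain ⟨L, hKL, hL⟩ : ∃ L : ℕ, K ≤ L ∧ ∀ i j, (u ∘ σ) i - v j ≤ L := by
          obtain ⟨B, hB⟩ := (Set.finite_range fun c : Fin M × Fin M =>
            (u ∘ σ) c.1 - v c.2).bddAbove
          refine ⟨max K B.toNat, le_max_left _ _, fun i j => ?_⟩
          have := hB ⟨(i, j), rfl⟩
          simp only at this
          have h6 := le_max_right K B.toNat
          omega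
        have hdet := detWindow_recursion hh hL
        rw [hdiff] at hdet
        push_cast at hdet
        rw [hdet, hW]
        have h7 := hF.apply mu' eta
        refine h7.trans ?_
        rw [Finset.sum_subset (Finset.Icc_subset_Icc_right hKL)]
        · refine Finset.sum_congr rfl fun n hn => ?_
          rw [Finset.mem_Icc] at hn
          congr 1
          have h8 := aMode_neg_apply (K := K) (n := n) (by omega) w mu'
          simp only [hw] at h8
          rw [← h8, ← windowCoeff_particle hmu (aMode _ w), windowCoeff_aMode (by omega), ← hu']
          refine Finset.sum_congr rfl fun i _ => ih _ ?_ (by omega)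
          simp only [Pi.add_apply, Finset.sum_add_distrib, Finset.sum_pi_single', Finset.mem_univ,
            if_true]
          have h9 : ∑ i, (u ∘ σ) i = ∑ i, u i := Equiv.sum_comp σ u
          simp only [Function.comp_apply] at h9 ⊢
          push_cast at hu
          omega
        · intro n hn hn'
          simp only [Finset.mem_Icc] at hn hn'
          rw [Finset.sum_eq_zero, mul_zero]
          intro κ _
          by_contra hc
          have := oscMatrix_support (by omega) (left_ne_zero_of_mul hc)
          have := mu'.2
          omega
  have hfin := key (lam.1.card + 1) (fun i => particle lam.1 i.rev) (by
    have h1 := sum_particle_rev hlam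
    have h2 := sum_particle_rev heta
    simp only [v]
    push_cast
    omega) (by have := lam.2; omega)
  rw [windowCoeff_particle hlam, hw] at hfin
  rw [hfin, detWindow, ← Matrix.det_submatrix_equiv_self Fin.revPerm]
  congr 1
  ext i j
  simp only [Matrix.submatrix_apply, Matrix.of_apply, Fin.revPerm_apply, v, Fin.rev_rev]

end FreeFermion
end

noncomputable section
namespace FreeFermion
open Maya

/-! ### Symmetric functions of summable sequences -/

section

variable {x : ℕ → ℂ}

/-- The monomial of a multiset of indices. -/
def symMonomial (x : ℕ → ℂ) {m : ℕ} (s : Sym ℕ m) : ℂ := ((s : Multiset ℕ).map x).prod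

theorem hsym_natCast (x : ℕ → ℂ) (m : ℕ) : hsym x m = ∑' s : Sym ℕ m, symMonomial x s := rfl

theorem summable_symMonomial (hx : Summable fun i => ‖x i‖) (m : ℕ) :
    Summable fun s : Sym ℕ m => ‖symMonomial x s‖ := by
  induction m with
  | zero => exact (hasSum_fintype _).summable
  | succ m ih =>
    let cons : ℕ × Sym ℕ m → Sym ℕ (m + 1) := fun c => c.1 ::ₛ c.2
    have hsurj : Function.Surjective cons := by
      intro s
      obtain ⟨a, s', rfl⟩ := s.exists_eq_cons_of_succ
      exact ⟨(a, s'), rfl⟩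
    have h1 : Summable fun c : ℕ × Sym ℕ m => ‖x c.1‖ * ‖symMonomial x c.2‖ :=
      hx.mul_of_nonneg ih (fun _ => norm_nonneg _) fun _ => norm_nonneg _
    refine (h1.comp_injective (Function.injective_surjInv hsurj)).congr fun s => ?_
    have h2 : cons (Function.surjInv hsurj s) = s := Function.surjInv_eq hsurj s
    conv_rhs => rw [← h2]
    simp only [cons, symMonomial, Function.comp_apply, Sym.coe_cons, Multiset.map_cons,
      Multiset.prod_cons, norm_mul]

theorem summable_pow_norm (hx : Summable fun i => ‖x i‖) {n : ℕ} (hn : 0 < n) :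
    Summable fun i => ‖x i ^ n‖ := by
  refine Summable.of_norm_bounded_eventually_nat hx ?_
  filter_upwards [hx.tendsto_atTop_zero.eventually (gt_mem_nhds zero_lt_one)] with i hi
  rw [norm_norm, norm_pow]
  exact pow_le_of_le_one (norm_nonneg _) hi.le hn.ne'

theorem hasSum_mul_prod {α β : Type} {f : α → ℂ} {g : β → ℂ} {a b : ℂ} (hf : HasSum f a)
    (hg : HasSum g b) (hf' : Summable fun i => ‖f i‖) (hg' : Summable fun i => ‖g i‖) :
    HasSum (fun c : α × β => f c.1 * g c.2) (a * b) :=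
  hf.mul hg (summable_mul_of_summable_norm hf' hg')

/-- Adding `n` copies of an index to a multiset of indices. -/
def addCopies (k n : ℕ) (c : Sym ℕ k × ℕ) : Sym ℕ (k + n) × ℕ :=
  (c.1.append (Sym.replicate n c.2), c.2)

theorem coe_addCopies (k n : ℕ) (c : Sym ℕ k × ℕ) :
    ((addCopies k n c).1 : Multiset ℕ) = (c.1 : Multiset ℕ) + Multiset.replicate n c.2 := by
  rw [addCopies, Sym.coe_append, Sym.coe_replicate]

theorem addCopies_injective (k n : ℕ) : Function.Injective (addCopies k n) := by
  rintro ⟨s, i⟩ ⟨s', i'⟩ h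
  have h2 : i = i' := (Prod.ext_iff.1 h).2
  subst h2
  have h3 := congrArg (fun t : Sym ℕ (k + n) × ℕ => (t.1 : Multiset ℕ)) h
  simp only [coe_addCopies] at h3
  exact Prod.ext (Sym.coe_injective (add_right_cancel h3)) rfl

theorem mem_range_addCopies {k n : ℕ} {c : Sym ℕ (k + n) × ℕ}
    (h : n ≤ (c.1 : Multiset ℕ).count c.2) : c ∈ Set.range (addCopies k n) := by
  obtain ⟨s, i⟩ := c
  have hle : Multiset.replicate n i ≤ (s : Multiset ℕ) := Multiset.le_count_iff_replicate_le.1 h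
  have hcard : Multiset.card ((s : Multiset ℕ) - Multiset.replicate n i) = k := by
    rw [Multiset.card_sub hle, Multiset.card_replicate, Sym.card_coe, Nat.add_sub_cancel]
  refine ⟨(Sym.mk _ hcard, i), Prod.ext (Sym.coe_injective ?_) rfl⟩
  rw [coe_addCopies]
  exact Multiset.sub_add_cancel hle

theorem symMonomial_addCopies (x : ℕ → ℂ) (k n : ℕ) (c : Sym ℕ k × ℕ) :
    symMonomial x (addCopies k n c).1 = symMonomial x c.1 * x c.2 ^ n := by
  rw [symMonomial, coe_addCopies, Multiset.map_add, Multiset.prod_add, Multiset.map_replicate,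
    Multiset.prod_replicate]
  rfl

/-- A pair of a multiset of size k and an index i becomes, after adding n copies of i, a multiset of
size k + n with an index of multiplicity at least n, and this is reversible. -/
theorem hasSum_symMonomial_count (hx : Summable fun i => ‖x i‖) {n : ℕ} (hn : 0 < n) (k : ℕ) :
    HasSum (fun c : Sym ℕ (k + n) × ℕ =>
      if n ≤ (c.1 : Multiset ℕ).count c.2 then symMonomial x c.1 else 0)
      (powerSum n x * hsym x k) := by
  have e1 : HasSum (fun s : Sym ℕ k => symMonomial x s) (hsym x k) := by
    rw [hsym_natCast]
    exact (summable_symMonomial hx k).of_norm.hasSum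
  have e2 : HasSum (fun i => x i ^ n) (powerSum n x) := (summable_pow_norm hx hn).of_norm.hasSum
  generalize hsym x k = H at *
  generalize powerSum n x = P at *
  have h1 := hasSum_mul_prod e1 e2 (summable_symMonomial hx k) (summable_pow_norm hx hn)
  rw [mul_comm]
  have h2 : ∀ c, (fun c : Sym ℕ (k + n) × ℕ =>
      if n ≤ (c.1 : Multiset ℕ).count c.2 then symMonomial x c.1 else 0) (addCopies k n c) =
      symMonomial x c.1 * x c.2 ^ n := by
    intro c
    have hc : n ≤ ((addCopies k n c).1 : Multiset ℕ).count (addCopies k n c).2 := by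
      rw [coe_addCopies, addCopies, Multiset.count_add, Multiset.count_replicate_self]
      exact Nat.le_add_left n _
    dsimp only
    rw [if_pos hc, symMonomial_addCopies]
  have h3 := (addCopies_injective k n).hasSum_iff (f := fun c : Sym ℕ (k + n) × ℕ =>
    if n ≤ (c.1 : Multiset ℕ).count c.2 then symMonomial x c.1 else 0)
    (a := H * P) (fun c hc => if_neg fun h => hc (mem_range_addCopies h))
  exact h3.1 (h1.congr_fun h2)

/-- Summing over n ≤ m, an index of multiplicity c in a multiset is counted c times, and the
multiplicities add up to m. Absolute convergence permits the interchange of sums. -/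
theorem isComplete_hsym (hx : Summable fun i => ‖x i‖) :
    IsComplete (fun n => powerSum n x) (hsym x) where
  neg m hm := by
    obtain ⟨n, rfl⟩ := Int.eq_negSucc_of_lt_zero hm
    rfl
  zero := by
    have h := hsym_natCast x 0
    rw [Nat.cast_zero] at h
    rw [h, tsum_eq_single Sym.nil]
    · simp [symMonomial]
    · intro s hs; exact absurd (Subsingleton.elim _ _) hs
  newton m := by
    have h1 : ∀ n ∈ Finset.Icc 1 m, HasSum (fun c : Sym ℕ m × ℕ =>
        if n ≤ (c.1 : Multiset ℕ).count c.2 then symMonomial x c.1 else 0)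
        (powerSum n x * hsym x (m - n)) := by
      intro n hn
      rw [Finset.mem_Icc] at hn
      obtain ⟨k, rfl⟩ : ∃ k, m = k + n := ⟨m - n, by omega⟩
      rw [show ((k + n : ℕ) : ℤ) - n = (k : ℕ) by push_cast; ring]
      exact hasSum_symMonomial_count hx (by omega) k
    have h2 := hasSum_sum h1
    have h3 : ∀ s : Sym ℕ m, HasSum (fun i => ∑ n ∈ Finset.Icc 1 m,
        if n ≤ (s : Multiset ℕ).count i then symMonomial x s else 0) (m * symMonomial x s) := by
      intro s
      have hcard : Multiset.card (s : Multiset ℕ) = m := s.2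
      have h4 : ∀ i, (∑ n ∈ Finset.Icc 1 m,
          if n ≤ (s : Multiset ℕ).count i then symMonomial x s else 0) =
          (s : Multiset ℕ).count i * symMonomial x s := by
        intro i
        have hle := Multiset.count_le_card i (s : Multiset ℕ)
        rw [← Finset.sum_filter, Finset.sum_const, nsmul_eq_mul]
        congr 2
        rw [show (Finset.Icc 1 m).filter (· ≤ (s : Multiset ℕ).count i) =
          Finset.Icc 1 ((s : Multiset ℕ).count i) by ext n; simp; omega]
        simp
      simp only [h4]
      have h5 : (m : ℂ) * symMonomial x s =
          ∑ i ∈ (s : Multiset ℕ).toFinset, (s : Multiset ℕ).count i * symMonomial x s := by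
        rw [← Finset.sum_mul, ← Nat.cast_sum, Multiset.toFinset_sum_count_eq, hcard]
      rw [h5]
      refine hasSum_sum_of_ne_finset_zero fun i hi => ?_
      rw [Multiset.mem_toFinset] at hi
      rw [Multiset.count_eq_zero_of_notMem hi, Nat.cast_zero, zero_mul]
    have h6 := h2.prod_fiberwise h3
    rw [hsym_natCast]
    exact ((summable_symMonomial hx m).of_norm.hasSum.mul_left (m : ℂ)).unique h6

theorem skewSchur_eq (lam eta : YoungDiagram) (x : ℕ → ℂ) :
    skewSchur lam eta x = Matrix.det (Matrix.of fun i j : Fin (max (lam.colLen 0) (eta.colLen 0)) =>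
      hsym x (particle lam i - particle eta j)) := by
  unfold skewSchur
  congr 2
  ext i j
  congr 1
  unfold particle; ring

theorem IsSkewMatrix.eq_skewSchur {K : ℕ} {F : Matrix (BoundedDiagram K) (BoundedDiagram K) ℂ}
    (hx : Summable fun i => ‖x i‖) (hF : IsSkewMatrix K (fun n => powerSum n x) F)
    (lam eta : BoundedDiagram K) : F lam eta = skewSchur lam.1 eta.1 x := by
  rw [skewSchur_eq]
  exact hF.eq_det (isComplete_hsym hx) lam eta (le_max_left _ _) (le_max_right _ _)

/-- The matrix of `exp (∑_{n>0} c_n a_{-n})`. -/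
def vertexMatrix (K : ℕ) (c : ℕ → ℂ) : Matrix (BoundedDiagram K) (BoundedDiagram K) ℂ :=
  IsNilpotent.exp (creationMatrix K c)

theorem vertexMatrix_apply (hx : Summable fun i => ‖x i‖) {c : ℂ} (hc : c ≠ 0) {K : ℕ}
    (lam eta : BoundedDiagram K) :
    vertexMatrix K (fun n => c ^ n * powerSum n x / n) lam eta =
      c ^ lam.1.card * skewSchur lam.1 eta.1 x * (c ^ eta.1.card)⁻¹ := by
  have h1 := (isSkewMatrix_exp (K := K) fun n => powerSum n x)
  have h2 := isSkewMatrix_exp (K := K) fun n => c ^ n * powerSum n x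
  rw [vertexMatrix, h2.unique (h1.scale hc), Matrix.of_apply, h1.eq_skewSchur hx]

/-- The sign (-1)^{n-1} is the involution ω, so both diagrams are transposed. -/
theorem vertexMatrix_apply_transpose (hx : Summable fun i => ‖x i‖) {c : ℂ} (hc : c ≠ 0) {K : ℕ}
    (lam eta : BoundedDiagram K) :
    vertexMatrix K (fun n => (-1) ^ (n - 1) * (c ^ n * powerSum n x) / n) lam eta =
      c ^ lam.1.card * skewSchur lam.1.transpose eta.1.transpose x * (c ^ eta.1.card)⁻¹ := by
  have h1 := (isSkewMatrix_exp (K := K) fun n => powerSum n x)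
  have h2 := isSkewMatrix_exp (K := K) fun n => (-1) ^ (n - 1) * (c ^ n * powerSum n x)
  rw [vertexMatrix, h2.unique (h1.scale hc).transpose, Matrix.submatrix_apply, Matrix.of_apply,
    h1.eq_skewSchur hx]
  simp [transposeEquiv, card_transpose]

theorem skewSchur_eq_zero (hx : Summable fun i => ‖x i‖) {lam eta : YoungDiagram}
    (h : lam.card < eta.card) : skewSchur lam eta x = 0 := by
  have h1 := isSkewMatrix_exp (K := eta.card) fun n => powerSum n x
  rw [← h1.eq_skewSchur hx ⟨lam, h.le⟩ ⟨eta, le_rfl⟩, h1.unitriangular _ _ h.le, if_neg]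
  intro hc
  rw [Subtype.mk.injEq] at hc
  exact h.ne (congrArg YoungDiagram.card hc)

end

theorem summable_spec {ℓ : ℂ} (hℓ : ‖Complex.exp ℓ‖ < 1) (lam : YoungDiagram) (c : ℂ) :
    Summable fun i => ‖spec ℓ lam c i‖ := by
  rw [← summable_nat_add_iff (lam.colLen 0)]
  have h1 := (summable_geometric_of_lt_one (norm_nonneg _) hℓ).mul_left
    ‖qPow ℓ (lam.colLen 0 + 1 / 2 + c)‖
  refine h1.congr fun i => ?_
  rw [← norm_pow, ← norm_mul, spec, rowLen_eq_zero (Nat.le_add_left _ _)]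
  congr 1
  rw [show Complex.exp ℓ ^ i = qPow ℓ i by rw [qPow, ← Complex.exp_nat_mul], ← qPow_add]
  congr 1
  push_cast; ring

end FreeFermion
end

noncomputable section
namespace FreeFermion
open Maya

/-! ### The exponential of the bilinear operator -/

/-- The space of pairs of bounded diagrams, as matrices. -/
abbrev DiagramMatrix (K : ℕ) : Type := Matrix (BoundedDiagram K) (BoundedDiagram K) ℂ

/-- The operator `∑_{n>0} (α_n a_n^(2) + (1/n) a_{-n}^(1) a_n^(2) + β_n a_{-n}^(1))`, acting on the
first factor through the rows and on the second through the columns. -/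
def pairEnd (K : ℕ) (α β : ℕ → ℂ) : Module.End ℂ (DiagramMatrix K) :=
  ∑ n ∈ Finset.Icc 1 K, (α n • LinearMap.mulRight ℂ (oscMatrix K n) +
    (n : ℂ)⁻¹ • (LinearMap.mulLeft ℂ (oscMatrix K n) * LinearMap.mulRight ℂ (oscMatrix K n)) +
    β n • LinearMap.mulLeft ℂ (oscMatrix K n))

section

variable {K : ℕ} {α β : ℕ → ℂ}

theorem pairEnd_apply (X : DiagramMatrix K) :
    pairEnd K α β X = ∑ n ∈ Finset.Icc 1 K, (α n • (X * oscMatrix K n) +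
      (n : ℂ)⁻¹ • (oscMatrix K n * (X * oscMatrix K n)) + β n • (oscMatrix K n * X)) := by
  simp [pairEnd, LinearMap.sum_apply]

/-- Every term raises the row diagram, lowers the column diagram, or does both, so |λ| + (K - |η|)
grows; it never exceeds 2K. -/
theorem pairEnd_pow_eq_zero : pairEnd K α β ^ (2 * K + 1) = 0 := by
  have hstep : ∀ (k : ℕ) (X : DiagramMatrix K),
      (∀ lam eta, lam.1.card + (K - eta.1.card) < k → X lam eta = 0) →
      ∀ lam eta, lam.1.card + (K - eta.1.card) < k + 1 → pairEnd K α β X lam eta = 0 := by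
    intro k X hX lam eta hlt
    have hR : ∀ n, 0 < n → ∀ lam eta : BoundedDiagram K, lam.1.card + (K - eta.1.card) < k + 1 →
        (X * oscMatrix K n) lam eta = 0 := by
      intro n hn lam eta hlt
      rw [Matrix.mul_apply]
      refine Finset.sum_eq_zero fun κ _ => ?_
      by_contra hc
      have h1 := oscMatrix_support hn (right_ne_zero_of_mul hc)
      have h2 := κ.2
      have h3 := eta.2
      exact left_ne_zero_of_mul hc (hX _ _ (by omega))
    have hL : ∀ n, 0 < n → ∀ Y : DiagramMatrix K,
        (∀ κ : BoundedDiagram K, κ.1.card < lam.1.card → Y κ eta = 0) →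
        (oscMatrix K n * Y) lam eta = 0 := by
      intro n hn Y hY
      rw [Matrix.mul_apply]
      refine Finset.sum_eq_zero fun κ _ => ?_
      by_contra hc
      have h1 := oscMatrix_support hn (left_ne_zero_of_mul hc)
      exact right_ne_zero_of_mul hc (hY κ (by omega))
    rw [pairEnd_apply, Matrix.sum_apply]
    refine Finset.sum_eq_zero fun n hn => ?_
    rw [Finset.mem_Icc] at hn
    have hn0 : 0 < n := by omega
    simp only [Matrix.add_apply, Matrix.smul_apply]
    rw [hR n hn0 _ _ hlt, hL n hn0 _ fun κ hκ => hR n hn0 κ eta (by omega),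
      hL n hn0 X fun κ hκ => hX κ eta (by omega)]
    simp
  have hpow : ∀ (k : ℕ) (X : DiagramMatrix K) (lam eta : BoundedDiagram K),
      lam.1.card + (K - eta.1.card) < k → (pairEnd K α β ^ k) X lam eta = 0 := by
    intro k X
    induction k with
    | zero => intro lam eta h; omega
    | succ k ih =>
      intro lam eta h
      rw [pow_succ']
      exact hstep k _ ih lam eta h
  refine LinearMap.ext fun X => ?_
  ext lam eta
  have h1 := lam.2
  exact hpow _ X lam eta (by omega)

theorem pairEnd_nilpotent : IsNilpotent (pairEnd K α β) := ⟨_, pairEnd_pow_eq_zero⟩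

theorem commute_mulLeft_mulLeft {n m : ℕ} (hn : 0 < n) (hm : 0 < m) :
    Commute (LinearMap.mulLeft ℂ (oscMatrix K n)) (LinearMap.mulLeft ℂ (oscMatrix K m)) :=
  LinearMap.ext fun X => by
    simp only [Module.End.mul_apply, LinearMap.mulLeft_apply, ← mul_assoc,
      (oscMatrix_commute hn hm).eq]

theorem commute_mulRight_mulRight {n m : ℕ} (hn : 0 < n) (hm : 0 < m) :
    Commute (LinearMap.mulRight ℂ (oscMatrix K n)) (LinearMap.mulRight ℂ (oscMatrix K m)) :=
  LinearMap.ext fun X => by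
    simp only [Module.End.mul_apply, LinearMap.mulRight_apply, mul_assoc,
      (oscMatrix_commute hn hm).eq]

theorem commute_mulLeft_mulRight (A B : DiagramMatrix K) :
    Commute (LinearMap.mulLeft ℂ A) (LinearMap.mulRight ℂ B) :=
  LinearMap.ext fun X => by
    simp only [Module.End.mul_apply, LinearMap.mulLeft_apply, LinearMap.mulRight_apply, mul_assoc]

theorem commute_pairEnd {T : Module.End ℂ (DiagramMatrix K)}
    (hL : ∀ n, 0 < n → Commute T (LinearMap.mulLeft ℂ (oscMatrix K n)))
    (hR : ∀ n, 0 < n → Commute T (LinearMap.mulRight ℂ (oscMatrix K n))) :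
    Commute T (pairEnd K α β) := by
  refine Commute.sum_right _ _ _ fun n hn => ?_
  rw [Finset.mem_Icc] at hn
  have hn0 : 0 < n := by omega
  exact (((hR n hn0).smul_right _).add_right
    (((hL n hn0).mul_right (hR n hn0)).smul_right _)).add_right ((hL n hn0).smul_right _)

/-- The commutator of the degree operator of the first factor with `pairEnd`. -/
def pairEndDeriv (K : ℕ) (β : ℕ → ℂ) : Module.End ℂ (DiagramMatrix K) :=
  ∑ n ∈ Finset.Icc 1 K,
    (LinearMap.mulLeft ℂ (oscMatrix K n) * LinearMap.mulRight ℂ (oscMatrix K n) +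
      (n * β n) • LinearMap.mulLeft ℂ (oscMatrix K n))

theorem commute_pairEnd_pairEndDeriv : Commute (pairEnd K α β) (pairEndDeriv K β) := by
  refine Commute.sum_right _ _ _ fun n hn => ?_
  rw [Finset.mem_Icc] at hn
  have hn0 : 0 < n := by omega
  have hL : Commute (pairEnd K α β) (LinearMap.mulLeft ℂ (oscMatrix K n)) :=
    (commute_pairEnd (fun m hm => commute_mulLeft_mulLeft hn0 hm)
      fun m _ => commute_mulLeft_mulRight _ _).symm
  have hR : Commute (pairEnd K α β) (LinearMap.mulRight ℂ (oscMatrix K n)) :=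
    (commute_pairEnd (fun m _ => (commute_mulLeft_mulRight _ _).symm)
      fun m hm => commute_mulRight_mulRight hn0 hm).symm
  exact (hL.mul_right hR).add_right (hL.smul_right _)

/-- The degree of the first factor weights a_{-n} by n: this cancels the 1/n of the mixed term and
removes the α terms. -/
theorem mulLeft_degMatrix_mul_pairEnd :
    LinearMap.mulLeft ℂ (degMatrix K) * pairEnd K α β =
      pairEnd K α β * LinearMap.mulLeft ℂ (degMatrix K) + pairEndDeriv K β := by
  refine LinearMap.ext fun X => ?_
  simp only [Module.End.mul_apply, LinearMap.add_apply, LinearMap.mulLeft_apply, pairEnd_apply,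
    pairEndDeriv, LinearMap.sum_apply, LinearMap.smul_apply, LinearMap.mulRight_apply,
    Finset.mul_sum]
  rw [← Finset.sum_add_distrib]
  refine Finset.sum_congr rfl fun n hn => ?_
  rw [Finset.mem_Icc] at hn
  have hn0 : (n : ℂ) ≠ 0 := by exact_mod_cast (by omega : n ≠ 0)
  have hd := degMatrix_mul_oscMatrix (K := K) (n := n) (by omega)
  simp only [mul_add, Matrix.mul_smul, ← mul_assoc, hd]
  simp only [add_mul, Matrix.smul_mul, smul_add, smul_smul, mul_assoc, inv_mul_cancel₀ hn0,
    one_smul, mul_comm (β n)]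
  abel

/-- The matrix which corresponds to the vacuum in the first and `v` in the second factor. -/
def vacRow (v : BoundedDiagram K → ℂ) : DiagramMatrix K :=
  Matrix.of fun lam eta => if lam.1.card = 0 then v eta else 0

theorem exp_pairEnd_mul_oscMatrix {n : ℕ} (hn : 0 < n) (X : DiagramMatrix K) :
    IsNilpotent.exp (pairEnd K α β) X * oscMatrix K n =
      IsNilpotent.exp (pairEnd K α β) (X * oscMatrix K n) := by
  have hR : Commute (LinearMap.mulRight ℂ (oscMatrix K n)) (pairEnd K α β) :=
    commute_pairEnd (fun m _ => (commute_mulLeft_mulRight _ _).symm)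
      fun m hm => commute_mulRight_mulRight hn hm
  have h : Commute (LinearMap.mulRight ℂ (oscMatrix K n)) (IsNilpotent.exp (pairEnd K α β)) := by
    rw [IsNilpotent.exp]
    exact Commute.sum_right _ _ _ fun k _ => (hR.pow_right k).smul_right _
  exact LinearMap.congr_fun h.eq X

theorem vacRow_mul_oscMatrix (v : BoundedDiagram K → ℂ) (n : ℕ) :
    vacRow v * oscMatrix K n = vacRow ((oscMatrix K n).transpose.mulVec v) := by
  ext lam eta
  simp only [Matrix.mul_apply, vacRow, Matrix.of_apply, Matrix.mulVec, dotProduct,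
    Matrix.transpose_apply]
  split_ifs with h
  · exact Finset.sum_congr rfl fun κ _ => mul_comm _ _
  · simp

theorem degMatrix_mul_vacRow (v : BoundedDiagram K → ℂ) : degMatrix K * vacRow v = 0 := by
  ext lam eta
  rw [degMatrix, Matrix.diagonal_mul, vacRow, Matrix.of_apply]
  split_ifs with h
  · rw [h]; simp
  · simp

/-- The vacuum row has degree zero, so only the commutator survives. Its mixed part replaces v by
a_n v, since annihilation in the second factor commutes with the exponential. -/
theorem card_mul_exp_pairEnd (v : BoundedDiagram K → ℂ) (lam eta : BoundedDiagram K) :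
    (lam.1.card : ℂ) * IsNilpotent.exp (pairEnd K α β) (vacRow v) lam eta =
      ∑ n ∈ Finset.Icc 1 K, ∑ κ, oscMatrix K n lam κ *
        (IsNilpotent.exp (pairEnd K α β) (vacRow ((oscMatrix K n).transpose.mulVec v)) κ eta +
          n * β n * IsNilpotent.exp (pairEnd K α β) (vacRow v) κ eta) := by
  have h := LinearMap.congr_fun (mul_nilpotent_exp (pairEnd_nilpotent (K := K) (α := α) (β := β))
    mulLeft_degMatrix_mul_pairEnd commute_pairEnd_pairEndDeriv) (vacRow v)
  simp only [Module.End.mul_apply, LinearMap.add_apply, LinearMap.mulLeft_apply,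
    degMatrix_mul_vacRow, map_zero, zero_add] at h
  have h1 := congrFun (congrFun h lam) eta
  rw [degMatrix, Matrix.diagonal_mul] at h1
  rw [h1, pairEndDeriv, LinearMap.sum_apply, Matrix.sum_apply]
  refine Finset.sum_congr rfl fun n hn => ?_
  rw [Finset.mem_Icc] at hn
  rw [LinearMap.add_apply, Module.End.mul_apply, LinearMap.mulRight_apply, LinearMap.smul_apply,
    LinearMap.mulLeft_apply, LinearMap.mulLeft_apply, exp_pairEnd_mul_oscMatrix (by omega),
    vacRow_mul_oscMatrix, Matrix.add_apply, Matrix.smul_apply, Matrix.mul_apply, Matrix.mul_apply,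
    smul_eq_mul, Finset.mul_sum, ← Finset.sum_add_distrib]
  exact Finset.sum_congr rfl fun κ _ => by ring

/-- Nothing has been created in the vacuum row, so only the α terms act. -/
theorem exp_pairEnd_vacuum_row (v : BoundedDiagram K → ℂ) {lam : BoundedDiagram K}
    (hlam : lam.1.card = 0) (eta : BoundedDiagram K) :
    IsNilpotent.exp (pairEnd K α β) (vacRow v) lam eta =
      ((vertexMatrix K α).transpose.mulVec v) eta := by
  have hrow : ∀ (X : DiagramMatrix K),
      pairEnd K α β X lam = Matrix.vecMul (X lam) (creationMatrix K α) := by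
    intro X
    have hL : ∀ (n : ℕ) (Y : DiagramMatrix K), 0 < n → (oscMatrix K n * Y) lam = 0 := by
      intro n Y hn
      ext κ
      rw [Matrix.mul_apply, Pi.zero_apply]
      refine Finset.sum_eq_zero fun μ _ => ?_
      by_contra hc
      have := oscMatrix_support hn (left_ne_zero_of_mul hc)
      omega
    ext κ
    rw [pairEnd_apply, Matrix.sum_apply, creationMatrix]
    simp only [Matrix.vecMul, dotProduct, Matrix.sum_apply, Finset.mul_sum]
    rw [Finset.sum_comm]
    refine Finset.sum_congr rfl fun n hn => ?_
    rw [Finset.mem_Icc] at hn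
    simp only [Matrix.add_apply, Matrix.smul_apply]
    rw [hL n _ (by omega), hL n _ (by omega), Matrix.mul_apply, smul_eq_mul, Finset.mul_sum]
    simp only [Pi.zero_apply, smul_eq_mul, mul_zero, add_zero]
    exact Finset.sum_congr rfl fun μ _ => by ring
  have hpow : ∀ k : ℕ, ((pairEnd K α β ^ k) (vacRow v)) lam =
      Matrix.vecMul v (creationMatrix K α ^ k) := by
    intro k
    induction k with
    | zero =>
      rw [pow_zero, pow_zero, Matrix.vecMul_one]
      ext κ
      simp only [Module.End.one_apply, vacRow, Matrix.of_apply, if_pos hlam]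
    | succ k ih =>
      rw [pow_succ', Module.End.mul_apply, hrow, ih, Matrix.vecMul_vecMul, ← pow_succ]
  have hnil : creationMatrix K α ^ (2 * K + 1) = 0 :=
    pow_eq_zero_of_le (by omega) (triangular_pow_eq_zero (K := K) (deg := fun lam => lam.1.card)
      (fun _ _ => creationMatrix_support) fun lam => lam.2)
  rw [IsNilpotent.exp_eq_sum pairEnd_pow_eq_zero, vertexMatrix, IsNilpotent.exp_eq_sum hnil,
    Matrix.mulVec_transpose, LinearMap.sum_apply, Matrix.sum_apply]
  simp only [Matrix.vecMul, dotProduct, Matrix.sum_apply, Finset.mul_sum]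
  rw [Finset.sum_comm]
  refine Finset.sum_congr rfl fun k _ => ?_
  have := congrFun (hpow k) eta
  simp only [Matrix.vecMul, dotProduct] at this
  rw [LinearMap.smul_apply, Matrix.smul_apply, this, Finset.smul_sum]
  exact Finset.sum_congr rfl fun μ _ => by rw [Matrix.smul_apply, mul_smul_comm]

theorem vertexMatrix_transpose_commute {n : ℕ} (hn : 0 < n) (v : BoundedDiagram K → ℂ) :
    (oscMatrix K n).transpose.mulVec ((vertexMatrix K α).transpose.mulVec v) =
      (vertexMatrix K α).transpose.mulVec ((oscMatrix K n).transpose.mulVec v) := by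
  have h : Commute (oscMatrix K n) (vertexMatrix K α) := by
    rw [vertexMatrix, IsNilpotent.exp]
    exact Commute.sum_right _ _ _ fun k _ =>
      (commute_oscMatrix_creationMatrix hn).pow_right k |>.smul_right _
  rw [Matrix.mulVec_mulVec, Matrix.mulVec_mulVec, ← Matrix.transpose_mul, ← Matrix.transpose_mul,
    h.eq]

/-- The degree passes the exponential, leaving a β term and the degree of u, which is then written
as Σ a_{-n} a_n. With u = exp(Σ α_n a_n) v this is the recursion of `card_mul_exp_pairEnd`. -/
theorem degMatrix_mulVec_vertexMatrix (u : BoundedDiagram K → ℂ) :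
    (degMatrix K).mulVec ((vertexMatrix K β).mulVec u) =
      ∑ n ∈ Finset.Icc 1 K, (oscMatrix K n).mulVec
        ((vertexMatrix K β).mulVec ((oscMatrix K n).transpose.mulVec u) +
          (n * β n) • (vertexMatrix K β).mulVec u) := by
  have h1 : degMatrix K * vertexMatrix K β =
      vertexMatrix K β * degMatrix K + (creationMatrix K fun n => n * β n) * vertexMatrix K β :=
    mul_nilpotent_exp creationMatrix_nilpotent degMatrix_mul_creationMatrix commute_creationMatrix
  have h2 : ∀ n, 0 < n → Commute (oscMatrix K n) (vertexMatrix K β) := by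
    intro n hn
    rw [vertexMatrix, IsNilpotent.exp]
    exact Commute.sum_right _ _ _ fun k _ =>
      (commute_oscMatrix_creationMatrix hn).pow_right k |>.smul_right _
  have h3 : degMatrix K * vertexMatrix K β = ∑ n ∈ Finset.Icc 1 K,
      oscMatrix K n * (vertexMatrix K β * (oscMatrix K n).transpose +
        (n * β n) • vertexMatrix K β) := by
    rw [h1, ← sum_oscMatrix_mul_transpose, creationMatrix, Finset.mul_sum, Finset.sum_mul,
      ← Finset.sum_add_distrib]
    refine Finset.sum_congr rfl fun n hn => ?_
    rw [Finset.mem_Icc] at hn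
    rw [← mul_assoc, ← (h2 n (by omega)).eq, mul_add, mul_assoc, Matrix.mul_smul, Matrix.smul_mul]
  rw [Matrix.mulVec_mulVec, h3, Matrix.sum_mulVec]
  refine Finset.sum_congr rfl fun n _ => ?_
  rw [← Matrix.mulVec_mulVec, Matrix.add_mulVec, ← Matrix.mulVec_mulVec, Matrix.smul_mulVec]

/-- The vacuum expectation value in the second factor of the exponential of the bilinear
operator. -/
theorem exp_pairEnd_apply (v : BoundedDiagram K → ℂ) (lam : BoundedDiagram K)
    {o : BoundedDiagram K} (ho : o.1.card = 0) :
    IsNilpotent.exp (pairEnd K α β) (vacRow v) lam o =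
      (vertexMatrix K β).mulVec ((vertexMatrix K α).transpose.mulVec v) lam := by
  -- The vector v is quantified inside the induction because the recursion passes from v to a_n v.
  have key : ∀ d, ∀ lam : BoundedDiagram K, lam.1.card = d → ∀ v : BoundedDiagram K → ℂ,
      IsNilpotent.exp (pairEnd K α β) (vacRow v) lam o =
        (vertexMatrix K β).mulVec ((vertexMatrix K α).transpose.mulVec v) lam := by
    intro d
    induction d using Nat.strong_induction_on with
    | _ d ih =>
      intro lam hd v
      have hbot : ∀ kap : BoundedDiagram K, kap.1.card = 0 → kap = o := by
        intro kap hk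
        refine Subtype.ext (YoungDiagram.ext ?_)
        rw [Finset.card_eq_zero.1 hk, Finset.card_eq_zero.1 ho]
      by_cases h0 : d = 0
      · obtain rfl := hbot lam (hd.trans h0)
        rw [exp_pairEnd_vacuum_row v ho]
        generalize (vertexMatrix K α).transpose.mulVec v = u
        simp only [Matrix.mulVec, dotProduct]
        rw [Finset.sum_eq_single lam]
        · rw [vertexMatrix, triangular_exp_apply (K := K) (deg := fun lam => lam.1.card)
            (fun _ _ => creationMatrix_support) (fun lam => lam.2) le_rfl, if_pos rfl, one_mul]
        · intro kap _ hk
          rw [vertexMatrix, triangular_exp_apply (K := K) (deg := fun lam => lam.1.card)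
            (fun _ _ => creationMatrix_support) (fun lam => lam.2) (by omega), if_neg hk.symm,
            zero_mul]
        · intro h; exact absurd (Finset.mem_univ _) h
      · have hne : (lam.1.card : ℂ) ≠ 0 := by
          rw [hd]; exact_mod_cast h0
        refine mul_left_cancel₀ hne ?_
        rw [card_mul_exp_pairEnd]
        have h1 := congrFun (degMatrix_mulVec_vertexMatrix (β := β)
          ((vertexMatrix K α).transpose.mulVec v)) lam
        rw [degMatrix, Matrix.mulVec_diagonal] at h1
        rw [h1, Finset.sum_apply]
        refine Finset.sum_congr rfl fun n hn => ?_
        rw [Finset.mem_Icc] at hn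
        rw [vertexMatrix_transpose_commute (by omega)]
        conv_rhs => rw [Matrix.mulVec, dotProduct]
        refine Finset.sum_congr rfl fun kap _ => ?_
        by_cases hz : oscMatrix K n lam kap = 0
        · rw [hz, zero_mul, zero_mul]
        · have := oscMatrix_support (by omega) hz
          rw [ih kap.1.card (by omega) kap rfl, ih kap.1.card (by omega) kap rfl, Pi.add_apply,
            Pi.smul_apply, smul_eq_mul]
  exact key _ lam rfl v

end

end FreeFermion
end

noncomputable section
namespace FreeFermion
open Maya

/-! ### Exponentials of operators on the Fock space and of matrices -/

section

variable {X Y : Type}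

/-- Bridge from the formal exponential to a finite one; the additive functional e reads off a single
component. -/
theorem opExp_eq_nilpotent_exp {R : Type*} [Ring R] [Module ℚ R] {B : R} {m : ℕ}
    (hB : B ^ m = 0) (e : R →+ ℂ) {A : Op X} {w : X → ℂ} {x : X}
    (h : ∀ k, (A^[k] w) x = e (B ^ k)) : opExp A w x = e (IsNilpotent.exp B) := by
  rw [opExp, tsum_eq_sum (s := Finset.range m), IsNilpotent.exp_eq_sum hB, map_sum]
  · refine Finset.sum_congr rfl fun k _ => ?_
    rw [h, map_rat_smul, Rat.smul_def]
    push_cast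
    rfl
  · intro k hk
    rw [Finset.mem_range, not_lt] at hk
    rw [h, pow_eq_zero_of_le hk hB, map_zero, mul_zero]

/-- Used to freeze the first Fock component: f embeds a slice that the operator preserves. -/
theorem opExp_comp {A : Op X} {B : Op Y} {f : Y → X} (h : ∀ w, A w ∘ f = B (w ∘ f)) (w : X → ℂ)
    (y : Y) : opExp A w (f y) = opExp B (w ∘ f) y := by
  have hk : ∀ k, A^[k] w ∘ f = B^[k] (w ∘ f) := by
    intro k
    induction k with
    | zero => rfl
    | succ k ih => rw [Function.iterate_succ_apply', h, ih, Function.iterate_succ_apply']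
  exact tsum_congr fun k => congrArg _ (congrFun (hk k) y)

theorem iterate_eq_zero {A : Op X} {P : X → Prop}
    (hA : ∀ w : X → ℂ, (∀ x, P x → w x = 0) → ∀ x, P x → A w x = 0) {w : X → ℂ}
    (hw : ∀ x, P x → w x = 0) (k : ℕ) : ∀ x, P x → (A^[k] w) x = 0 := by
  induction k with
  | zero => exact hw
  | succ k ih => rw [Function.iterate_succ_apply']; exact hA _ ih

theorem opExp_eq_zero {A : Op X} {P : X → Prop}
    (hA : ∀ w : X → ℂ, (∀ x, P x → w x = 0) → ∀ x, P x → A w x = 0) {w : X → ℂ}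
    (hw : ∀ x, P x → w x = 0) {x : X} (hx : P x) : opExp A w x = 0 := by
  rw [opExp]
  simp only [iterate_eq_zero hA hw _ x hx, mul_zero, tsum_zero]

end

/-- The components of a vector along the diagrams with at most `K` boxes. -/
def truncate (K : ℕ) (w : Maya → ℂ) : BoundedDiagram K → ℂ := fun lam => w (mayaOf lam.1)

theorem aMode_zero {n : ℤ} (hn : n ≠ 0) (S : Maya) : aMode n (fun _ => 0) S = 0 := by
  simp [aMode_eq_sum hn]

theorem aMode_eq_zero_of_excess {n : ℤ} (hn : n ≠ 0) {w : Maya → ℂ}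
    (hw : ∀ S, excess 1 S ≠ 0 → w S = 0) {S : Maya} (hS : excess 1 S ≠ 0) : aMode n w S = 0 := by
  rw [aMode_eq_sum hn]
  refine Finset.sum_eq_zero fun k hk => ?_
  simp only [Set.Finite.mem_toFinset, Set.mem_ofPred_eq] at hk
  rw [hw, mul_zero, mul_zero]
  rw [excess_move hk.2 hk.1]
  simpa using hS

theorem aMode_eq_zero_of_card {n K : ℕ} (hn : 0 < n) {w : Maya → ℂ}
    (hw : ∀ eta : YoungDiagram, K < eta.card → w (mayaOf eta) = 0) {lam : YoungDiagram}
    (h : K < lam.card) : aMode n w (mayaOf lam) = 0 := by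
  rw [aMode_apply_eq_sum (K := K) (by omega) w lam fun eta _ => hw eta]
  refine Finset.sum_eq_zero fun eta _ => ?_
  by_contra hc
  have h1 := aMode_basisVec_support (by omega) (left_ne_zero_of_mul hc)
  have h2 := eta.2
  omega

theorem oscMatrix_eq_zero {K n : ℕ} (h : K < n) : oscMatrix K n = 0 := by
  ext lam eta
  by_contra hc
  have h1 := oscMatrix_support (by omega) hc
  have h2 := lam.2
  omega

theorem creationMatrix_pow_eq_zero {K : ℕ} {c : ℕ → ℂ} : creationMatrix K c ^ (K + 1) = 0 :=
  triangular_pow_eq_zero (K := K) (deg := fun lam => lam.1.card)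
    (fun _ _ => creationMatrix_support) fun lam => lam.2

/-! ### One Fock space -/

/-- The operator `∑_{n>0} c_n a_{-n}`. -/
def raiseOp (c : ℕ → ℂ) : Op Maya := fun w S => ∑' n : ℕ+, c n * aMode (-(n : ℤ)) w S

/-- The operator `∑_{n>0} c_n a_n`. -/
def lowerOp (c : ℕ → ℂ) : Op Maya := fun w S => ∑' n : ℕ+, c n * aMode (n : ℤ) w S

section

variable {K : ℕ} {c : ℕ → ℂ} {w : Maya → ℂ}

theorem truncate_raiseOp :
    truncate K (raiseOp c w) = (creationMatrix K c).mulVec (truncate K w) := by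
  ext lam
  have h1 : ∀ n : ℕ, 0 < n → c n * aMode (-(n : ℤ)) w (mayaOf lam.1) =
      c n * (oscMatrix K n).mulVec (truncate K w) lam := fun n hn => by
    rw [aMode_neg_apply hn]; rfl
  rw [truncate, raiseOp, tsum_congr fun n : ℕ+ => h1 n n.pos,
    tsum_pnat_eq_sum (K := K) fun n => c n * (oscMatrix K n).mulVec (truncate K w) lam,
    creationMatrix, Matrix.sum_mulVec, Finset.sum_apply]
  · exact Finset.sum_congr rfl fun n _ => by rw [Matrix.smul_mulVec, Pi.smul_apply, smul_eq_mul]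
  · intro n hn
    rw [oscMatrix_eq_zero hn, Matrix.zero_mulVec, Pi.zero_apply, mul_zero]

theorem opExp_raiseOp (lam : BoundedDiagram K) :
    opExp (raiseOp c) w (mayaOf lam.1) = (vertexMatrix K c).mulVec (truncate K w) lam := by
  refine opExp_eq_nilpotent_exp creationMatrix_pow_eq_zero
    (AddMonoidHom.mk' (fun B : DiagramMatrix K => B.mulVec (truncate K w) lam)
      fun B B' => by rw [Matrix.add_mulVec, Pi.add_apply]) fun k => ?_
  have h : truncate K ((raiseOp c)^[k] w) = (creationMatrix K c ^ k).mulVec (truncate K w) := by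
    induction k with
    | zero => rw [pow_zero, Matrix.one_mulVec]; rfl
    | succ k ih =>
      rw [Function.iterate_succ_apply', truncate_raiseOp, ih, Matrix.mulVec_mulVec, ← pow_succ']
  exact congrFun h lam

theorem opExp_raiseOp_eq_zero (hw : ∀ S, excess 1 S ≠ 0 → w S = 0) {S : Maya}
    (hS : excess 1 S ≠ 0) : opExp (raiseOp c) w S = 0 := by
  refine opExp_eq_zero (P := fun S => excess 1 S ≠ 0) (fun w hw S hS => ?_) hw hS
  simp only [raiseOp]
  rw [tsum_congr fun n : ℕ+ => by
    rw [aMode_eq_zero_of_excess (neg_ne_zero.2 (by exact_mod_cast n.ne_zero)) hw hS, mul_zero],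
    tsum_zero]

theorem truncate_lowerOp (hw : ∀ eta : YoungDiagram, K < eta.card → w (mayaOf eta) = 0) :
    truncate K (lowerOp c w) = Matrix.vecMul (truncate K w) (creationMatrix K c) := by
  ext lam
  have h1 : ∀ n : ℕ, 0 < n → c n * aMode (n : ℤ) w (mayaOf lam.1) =
      c n * Matrix.vecMul (truncate K w) (oscMatrix K n) lam := fun n hn => by
    rw [aMode_pos_apply hn hw, Matrix.vecMul, dotProduct]
    exact congrArg _ (Finset.sum_congr rfl fun eta _ => mul_comm _ _)
  rw [truncate, lowerOp, tsum_congr fun n : ℕ+ => h1 n n.pos,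
    tsum_pnat_eq_sum (K := K) fun n => c n * Matrix.vecMul (truncate K w) (oscMatrix K n) lam,
    creationMatrix, Matrix.vecMul_sum, Finset.sum_apply]
  · exact Finset.sum_congr rfl fun n _ => by rw [Matrix.vecMul_smul, Pi.smul_apply, smul_eq_mul]
  · intro n hn
    rw [oscMatrix_eq_zero hn, Matrix.vecMul_zero, Pi.zero_apply, mul_zero]

theorem opExp_lowerOp (hw : ∀ eta : YoungDiagram, K < eta.card → w (mayaOf eta) = 0)
    (lam : BoundedDiagram K) :
    opExp (lowerOp c) w (mayaOf lam.1) = Matrix.vecMul (truncate K w) (vertexMatrix K c) lam := by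
  refine opExp_eq_nilpotent_exp creationMatrix_pow_eq_zero
    (AddMonoidHom.mk' (fun B : DiagramMatrix K => Matrix.vecMul (truncate K w) B lam)
      fun B B' => by rw [Matrix.vecMul_add, Pi.add_apply]) fun k => ?_
  have hz : ∀ k, ∀ eta : YoungDiagram, K < eta.card → ((lowerOp c)^[k] w) (mayaOf eta) = 0 := by
    intro k eta heta
    refine iterate_eq_zero (P := fun S => ∃ eta : YoungDiagram, K < eta.card ∧ S = mayaOf eta)
      ?_ ?_ k _ ⟨eta, heta, rfl⟩
    · rintro w hw _ ⟨eta, heta, rfl⟩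
      simp only [lowerOp]
      rw [tsum_congr fun n : ℕ+ => by
        rw [aMode_eq_zero_of_card (n := n) n.pos (fun eta h => hw _ ⟨eta, h, rfl⟩) heta, mul_zero],
        tsum_zero]
    · rintro _ ⟨eta, heta, rfl⟩
      exact hw eta heta
  have h : truncate K ((lowerOp c)^[k] w) =
      Matrix.vecMul (truncate K w) (creationMatrix K c ^ k) := by
    induction k with
    | zero => rw [pow_zero, Matrix.vecMul_one]; rfl
    | succ k ih =>
      rw [Function.iterate_succ_apply', truncate_lowerOp (hz k), ih, Matrix.vecMul_vecMul,
        ← pow_succ]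
  exact congrFun h lam

end

/-! ### Two Fock spaces -/

/-- The operator `∑_{n>0} (α_n a_n^(2) + (1/n) a_{-n}^(1) a_n^(2) + β_n a_{-n}^(1))`. -/
def pairOp (α β : ℕ → ℂ) : Op (Maya × Maya) := fun w x =>
  ∑' n : ℕ+, (α n * aMode n (fun R => w (x.1, R)) x.2 +
    (n : ℂ)⁻¹ * aMode (-(n : ℤ)) (fun T => aMode n (fun R => w (T, R)) x.2) x.1 +
    β n * aMode (-(n : ℤ)) (fun T => w (T, x.2)) x.1)

section

variable {K : ℕ} {α β : ℕ → ℂ}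

/-- The components of a vector along the pairs of diagrams with at most `K` boxes. -/
def truncatePair (K : ℕ) (w : Maya × Maya → ℂ) : DiagramMatrix K :=
  Matrix.of fun lam eta => w (mayaOf lam.1, mayaOf eta.1)

theorem truncatePair_pairOp {w : Maya × Maya → ℂ}
    (hw : ∀ T (eta : YoungDiagram), K < eta.card → w (T, mayaOf eta) = 0) :
    truncatePair K (pairOp α β w) = pairEnd K α β (truncatePair K w) := by
  ext lam eta
  have h1 : ∀ n : ℕ, 0 < n → ∀ T, aMode n (fun R => w (T, R)) (mayaOf eta.1) =
      ∑ κ, oscMatrix K n κ eta * w (T, mayaOf κ.1) := fun n hn T => aMode_pos_apply hn (hw T) eta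
  have h2 : ∀ n : ℕ, 0 < n → α n * aMode n (fun R => w (mayaOf lam.1, R)) (mayaOf eta.1) +
      (n : ℂ)⁻¹ * aMode (-(n : ℤ)) (fun T => aMode n (fun R => w (T, R)) (mayaOf eta.1))
        (mayaOf lam.1) + β n * aMode (-(n : ℤ)) (fun T => w (T, mayaOf eta.1)) (mayaOf lam.1) =
      (α n • (truncatePair K w * oscMatrix K n) +
      (n : ℂ)⁻¹ • (oscMatrix K n * (truncatePair K w * oscMatrix K n)) +
      β n • (oscMatrix K n * truncatePair K w)) lam eta := by
    intro n hn
    simp only [h1 n hn]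
    simp only [aMode_neg_apply hn, Matrix.add_apply, Matrix.smul_apply, smul_eq_mul,
      Matrix.mul_apply, truncatePair, Matrix.of_apply]
    simp only [mul_comm (oscMatrix K n _ eta)]
  rw [truncatePair, Matrix.of_apply, pairOp, pairEnd_apply, Matrix.sum_apply,
    tsum_congr fun n : ℕ+ => h2 n n.pos]
  exact tsum_pnat_eq_sum (fun n => (α n • (truncatePair K w * oscMatrix K n) +
      (n : ℂ)⁻¹ • (oscMatrix K n * (truncatePair K w * oscMatrix K n)) +
      β n • (oscMatrix K n * truncatePair K w)) lam eta) fun n hn => by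
    simp [oscMatrix_eq_zero hn]

/-- The vacuum expectation value in the second factor of the exponential of `pairOp`. -/
theorem opExp_pairOp {v : Maya → ℂ}
    (hv : ∀ eta : YoungDiagram, K < eta.card → v (mayaOf eta) = 0) (lam : BoundedDiagram K) :
    opExp (pairOp α β) (fun p => vacuum p.1 * v p.2) (mayaOf lam.1, vac) =
      (vertexMatrix K β).mulVec ((vertexMatrix K α).transpose.mulVec (truncate K v)) lam := by
  let o : BoundedDiagram K := ⟨⊥, Nat.zero_le _⟩
  rw [← exp_pairEnd_apply (truncate K v) lam (o := o) rfl]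
  refine opExp_eq_nilpotent_exp pairEnd_pow_eq_zero
    (AddMonoidHom.mk' (fun B : Module.End ℂ (DiagramMatrix K) => B (vacRow (truncate K v)) lam o)
      fun B B' => by rw [LinearMap.add_apply, Matrix.add_apply]) fun k => ?_
  have hz : ∀ k, ∀ T (eta : YoungDiagram), K < eta.card →
      ((pairOp α β)^[k] (fun p => vacuum p.1 * v p.2)) (T, mayaOf eta) = 0 := by
    intro k T eta heta
    refine iterate_eq_zero
      (P := fun x : Maya × Maya => ∃ eta : YoungDiagram, K < eta.card ∧ x.2 = mayaOf eta)
      ?_ ?_ k _ ⟨eta, heta, rfl⟩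
    · rintro w hw ⟨T, _⟩ ⟨eta, heta, rfl⟩
      simp only [pairOp]
      rw [← tsum_zero]
      refine tsum_congr fun n : ℕ+ => ?_
      have h0 : -((n : ℕ) : ℤ) ≠ 0 := neg_ne_zero.2 (by exact_mod_cast n.ne_zero)
      have h1 : ∀ T, aMode ((n : ℕ) : ℤ) (fun R => w (T, R)) (mayaOf eta) = 0 := fun T =>
        aMode_eq_zero_of_card n.pos (fun κ hκ => hw _ ⟨κ, hκ, rfl⟩) heta
      have h2 : ∀ T, w (T, mayaOf eta) = 0 := fun T => hw _ ⟨eta, heta, rfl⟩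
      simp only [h1, h2, aMode_zero h0, mul_zero, add_zero]
    · rintro ⟨T, _⟩ ⟨eta, heta, rfl⟩
      simp only [hv eta heta, mul_zero]
  have h : truncatePair K ((pairOp α β)^[k] fun p => vacuum p.1 * v p.2) =
      (pairEnd K α β ^ k) (vacRow (truncate K v)) := by
    induction k with
    | zero =>
      rw [pow_zero]
      ext lam eta
      have hiff : mayaOf lam.1 = vac ↔ lam.1.card = 0 := by
        rw [← mayaOf_bot, mayaOf_injective.eq_iff, YoungDiagram.card, Finset.card_eq_zero]
        exact ⟨fun h => by rw [h]; rfl, fun h => YoungDiagram.ext h⟩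
      simp only [truncatePair, Matrix.of_apply, Function.iterate_zero, id, Module.End.one_apply,
        vacRow, vacuum, hiff, ite_mul, one_mul, zero_mul, truncate]
    | succ k ih =>
      rw [Function.iterate_succ_apply', truncatePair_pairOp (hz k), ih, pow_succ',
        Module.End.mul_apply]
  have := congrFun (congrFun h lam) o
  rw [truncatePair, Matrix.of_apply, show o.1 = ⊥ from rfl, mayaOf_bot] at this
  exact this

theorem opExp_pairOp_eq_zero {w : Maya × Maya → ℂ} (hw : ∀ T R, excess 1 T ≠ 0 → w (T, R) = 0)
    {T : Maya} (hT : excess 1 T ≠ 0) (R : Maya) : opExp (pairOp α β) w (T, R) = 0 := by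
  refine opExp_eq_zero (P := fun x => excess 1 x.1 ≠ 0) ?_ (fun x => hw x.1 x.2) hT
  rintro w hw ⟨T, R⟩ hT
  simp only [pairOp]
  rw [← tsum_zero]
  refine tsum_congr fun n : ℕ+ => ?_
  have h0 : ((n : ℕ) : ℤ) ≠ 0 := by exact_mod_cast n.ne_zero
  have h1 : ∀ R, w (T, R) = 0 := fun R => hw _ hT
  have h2 : ∀ T, excess 1 T ≠ 0 → aMode ((n : ℕ) : ℤ) (fun R => w (T, R)) R = 0 := fun T hT => by
    simp only [hw (T, _) hT, aMode_zero h0]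
  rw [aMode_eq_zero_of_excess (neg_ne_zero.2 h0) h2 hT,
    aMode_eq_zero_of_excess (neg_ne_zero.2 h0) (fun T hT => hw (T, R) hT) hT]
  simp only [h1, aMode_zero h0, mul_zero, add_zero]

end

theorem aMode_aMode_swap {n m : ℤ} (hn : n ≠ 0) (hm : m ≠ 0) (w : Maya → Maya → ℂ) (S T : Maya) :
    aMode n (fun X => aMode m (fun Y => w X Y) T) S =
      aMode m (fun Y => aMode n (fun X => w X Y) S) T := by
  simp only [aMode_eq_sum hn, aMode_eq_sum hm, Finset.mul_sum]
  rw [Finset.sum_comm]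
  exact Finset.sum_congr rfl fun _ _ => Finset.sum_congr rfl fun _ _ => by ring

/-- Since b_n is diagonal, S is a mere parameter and b_n acts as the scalar `bEigen ℓ n S`. -/
theorem opExp_bilinStar (ℓ : ℂ) (w : Maya × Maya × Maya → ℂ) (S T R : Maya) :
    opExp (bilinStar ℓ) w (S, T, R) =
      opExp (pairOp (fun n => -(-1) ^ n * bEigen ℓ n S / n)
        fun n => (-1) ^ n * bEigen ℓ (-n) S / n) (fun p => w (S, p.1, p.2)) (T, R) := by
  refine opExp_comp (f := fun p : Maya × Maya => (S, p.1, p.2)) (fun w => ?_) w (T, R)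
  ext ⟨T, R⟩
  simp only [Function.comp_def, bilinStar, pairOp, on1, on2, on3, bMode_apply]
  exact tsum_congr fun n => by ring

/-- The third space starts in the vacuum and the second ends in it, so they enter `pairOp` in
exchanged order. -/
theorem opExp_bilin (ℓ : ℂ) (w : Maya × Maya × Maya → ℂ) (S T R : Maya) :
    opExp (bilin ℓ) w (S, T, R) =
      opExp (pairOp (fun n => (-1) ^ n * bEigen ℓ n S / n)
        fun n => -(-1) ^ n * bEigen ℓ (-n) S / n) (fun p => w (S, p.2, p.1)) (R, T) := by
  refine opExp_comp (f := fun p : Maya × Maya => (S, p.2, p.1)) (fun w => ?_) w (R, T)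
  ext ⟨R, T⟩
  simp only [Function.comp_def, bilin, pairOp, on1, on2, on3, bMode_apply]
  refine tsum_congr fun n => ?_
  have h0 : ((n : ℕ) : ℤ) ≠ 0 := by exact_mod_cast n.ne_zero
  rw [aMode_aMode_swap (neg_ne_zero.2 h0) h0 fun X Y => w (S, Y, X)]
  ring

end FreeFermion
end

noncomputable section
namespace FreeFermion
open Maya

/-! ### The vertex and the intertwiners -/

theorem transpose_bot : (⊥ : YoungDiagram).transpose = ⊥ := by
  ext x; simp [YoungDiagram.mem_transpose]

theorem kappa_bot : kappa ⊥ = 0 := by simp [kappa, colLen_bot]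

theorem card_bot : (⊥ : YoungDiagram).card = 0 := rfl

section

variable {ℓ : ℂ}

/-- Needed in order to divide by 𝒩_∅. The factors are 1 + x/(1 - x) with x = q^{i+j+1}, i, j ≥ 0, a
summable perturbation of 1 without zeros. -/
theorem hookProd_bot_ne_zero (hℓ : ‖Complex.exp ℓ‖ < 1) : hookProd ℓ ⊥ ≠ 0 := by
  set q := Complex.exp ℓ with hq
  have hx : ∀ p : ℕ × ℕ, qPow ℓ (-((⊥ : YoungDiagram).rowLen p.1 : ℂ) -
      (⊥ : YoungDiagram).colLen p.2 + (p.1 + 1) + (p.2 + 1) - 1) = q ^ (p.1 + p.2 + 1) := by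
    intro p
    rw [rowLen_bot, colLen_bot, qPow, hq, ← Complex.exp_nat_mul]
    congr 1; push_cast; ring
  have hlt : ∀ n : ℕ, ‖q ^ (n + 1)‖ ≤ ‖q‖ := by
    intro n
    rw [norm_pow]
    exact pow_le_of_le_one (norm_nonneg _) hℓ.le (Nat.succ_ne_zero n)
  have hge : ∀ n : ℕ, 1 - ‖q‖ ≤ ‖1 - q ^ (n + 1)‖ := by
    intro n
    have h1 := norm_sub_norm_le (1 : ℂ) (q ^ (n + 1))
    rw [norm_one] at h1
    linarith [hlt n]
  have hne : ∀ n : ℕ, 1 - q ^ (n + 1) ≠ 0 := fun n h => by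
    have := hge n
    rw [h, norm_zero] at this
    linarith
  have h := tprod_one_add_ne_zero_of_summable (R := ℂ)
    (f := fun p : ℕ × ℕ => q ^ (p.1 + p.2 + 1) * (1 - q ^ (p.1 + p.2 + 1))⁻¹) ?_ ?_
  · convert h using 1
    refine tprod_congr fun p => ?_
    rw [hx]
    have := hne (p.1 + p.2)
    field_simp
    ring
  · intro p
    have := hne (p.1 + p.2)
    have h1 : 1 + q ^ (p.1 + p.2 + 1) * (1 - q ^ (p.1 + p.2 + 1))⁻¹ =
        (1 - q ^ (p.1 + p.2 + 1))⁻¹ := by field_simp; ring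
    rw [h1]
    exact inv_ne_zero this
  · have hs := summable_geometric_of_lt_one (norm_nonneg q) hℓ
    have hs2 : Summable fun p : ℕ × ℕ => ‖q‖ ^ p.1 * ‖q‖ ^ p.2 :=
      hs.mul_of_nonneg hs (fun _ => by positivity) fun _ => by positivity
    refine Summable.of_nonneg_of_le (fun _ => norm_nonneg _) (fun p => ?_)
      (hs2.mul_right (1 - ‖q‖)⁻¹)
    rw [norm_mul, norm_inv, norm_pow, ← pow_add]
    refine mul_le_mul (pow_le_pow_of_le_one (norm_nonneg _) hℓ.le (Nat.le_succ _))
      (inv_anti₀ (by linarith) (hge _)) (by positivity) (by positivity)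

theorem normKet_bot_ne_zero (hℓ : ‖Complex.exp ℓ‖ < 1) : normKet ℓ ⊥ ≠ 0 := by
  rw [normKet, Complex.cpow_ne_zero_iff_of_exponent_ne_zero (by norm_num)]
  exact mul_ne_zero (mul_ne_zero (by simp [card_bot]) (qPow_ne_zero _ _)) (hookProd_bot_ne_zero hℓ)

theorem normBra_bot : normBra ℓ ⊥ = normKet ℓ ⊥ := by
  simp [normBra, normKet, kappa_bot, card_bot]

theorem vertexMatrix_congr {K : ℕ} {c c' : ℕ → ℂ} (h : ∀ n, 0 < n → c n = c' n) :
    vertexMatrix K c = vertexMatrix K c' := by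
  rw [vertexMatrix, vertexMatrix, creationMatrix, creationMatrix]
  congr 1
  refine Finset.sum_congr rfl fun n hn => ?_
  rw [h n (Finset.mem_Icc.1 hn).1]

theorem powerSum_spec (lam : YoungDiagram) (n : ℕ) (c : ℂ) :
    powerSum n (spec ℓ lam c) = qPow ℓ c ^ n * powerSum n (spec ℓ lam 0) := by
  rw [← powerSum_spec_add, add_zero]

theorem neg_one_pow_pred {n : ℕ} (hn : 0 < n) : (-1 : ℂ) ^ (n - 1) = -(-1) ^ n := by
  obtain ⟨m, rfl⟩ : ∃ m, n = m + 1 := ⟨n - 1, by omega⟩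
  rw [pow_succ, Nat.add_sub_cancel]; ring

theorem bra_ket (lam : YoungDiagram) (w : Maya → ℂ) :
    bra (ket lam) w = (-1) ^ lam.card * w (mayaOf lam) := by
  rw [bra, tsum_eq_single (mayaOf lam)]
  · rw [ket_eq, Pi.smul_apply, basisVec_self, smul_eq_mul, mul_one]
  · intro S hS
    rw [ket_eq, Pi.smul_apply, basisVec_of_ne hS, smul_zero, zero_mul]

theorem bra_vacuum (w : Maya → ℂ) : bra vacuum w = w vac := by
  rw [bra, tsum_eq_single vac, vacuum_eq, basisVec_self, one_mul]
  intro S hS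
  rw [vacuum_eq, basisVec_of_ne hS, zero_mul]

theorem ket_self (lam : YoungDiagram) : ket lam (mayaOf lam) = (-1) ^ lam.card := by
  rw [ket_eq, Pi.smul_apply, basisVec_self, smul_eq_mul, mul_one]

theorem ket_of_ne {lam eta : YoungDiagram} (h : eta ≠ lam) : ket lam (mayaOf eta) = 0 := by
  rw [ket_eq, Pi.smul_apply, basisVec_of_ne fun h' => h (mayaOf_injective h'), smul_zero]

theorem ket_of_excess {S : Maya} (hS : excess 1 S ≠ 0) (lam : YoungDiagram) : ket lam S = 0 := by
  rw [ket_eq, Pi.smul_apply, basisVec_of_ne, smul_zero]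
  rintro rfl
  exact hS (excess_one_mayaOf lam)

theorem vacuum_of_excess {S : Maya} (hS : excess 1 S ≠ 0) : vacuum S = 0 := by
  rw [vacuum_eq, basisVec_of_ne]
  rintro rfl
  rw [← mayaOf_bot] at hS
  exact hS (excess_one_mayaOf ⊥)

theorem sKet_bot_eq : sKet ℓ ⊥ = normKet ℓ ⊥ • opExp
    (raiseOp fun n => -(powerSum n (spec ℓ ⊥ (-1 / 2)) / n)) vacuum := by
  rw [sKet, transpose_bot]
  congr 2
  ext w S
  rw [raiseOp, ← tsum_neg]
  exact tsum_congr fun n => by ring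

/-- The exponent -p_n(q^{-1/2} x) equals (-1)^{n-1} p_n(-q^{-1/2} x), which accounts for both the
transposed diagram and the sign. -/
theorem sKet_bot_mayaOf (hℓ : ‖Complex.exp ℓ‖ < 1) (lam : YoungDiagram) :
    sKet ℓ ⊥ (mayaOf lam) = normKet ℓ ⊥ *
      ((-qPow ℓ (-1 / 2)) ^ lam.card * skewSchur lam.transpose ⊥ (spec ℓ ⊥ 0)) := by
  let L : BoundedDiagram lam.card := ⟨lam, le_rfl⟩
  let o : BoundedDiagram lam.card := ⟨⊥, Nat.zero_le _⟩
  rw [sKet_bot_eq, Pi.smul_apply, smul_eq_mul, show mayaOf lam = mayaOf L.1 from rfl,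
    opExp_raiseOp, vertexMatrix_congr (c' := fun n =>
      (-1) ^ (n - 1) * ((-qPow ℓ (-1 / 2)) ^ n * powerSum n (spec ℓ ⊥ 0)) / n), Matrix.mulVec,
    dotProduct, Finset.sum_eq_single o]
  · rw [vertexMatrix_apply_transpose (summable_spec hℓ _ _) (neg_ne_zero.2 (qPow_ne_zero _ _))]
    simp only [truncate, o, L, mayaOf_bot, vacuum_eq, basisVec_self, transpose_bot, card_bot,
      pow_zero, inv_one, mul_one]
  · intro eta _ heta
    rw [truncate, vacuum_eq, basisVec_of_ne, mul_zero]
    rw [← mayaOf_bot]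
    exact fun h => heta (Subtype.ext (mayaOf_injective h))
  · intro h; exact absurd (Finset.mem_univ _) h
  · intro n hn
    rw [neg_one_pow_pred hn, powerSum_spec, neg_pow (qPow ℓ (-1 / 2))]
    have : (-1 : ℂ) ^ n * (-1) ^ n = 1 := by rw [← mul_pow]; simp
    linear_combination (-(qPow ℓ (-1 / 2)) ^ n * powerSum n (spec ℓ ⊥ 0) / n) * -this

theorem sKet_bot_of_excess {S : Maya} (hS : excess 1 S ≠ 0) : sKet ℓ ⊥ S = 0 := by
  rw [sKet_bot_eq, Pi.smul_apply, opExp_raiseOp_eq_zero (fun _ => vacuum_of_excess) hS, smul_zero]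

theorem sBra_bot (hℓ : ‖Complex.exp ℓ‖ < 1) {K : ℕ} {w : Maya → ℂ}
    (hw : ∀ eta : YoungDiagram, K < eta.card → w (mayaOf eta) = 0) :
    sBra ℓ ⊥ w = normKet ℓ ⊥ * ∑ lam : BoundedDiagram K,
      w (mayaOf lam.1) * (qPow ℓ (1 / 2) ^ lam.1.card * skewSchur lam.1 ⊥ (spec ℓ ⊥ 0)) := by
  let o : BoundedDiagram K := ⟨⊥, Nat.zero_le _⟩
  have h : (fun (w : Maya → ℂ) S => ∑' n : ℕ+, (1 / (n : ℂ)) *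
      (powerSum n (spec ℓ ⊥ (1 / 2)) * aMode (n : ℤ) w S)) =
      lowerOp fun n => powerSum n (spec ℓ ⊥ (1 / 2)) / n := by
    ext w S
    exact tsum_congr fun n => by ring
  rw [sBra, normBra_bot, bra_vacuum, h, ← mayaOf_bot, show (⊥ : YoungDiagram) = o.1 from rfl,
    opExp_lowerOp hw, vertexMatrix_congr (c' := fun n =>
      qPow ℓ (1 / 2) ^ n * powerSum n (spec ℓ ⊥ 0) / n), Matrix.vecMul, dotProduct]
  · congr 1
    refine Finset.sum_congr rfl fun lam _ => ?_
    rw [vertexMatrix_apply (summable_spec hℓ _ _) (qPow_ne_zero _ _)]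
    simp [truncate, o, card_bot]
  · intro n _
    rw [show o.1 = ⊥ from rfl, powerSum_spec]

theorem tsum_eq_sum_boundedDiagram {K : ℕ} {f : YoungDiagram → ℂ}
    (hf : ∀ eta, K < eta.card → f eta = 0) : ∑' eta, f eta = ∑ eta : BoundedDiagram K, f eta.1 := by
  rw [tsum_eq_sum (s := (Finset.univ : Finset (BoundedDiagram K)).map (Function.Embedding.subtype _)),
    Finset.sum_map]
  · rfl
  · intro eta heta
    refine hf eta ?_
    by_contra h
    exact heta (Finset.mem_map.2 ⟨⟨eta, not_lt.1 h⟩, Finset.mem_univ _, rfl⟩)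

theorem vertexC_eq (hℓ : ‖Complex.exp ℓ‖ < 1) {K : ℕ} (lam : YoungDiagram) {mu : YoungDiagram}
    (hmu : mu.card ≤ K) (nu : YoungDiagram) :
    vertexC ℓ lam mu nu = qKappa ℓ mu * skewSchur nu.transpose ⊥ (spec ℓ ⊥ 0) *
      ∑ eta : BoundedDiagram K, skewSchur lam.transpose eta.1 (spec ℓ nu 0) *
        skewSchur mu eta.1 (spec ℓ nu.transpose 0) := by
  rw [vertexC, tsum_eq_sum_boundedDiagram]
  intro eta heta
  rw [skewSchur_eq_zero (lam := mu) (summable_spec hℓ _ _) (hmu.trans_lt heta), mul_zero]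

theorem frame_zpow (lam : YoungDiagram) (N : ℤ) :
    frame ℓ lam ^ N = ((-1) ^ N) ^ lam.card * qPow ℓ (N / 2 * kappa lam) := by
  rw [frame, mul_zpow, qKappa, qPow_zpow, ← zpow_natCast, ← zpow_natCast, ← zpow_mul, ← zpow_mul,
    mul_comm N]
  congr 2; ring

theorem exists_card_bound {s : Set Maya} (hs : s.Finite) :
    ∃ K : ℕ, ∀ lam : YoungDiagram, mayaOf lam ∈ s → lam.card ≤ K := by
  have h := (hs.preimage mayaOf_injective.injOn).image YoungDiagram.card
  obtain ⟨K, hK⟩ := h.bddAbove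
  exact ⟨K, fun lam hlam => hK ⟨lam, hlam, rfl⟩⟩

theorem PhiStar_mayaOf (N : ℤ) (v : Maya →₀ ℂ) (lam mu : YoungDiagram) {K : ℕ}
    (hK : ∀ eta : YoungDiagram, K < eta.card → v (mayaOf eta) = 0) :
    PhiStar ℓ N v (mayaOf lam, mayaOf mu) = ∑ nu : BoundedDiagram K,
      phiStarCoeff ℓ N lam mu nu.1 *
        ((-1) ^ lam.card * (-1) ^ mu.card * ((-1) ^ nu.1.card * v (mayaOf nu.1))) := by
  let e : BoundedDiagram K ↪ YoungDiagram × YoungDiagram × YoungDiagram :=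
    ⟨fun nu => (lam, mu, nu.1), fun a b h => Subtype.ext (by simpa using h)⟩
  rw [PhiStar, tsum_eq_sum (s := Finset.univ.map e), Finset.sum_map]
  · refine Finset.sum_congr rfl fun nu _ => ?_
    rw [show e nu = (lam, mu, nu.1) from rfl]
    simp only [ket_self, bra_ket]
  · rintro ⟨a, b, c⟩ ht
    by_cases ha : lam = a
    · by_cases hb : mu = b
      · rw [bra_ket, hK c, mul_zero, mul_zero, mul_zero]
        by_contra hc
        exact ht (Finset.mem_map.2 ⟨⟨c, not_lt.1 hc⟩, Finset.mem_univ _, by rw [← ha, ← hb]; rfl⟩)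
      · rw [ket_of_ne hb]; ring
    · rw [ket_of_ne ha]; ring

theorem Phi_mayaOf (N : ℤ) (v : Maya × Maya →₀ ℂ) (nu : YoungDiagram) {K : ℕ}
    (hK : ∀ lam mu : YoungDiagram, K < lam.card ∨ K < mu.card → v (mayaOf lam, mayaOf mu) = 0) :
    Phi ℓ N v (mayaOf nu) = ∑ lam : BoundedDiagram K, ∑ mu : BoundedDiagram K,
      phiCoeff ℓ N lam.1 mu.1 nu * ((-1) ^ lam.1.card *
        ((-1) ^ mu.1.card * v (mayaOf lam.1, mayaOf mu.1)) * (-1) ^ nu.card) := by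
  let e : BoundedDiagram K × BoundedDiagram K ↪ YoungDiagram × YoungDiagram × YoungDiagram :=
    ⟨fun p => (p.1.1, p.2.1, nu), fun a b h => by
      simp only [Prod.mk.injEq, and_true] at h
      exact Prod.ext (Subtype.ext h.1) (Subtype.ext h.2)⟩
  rw [Phi, tsum_eq_sum (s := Finset.univ.map e), Finset.sum_map, ← Fintype.sum_prod_type']
  · refine Finset.sum_congr rfl fun p _ => ?_
    rw [show e p = (p.1.1, p.2.1, nu) from rfl]
    simp only [ket_self, bra_ket]
  · rintro ⟨a, b, c⟩ ht
    by_cases hc : nu = c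
    · rw [bra_ket, bra_ket, hK a b, mul_zero, mul_zero, zero_mul, mul_zero]
      by_contra! hab
      exact ht (Finset.mem_map.2 ⟨(⟨a, hab.1⟩, ⟨b, hab.2⟩), Finset.mem_univ _, by rw [← hc]; rfl⟩)
    · rw [ket_of_ne hc]; ring

theorem qOp_wHat_eq_zero (c : ℂ) {w : Maya → ℂ} {S : Maya} (h : w S = 0) :
    qOp ℓ c wHat w S = 0 := by
  rw [qOp, opExp_diagonal (c := fun S => c * ℓ * excess (fun m => ((m : ℂ) + 1 / 2) ^ 2) S), h,
    mul_zero]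
  intro w S
  rw [Pi.smul_apply, wHat_apply, smul_eq_mul]; ring

theorem qOp_L0_eq_zero (c : ℂ) {w : Maya → ℂ} {S : Maya} (h : w S = 0) : qOp ℓ c L0 w S = 0 := by
  rw [qOp, opExp_diagonal (c := fun S => c * ℓ * S.inversions.card), h, mul_zero]
  intro w S
  rw [Pi.smul_apply, L0_apply, smul_eq_mul]; ring

theorem opExp_pairOp_zero (α β : ℕ → ℂ) {w : Maya × Maya → ℂ} (hw : ∀ x, w x = 0)
    (x : Maya × Maya) : opExp (pairOp α β) w x = 0 := by
  refine opExp_eq_zero (P := fun _ => True) (fun w hw x _ => ?_) (fun x _ => hw x) trivial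
  simp only [pairOp]
  rw [← tsum_zero]
  refine tsum_congr fun n : ℕ+ => ?_
  have h0 : ((n : ℕ) : ℤ) ≠ 0 := by exact_mod_cast n.ne_zero
  have h1 : ∀ x, w x = 0 := fun x => hw x trivial
  simp only [h1, aMode_zero h0, aMode_zero (neg_ne_zero.2 h0), mul_zero, add_zero]

/-- Here the signs combine to p_n(-q^{±1/2} x), so no transposition occurs. -/
theorem vertexMatrix_bilinStar (hℓ : ‖Complex.exp ℓ‖ < 1) {K : ℕ} (lam : YoungDiagram)
    (mu eta : BoundedDiagram K) :
    vertexMatrix K (fun n => -(-1) ^ n * bEigen ℓ n (mayaOf lam) / n) mu eta =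
        (-qPow ℓ (1 / 2)) ^ mu.1.card * skewSchur mu.1 eta.1 (spec ℓ lam 0) *
          ((-qPow ℓ (1 / 2)) ^ eta.1.card)⁻¹ ∧
      vertexMatrix K (fun n => (-1) ^ n * bEigen ℓ (-n) (mayaOf lam) / n) mu eta =
        (-qPow ℓ (-1 / 2)) ^ mu.1.card * skewSchur mu.1 eta.1 (spec ℓ lam.transpose 0) *
          ((-qPow ℓ (-1 / 2)) ^ eta.1.card)⁻¹ := by
  constructor
  · rw [← vertexMatrix_apply (summable_spec hℓ _ _) (neg_ne_zero.2 (qPow_ne_zero _ _))]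
    refine congrFun (congrFun (vertexMatrix_congr fun n hn => ?_) mu) eta
    rw [bEigen_pos hℓ lam hn, powerSum_spec, neg_pow (qPow ℓ (1 / 2))]
    ring
  · rw [← vertexMatrix_apply (summable_spec hℓ _ _) (neg_ne_zero.2 (qPow_ne_zero _ _))]
    refine congrFun (congrFun (vertexMatrix_congr fun n hn => ?_) mu) eta
    rw [bEigen_neg hℓ lam hn, powerSum_spec, neg_pow (qPow ℓ (-1 / 2))]
    ring

/-- Here a factor (-1)^{n-1} is left over, whence the transposed diagrams. -/
theorem vertexMatrix_bilin (hℓ : ‖Complex.exp ℓ‖ < 1) {K : ℕ} (lam : YoungDiagram)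
    (mu eta : BoundedDiagram K) :
    vertexMatrix K (fun n => (-1) ^ n * bEigen ℓ n (mayaOf lam) / n) mu eta =
        qPow ℓ (1 / 2) ^ mu.1.card *
          skewSchur mu.1.transpose eta.1.transpose (spec ℓ lam 0) *
          (qPow ℓ (1 / 2) ^ eta.1.card)⁻¹ ∧
      vertexMatrix K (fun n => -(-1) ^ n * bEigen ℓ (-n) (mayaOf lam) / n) mu eta =
        qPow ℓ (-1 / 2) ^ mu.1.card *
          skewSchur mu.1.transpose eta.1.transpose (spec ℓ lam.transpose 0) *
          (qPow ℓ (-1 / 2) ^ eta.1.card)⁻¹ := by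
  constructor
  · rw [← vertexMatrix_apply_transpose (summable_spec hℓ _ _) (qPow_ne_zero _ _)]
    refine congrFun (congrFun (vertexMatrix_congr fun n hn => ?_) mu) eta
    rw [bEigen_pos hℓ lam hn, powerSum_spec, neg_one_pow_pred hn]
    ring
  · rw [← vertexMatrix_apply_transpose (summable_spec hℓ _ _) (qPow_ne_zero _ _)]
    refine congrFun (congrFun (vertexMatrix_congr fun n hn => ?_) mu) eta
    rw [bEigen_neg hℓ lam hn, powerSum_spec, neg_one_pow_pred hn]

end

end FreeFermion
end

noncomputable section
namespace FreeFermion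
open Maya

/-! ### The two identities -/

/-- Comparison of prefactors, with s = (-1)^N, a = q^{1/2}, k = q^{κ_μ/2}, c = 𝒩_∅; l, m, n, h are
the sizes of λ, μ, ν, η. The powers with exponent h cancel, since the two exponentials carry inverse
scalings. -/
theorem phiStar_scalar {s a k c : ℂ} (hs : s * s = 1) (ha : a ≠ 0) (hk : k ≠ 0) (hc : c ≠ 0)
    (l m n h : ℕ) (Q S A B v : ℂ) :
    (s * a) ^ l * (s ^ l * Q) * ((-a⁻¹) ^ m * ((-1) ^ m * k)⁻¹) * a ^ n * (k * S * (A * B)) *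
        ((-1) ^ l * (-1) ^ m * ((-1) ^ n * v)) =
      c⁻¹ * ((-a⁻¹) ^ m * B * ((-a⁻¹) ^ h)⁻¹ * ((-a) ^ n * A * ((-a) ^ h)⁻¹ *
        (Q * ((a * a) ^ l * (c * ((-a⁻¹) ^ l * S))) * v))) := by
  have h1 : (s * a) ^ l * s ^ l = a ^ l := by
    rw [← mul_pow]; congr 1; linear_combination a * hs
  have h2 : ((-1 : ℂ) ^ m * k)⁻¹ * k * (-1) ^ m = 1 := by
    have : (-1 : ℂ) ^ m ≠ 0 := by simp
    field_simp
  have h3 : ((-a⁻¹) ^ h)⁻¹ * ((-a) ^ h)⁻¹ = 1 := by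
    rw [← mul_inv, ← mul_pow, neg_mul_neg, inv_mul_cancel₀ ha, one_pow, inv_one]
  have h4 : (a * a) ^ l * (-a⁻¹) ^ l = a ^ l * (-1) ^ l := by
    rw [← mul_pow, ← mul_pow]; congr 1; field_simp
  calc _ = (s * a) ^ l * s ^ l * (((-1 : ℂ) ^ m * k)⁻¹ * k * (-1) ^ m) *
        (Q * (-a⁻¹) ^ m * a ^ n * S * A * B * ((-1) ^ l * ((-1) ^ n * v))) := by ring
    _ = c⁻¹ * c * (((-a⁻¹) ^ h)⁻¹ * ((-a) ^ h)⁻¹) * ((a * a) ^ l * (-a⁻¹) ^ l) *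
        ((-a⁻¹) ^ m * B * ((-a) ^ n * A) * Q * S * v) := by
      rw [h1, h2, h3, h4, inv_mul_cancel₀ hc, neg_pow a n]; ring
    _ = _ := by ring

theorem phi_scalar {s a k c : ℂ} (hs : s * s = 1) (ha : a ≠ 0) (hk : k ≠ 0) (hc : c ≠ 0)
    (l m n h : ℕ) (Q S A B v : ℂ) :
    (-s * a⁻¹) ^ l * (s ^ l * Q) * (a ^ m * ((-1) ^ m * k)) * (-a⁻¹) ^ n * (k⁻¹ * S * (B * A)) *
        ((-1) ^ l * ((-1) ^ m * v) * (-1) ^ n) =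
      c⁻¹ * (c * ((a⁻¹ * a⁻¹) ^ l * (Q * ((a⁻¹) ^ n * B * ((a⁻¹) ^ h)⁻¹ *
        (a ^ m * A * (a ^ h)⁻¹ * v))) * (a ^ l * S))) := by
  have h1 : (-s * a⁻¹) ^ l * s ^ l * (-1) ^ l = (a⁻¹) ^ l := by
    rw [← mul_pow, ← mul_pow]; congr 1; linear_combination a⁻¹ * hs
  have h2 : ∀ m, (-1 : ℂ) ^ m * (-1) ^ m = 1 := fun m => by rw [← mul_pow]; simp
  have h3 : ((a⁻¹) ^ h)⁻¹ * (a ^ h)⁻¹ = 1 := by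
    rw [← mul_inv, ← mul_pow, inv_mul_cancel₀ ha, one_pow, inv_one]
  have h4 : (a⁻¹ * a⁻¹) ^ l * a ^ l = (a⁻¹) ^ l := by
    rw [← mul_pow]; congr 1; field_simp
  calc _ = (-s * a⁻¹) ^ l * s ^ l * (-1) ^ l * ((-1) ^ m * (-1) ^ m) * ((-1) ^ n * (-1) ^ n) *
        (k * k⁻¹) * (Q * a ^ m * (a⁻¹) ^ n * S * B * A * v) := by rw [neg_pow a⁻¹ n]; ring
    _ = c⁻¹ * c * (((a⁻¹) ^ h)⁻¹ * (a ^ h)⁻¹) * ((a⁻¹ * a⁻¹) ^ l * a ^ l) *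
        (Q * a ^ m * (a⁻¹) ^ n * S * B * A * v) := by
      rw [h1, h2, h2, h3, h4, inv_mul_cancel₀ hc, mul_inv_cancel₀ hk]; ring
    _ = _ := by ring

theorem neg_one_zpow_mul_self (N : ℤ) : (-1 : ℂ) ^ N * (-1) ^ N = 1 := by
  rw [← mul_zpow]; simp

section

variable {ℓ : ℂ}

theorem qPow_neg_half : qPow ℓ (-1 / 2) = (qPow ℓ (1 / 2))⁻¹ := by
  rw [← qPow_neg]; congr 1; ring

theorem qPow_natCast_mul (l : ℕ) :
    qPow ℓ (1 * l) = (qPow ℓ (1 / 2) * qPow ℓ (1 / 2)) ^ l ∧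
      qPow ℓ (-1 * l) = ((qPow ℓ (1 / 2))⁻¹ * (qPow ℓ (1 / 2))⁻¹) ^ l := by
  constructor
  · rw [← qPow_add, qPow_pow]; congr 1; ring
  · rw [← qPow_neg, ← qPow_add, qPow_pow]; congr 1; ring

theorem PhiStar_eq_mayaOf (hℓ : ‖Complex.exp ℓ‖ < 1) (N : ℤ) (v : Maya →₀ ℂ)
    (lam mu : YoungDiagram) :
    PhiStar ℓ N v (mayaOf lam, mayaOf mu) = (normKet ℓ ⊥)⁻¹ *
      opExp (bilinStar ℓ) (on1 (qOp ℓ (N / 2) wHat) (on1 (qOp ℓ 1 L0)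
        (fun x => sKet ℓ ⊥ x.1 * vacuum x.2.1 * v x.2.2))) (mayaOf lam, mayaOf mu, vac) := by
  obtain ⟨K₀, hK₀⟩ := exists_card_bound v.support.finite_toSet
  -- K has to bound the support of v and mu; the diagram lam is only a parameter.
  obtain ⟨K, hK₀K, hmu⟩ : ∃ K, K₀ ≤ K ∧ mu.card ≤ K :=
    ⟨max K₀ mu.card, le_max_left _ _, le_max_right _ _⟩
  have hK : ∀ eta : YoungDiagram, K < eta.card → v (mayaOf eta) = 0 := by
    intro eta heta
    by_contra hc
    exact absurd (hK₀ eta (Finsupp.mem_support_iff.2 hc)) (by omega)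
  let c : ℂ := qPow ℓ (N / 2 * kappa lam) * (qPow ℓ (1 * lam.card) * sKet ℓ ⊥ (mayaOf lam))
  have hslice : (fun p : Maya × Maya => on1 (qOp ℓ (N / 2) wHat) (on1 (qOp ℓ 1 L0)
      (fun x => sKet ℓ ⊥ x.1 * vacuum x.2.1 * v x.2.2)) (mayaOf lam, p.1, p.2)) =
      fun p => vacuum p.1 * (c * v p.2) := by
    ext p
    simp only [on1, qOp_wHat, qOp_L0, c]
    ring
  rw [PhiStar_mayaOf N v lam mu hK, opExp_bilinStar, hslice,
    show mayaOf mu = mayaOf (⟨mu, hmu⟩ : BoundedDiagram K).1 from rfl,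
    opExp_pairOp (v := fun R => c * v R) fun eta heta => by rw [hK eta heta, mul_zero]]
  simp only [Matrix.mulVec, dotProduct, Matrix.transpose_apply, vertexMatrix_bilinStar hℓ,
    truncate, Finset.mul_sum]
  rw [Finset.sum_comm]
  refine Finset.sum_congr rfl fun nu _ => ?_
  rw [phiStarCoeff, vertexC_eq hℓ nu.1.transpose hmu lam]
  simp only [YoungDiagram.transpose_transpose, Finset.mul_sum, Finset.sum_mul]
  refine Finset.sum_congr rfl fun eta _ => ?_
  simp only [c, sKet_bot_mayaOf hℓ, frame_zpow, qPow_neg_half, qPow_natCast_mul]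
  rw [frame]
  exact phiStar_scalar (neg_one_zpow_mul_self N) (qPow_ne_zero _ _) (qPow_ne_zero _ _)
    (normKet_bot_ne_zero hℓ) _ _ _ _ _ _ _ _ _

theorem PhiStar_eq_zero (N : ℤ) (v : Maya →₀ ℂ) {S T : Maya}
    (h : excess 1 S ≠ 0 ∨ excess 1 T ≠ 0) : PhiStar ℓ N v (S, T) = 0 := by
  rw [PhiStar, ← tsum_zero]
  refine tsum_congr fun t => ?_
  rcases h with h | h
  · rw [ket_of_excess h]; ring
  · simp only [ket_of_excess h]; ring

theorem opExp_bilinStar_eq_zero (N : ℤ) (v : Maya → ℂ) {S T : Maya}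
    (h : excess 1 S ≠ 0 ∨ excess 1 T ≠ 0) (R : Maya) :
    opExp (bilinStar ℓ) (on1 (qOp ℓ (N / 2) wHat) (on1 (qOp ℓ 1 L0)
        (fun x => sKet ℓ ⊥ x.1 * vacuum x.2.1 * v x.2.2))) (S, T, R) = 0 := by
  rw [opExp_bilinStar]
  rcases h with h | h
  · refine opExp_pairOp_zero _ _ (fun p => ?_) _
    refine qOp_wHat_eq_zero _ (qOp_L0_eq_zero _ ?_)
    simp only [sKet_bot_of_excess h, zero_mul]
  · refine opExp_pairOp_eq_zero (fun T R hT => ?_) h R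
    refine qOp_wHat_eq_zero _ (qOp_L0_eq_zero _ ?_)
    simp only [vacuum_of_excess hT, mul_zero, zero_mul]

theorem Phi_eq_mayaOf (hℓ : ‖Complex.exp ℓ‖ < 1) (N : ℤ) (v : Maya × Maya →₀ ℂ)
    (nu : YoungDiagram) :
    Phi ℓ N v (mayaOf nu) = (normKet ℓ ⊥)⁻¹ * sBra ℓ ⊥ (fun S =>
      on1 (qOp ℓ (-1) L0) (on1 (qOp ℓ (-(N / 2)) wHat)
        (opExp (bilin ℓ) (fun x => v (x.1, x.2.1) * vacuum x.2.2))) (S, vac, mayaOf nu)) := by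
  obtain ⟨K₁, hK₁⟩ := exists_card_bound (v.support.finite_toSet.image Prod.fst)
  obtain ⟨K₂, hK₂⟩ := exists_card_bound (v.support.finite_toSet.image Prod.snd)
  obtain ⟨K, hK₁K, hK₂K, hnu⟩ : ∃ K, K₁ ≤ K ∧ K₂ ≤ K ∧ nu.card ≤ K :=
    ⟨K₁ + K₂ + nu.card, by omega, by omega, by omega⟩
  have hK1 : ∀ (lam : YoungDiagram) T, K < lam.card → v (mayaOf lam, T) = 0 := by
    intro lam T h
    by_contra hc
    exact absurd (hK₁ lam ⟨_, Finsupp.mem_support_iff.2 hc, rfl⟩) (by omega)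
  have hK2 : ∀ S (mu : YoungDiagram), K < mu.card → v (S, mayaOf mu) = 0 := by
    intro S mu h
    by_contra hc
    exact absurd (hK₂ mu ⟨_, Finsupp.mem_support_iff.2 hc, rfl⟩) (by omega)
  have hslice : ∀ S, (fun p : Maya × Maya => v (S, p.2) * vacuum p.1) =
      fun p => vacuum p.1 * v (S, p.2) := fun S => funext fun p => mul_comm _ _
  rw [Phi_mayaOf N v nu (K := K) fun lam mu h => h.elim (hK1 lam _) (hK2 _ mu),
    sBra_bot hℓ (K := K)]
  · simp only [on1, qOp_wHat, qOp_L0, opExp_bilin, hslice]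
    rw [show mayaOf nu = mayaOf (⟨nu, hnu⟩ : BoundedDiagram K).1 from rfl]
    rw [Finset.mul_sum, Finset.mul_sum]
    refine Finset.sum_congr rfl fun lam _ => ?_
    rw [opExp_pairOp (v := fun R => v (mayaOf lam.1, R)) fun eta heta => hK2 _ eta heta]
    simp only [Matrix.mulVec, dotProduct, Matrix.transpose_apply, vertexMatrix_bilin hℓ,
      truncate, Finset.mul_sum, Finset.sum_mul]
    rw [Finset.sum_comm]
    refine Finset.sum_congr rfl fun mu _ => ?_
    -- The exponentials produce transposed intermediate diagrams, so the sum over η in the vertex is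
    -- reindexed by transposition.
    rw [phiCoeff, vertexC_eq hℓ nu (mu := mu.1.transpose) ((card_transpose mu.1).trans_le mu.2),
      ← (transposeEquiv K).sum_comp]
    simp only [YoungDiagram.transpose_transpose, Finset.mul_sum, Finset.sum_mul]
    refine Finset.sum_congr rfl fun eta _ => ?_
    have hkap : qKappa ℓ mu.1.transpose = (qKappa ℓ mu.1)⁻¹ := by
      rw [qKappa, qKappa, ← qPow_neg, kappa_transpose]
      congr 1; push_cast; ring
    have hN : ((-N : ℤ) : ℂ) / 2 = -(N / 2) := by push_cast; ring
    have hs : (-1 : ℂ) ^ (-N) = (-1) ^ N := by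
      rw [zpow_neg]; exact inv_eq_of_mul_eq_one_left (neg_one_zpow_mul_self N)
    simp only [frame_zpow, qPow_neg_half, qPow_natCast_mul, hkap, hN, hs]
    rw [frame]
    exact phi_scalar (neg_one_zpow_mul_self N) (qPow_ne_zero _ _) (qPow_ne_zero _ _)
      (normKet_bot_ne_zero hℓ) _ _ _ _ _ _ _ _ _
  · intro lam hlam
    simp only [on1, qOp_wHat, qOp_L0, opExp_bilin, hK1 lam _ hlam, zero_mul]
    rw [opExp_pairOp_zero _ _ fun _ => rfl, mul_zero, mul_zero]

theorem Phi_eq_zero (N : ℤ) (v : Maya × Maya →₀ ℂ) {R : Maya} (h : excess 1 R ≠ 0) :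
    Phi ℓ N v R = 0 := by
  rw [Phi, ← tsum_zero]
  exact tsum_congr fun t => by rw [ket_of_excess h]; ring

theorem on1_opExp_bilin_eq_zero (N : ℤ) (v : Maya × Maya → ℂ) {R : Maya} (h : excess 1 R ≠ 0)
    (S T : Maya) :
    on1 (qOp ℓ (-1) L0) (on1 (qOp ℓ (-(N / 2)) wHat)
        (opExp (bilin ℓ) (fun x => v (x.1, x.2.1) * vacuum x.2.2))) (S, T, R) = 0 := by
  refine qOp_L0_eq_zero _ (qOp_wHat_eq_zero _ ?_)
  simp only [opExp_bilin]
  refine opExp_pairOp_eq_zero (fun R T hR => ?_) h T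
  simp only [vacuum_of_excess hR, mul_zero]

theorem sBra_bot_zero (hℓ : ‖Complex.exp ℓ‖ < 1) : sBra ℓ ⊥ (fun _ => 0) = 0 := by
  rw [sBra_bot hℓ (K := 0) fun _ _ => rfl]
  simp

end

end FreeFermion
end

theorem mainTheorem2 (ℓ : ℂ) (hℓ : ‖Complex.exp ℓ‖ < 1) (N : ℤ) :
    (∀ (v : Maya →₀ ℂ) (S T : Maya),
      PhiStar ℓ N v (S, T) =
        (normKet ℓ ⊥)⁻¹ *
          bra vacuum (fun R =>
            opExp (bilinStar ℓ)
              (on1 (qOp ℓ (N / 2) wHat) (on1 (qOp ℓ 1 L0)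
                (fun x => sKet ℓ ⊥ x.1 * vacuum x.2.1 * v x.2.2)))
              (S, T, R))) ∧
    (∀ (v : Maya × Maya →₀ ℂ) (R : Maya),
      Phi ℓ N v R =
        (normKet ℓ ⊥)⁻¹ *
          bra vacuum (fun T =>
            sBra ℓ ⊥ (fun S =>
              on1 (qOp ℓ (-1) L0) (on1 (qOp ℓ (-(N / 2)) wHat)
                (opExp (bilin ℓ) (fun x => v (x.1, x.2.1) * vacuum x.2.2)))
              (S, T, R)))) := by
  refine ⟨fun v S T => ?_, fun v R => ?_⟩
  · rw [bra_vacuum]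
    -- Both sides vanish unless all output charges are zero, and then the output components are
    -- Young diagrams.
    by_cases h : Maya.excess 1 S ≠ 0 ∨ Maya.excess 1 T ≠ 0
    · rw [PhiStar_eq_zero N v h, opExp_bilinStar_eq_zero N v h, mul_zero]
    · rw [not_or, not_not, not_not] at h
      obtain ⟨lam, rfl⟩ := exists_mayaOf h.1
      obtain ⟨mu, rfl⟩ := exists_mayaOf h.2
      exact PhiStar_eq_mayaOf hℓ N v lam mu
  · rw [bra_vacuum]
    by_cases h : Maya.excess 1 R = 0
    · obtain ⟨nu, rfl⟩ := exists_mayaOf h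
      exact Phi_eq_mayaOf hℓ N v nu
    · simp only [Phi_eq_zero N v h, on1_opExp_bilin_eq_zero N v h, sBra_bot_zero hℓ, mul_zero]
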